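/- **Theorem 7.3.** Notation. Let $A,b,d>0$ and $N\in\mathbb N$. Put $\Omega=(-A,A)^3$, $\mathbf x=(x,y,z)$, $\mathbf x_0(s)=(s,0,-A-b)$ for $s\in(-d,d)$, and $\Omega_\varepsilon=\{\mathbf x\in\Omega: z<A-\varepsilon\}$ for $\varepsilon\in(0,A)$. All functions are real valued. $H^k_N(\Omega)$ is the space of $N$-vectors with components in the Sobolev space $H^k(\Omega)$, with $\|D\|^2_{H^k_N(\Omega)}=\sum_j\|D_j\|^2_{H^k(\Omega)}$. Let $\Psi_1,\dots,\Psi_N$ be the functions obtained from $e^{s},se^{s},\dots,s^{N-1}e^{s}$ by Gram–Schmidt orthonormalization in $L_2(-d,d)$, and let $M=\big(\int_{-d}^d\Psi_n'\Psi_m\,ds\big)_{m,n=1}^N$ (row $m$, column $n$). Let $L(U)=\Delta U+A_1(\mathbf x)U_x+A_2(\mathbf x)U_y+A_3(\mathbf x)U_z+A_0(\mathbf x)U$, where $A_j=-M^{-1}E_j$ for $j=1,2,3$, $A_0=M^{-1}E_0$ and $$(E_j)_{mn}(\mathbf x)=\int_{-d}^{d}\partial_s\!\left[\frac{2(\mathbf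 x-\mathbf x_0(s))_j}{|\mathbf x-\mathbf x_0(s)|^2}\Psi_n(s)\right]\Psi_m(s)\,ds,\qquad (E_0)_{mn}(\mathbf x)=\int_{-d}^{d}\partial_s\!\left[\frac{4}{|\mathbf x-\mathbf x_0(s)|^2}\Psi_n(s)\right]\Psi_m(s)\,ds .$$ The norm of a matrix function in $C_{N^2}(\overline\Omega)$ is the square root of the sum of the squares of the maximum norms of its entries. For $s\in(-d,d)$ and $U=(u_1,\dots,u_N)\in H^3_N(\Omega)$ put $u(\mathbf x,s)=\sum_{n=1}^N u_n(\mathbf x)\Psi_n(s)$. The coefficient reconstructed from $U$ is the function $q$ determined, with $s=0$, by $$\Delta u-\frac{2}{|\mathbf x-\mathbf x_0(s)|^2}\Big((\mathbf x-\mathbf x_0(s))\cdot\nabla u-2u\Big)=-\frac{q(\mathbf x)}{2\pi},\qquad \mathbf x\in\Omega .$$ Let $S=\{z=-A\}\cap\partial\Omega$ and let $n$ be the outward normal. Let $H^3_{0,bsc,N}(\Omega)$ be the space of $V\in H^3_N(\Omega)$ with $V=0$ on $S$ and $\partial_nV=0$ on $\partial\Omega\setminus\{z=A\}$. We say that $G\in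 H^3_N(\Omega)$ satisfies the boundary conditions with data $(\varphi_0,\varphi_1)$ if $G=\varphi_0$ and $\partial_nG=\varphi_1$ on $S$, and $\partial_nG=0$ on the other five faces (all in the sense of traces). For $F\in H^3_N(\Omega)$, $\gamma>0$ and $V\in H^3_{0,bsc,N}(\Omega)$ let $J_\gamma(V)=\int_\Omega|L(V+F)|^2d\mathbf x+\gamma\|V\|^2_{H^3_N(\Omega)}$. Statement. For every $A>0$ and $\varepsilon\in(0,A)$ there is a number $\alpha\in(0,1/2)$, depending only on $A$ and $\varepsilon$; for every $A>0$ and $K$ there is a constant $B>0$, depending only on $A$ and $K$; and for all $A,K,\varepsilon$ there is $\delta_0\in(0,1)$, depending only on $A,K,\varepsilon$, such that the following holds. Let $b,d,N$ be such that the $C_{N^2}(\overline\Omega)$-norms of $A_0,A_1,A_2,A_3$ are at most $K$. Let $\delta\in(0,\delta_0)$. Let $U^*,F_1^*\in H^3_N(\Omega)$ satisfy the boundary conditions with the same (noiseless) data $(\varphi_0^*,\varphi_1^*)$, with $L(U^*)=0$ in $\Omega$; let $F_1\in H^3_N(\Omega)$ satisfy the boundary conditions with some (noisy) data $(\varphi_0,\varphi_1)$,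 with $\|F_1-F_1^*\|_{H^2_N(\Omega)}\le\delta$. Let $V_{\min,\delta}$ be the minimizer of $J_{\delta^2}$, with $F=F_1$, on $H^3_{0,bsc,N}(\Omega)$, and let $U_{\min,\delta}=V_{\min,\delta}+F_1$. Then $$\|U_{\min,\delta}-U^*\|_{H^2_N(\Omega_\varepsilon)}\le B\big(1+\|U^*\|_{H^3_N(\Omega)}+\|F_1^*\|_{H^3_N(\Omega)}\big)\delta^{\alpha}.$$ If, moreover, $1/b\le K$ and $\big(\sum_{n=1}^N\Psi_n(0)^2\big)^{1/2}\le K$ (so for every $b,d,N$ once $K$ is large enough), then the coefficients $q_{\min,\delta}$ and $q^*$ reconstructed from $U_{\min,\delta}$ and $U^*$ satisfy, with the same $\alpha$, $$\|q_{\min,\delta}-q^*\|_{L_2(\Omega_\varepsilon)}\le B\big(1+\|U^*\|_{H^3_N(\Omega)}+\|F_1^*\|_{H^3_N(\Omega)}\big)\delta^{\alpha}.$$ -/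

import Mathlib

open MeasureTheory Set
open scoped ContDiff

noncomputable section

namespace Lavrentev

/-- Three-dimensional Euclidean space; the coordinates `(x, y, z)` are `(x 0, x 1, x 2)`. -/
abbrev E3 : Type := EuclideanSpace ℝ (Fin 3)

/-! ### The domains -/

/-- The open cube `(-A, A)³`. -/
def cube (A : ℝ) : Set E3 := {x | ∀ i, -A < x i ∧ x i < A}

/-- The closed cube `[-A, A]³`. -/
def closedCube (A : ℝ) : Set E3 := {x | ∀ i, -A ≤ x i ∧ x i ≤ A}

/-- The subdomain `{-A < x, y < A, -A < z < A - ε}`. -/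
def cubeEps (A ε : ℝ) : Set E3 := {x | x ∈ cube A ∧ x 2 < A - ε}

/-- The point source `(s, 0, -A - b)`, on a line below the cube. -/
def source (A b s : ℝ) : E3 := !₂[s, 0, -A - b]

/-! ### Sobolev spaces `H^k` through weak derivatives -/

/-- The classical partial derivative in the `i`-th coordinate direction. -/
def partialD (i : Fin 3) (φ : E3 → ℝ) : E3 → ℝ :=
  fun x => fderiv ℝ φ x (EuclideanSpace.single i 1)

/-- The classical derivative `D^a` for a multi-index `a`. -/
def multiD (a : Fin 3 → ℕ) (φ : E3 → ℝ) : E3 → ℝ :=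
  (partialD 0)^[a 0] ((partialD 1)^[a 1] ((partialD 2)^[a 2] φ))

/-- `w` is the weak derivative `D^a u` on the open set `Ω`. -/
def IsWeakDeriv (Ω : Set E3) (a : Fin 3 → ℕ) (u w : E3 → ℝ) : Prop :=
  LocallyIntegrableOn u Ω ∧ LocallyIntegrableOn w Ω ∧
    ∀ φ : E3 → ℝ, ContDiff ℝ ∞ φ → HasCompactSupport φ → tsupport φ ⊆ Ω →
      ∫ x in Ω, u x * multiD a φ x = (-1) ^ (∑ i, a i) * ∫ x in Ω, w x * φ x

open Classical in
/-- A representative of the weak derivative `D^a u` on `Ω` (unique almost everywhere in `Ω`). It is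
meaningful when a weak derivative exists, and zero otherwise. -/
def weakDeriv (Ω : Set E3) (a : Fin 3 → ℕ) (u : E3 → ℝ) : E3 → ℝ :=
  if h : ∃ w, IsWeakDeriv Ω a u w then h.choose else 0

/-- The weak first order derivative in the `i`-th coordinate direction. -/
def weakD (Ω : Set E3) (i : Fin 3) (u : E3 → ℝ) : E3 → ℝ := weakDeriv Ω (Pi.single i 1) u

/-- The weak Laplacian `∑ i, ∂_i² u`. -/
def weakLaplacian (Ω : Set E3) (u : E3 → ℝ) : E3 → ℝ :=
  fun x => ∑ i, weakDeriv Ω (Pi.single i 2) u x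

/-- The multi-indices of order at most `k`. -/
def multiIndices (k : ℕ) : Finset (Fin 3 → ℕ) :=
  (Fintype.piFinset fun _ => Finset.range (k + 1)).filter fun a => ∑ i, a i ≤ k

/-- `u` belongs to `H^k(Ω)`: all weak derivatives up to order `k` exist and lie in `L²(Ω)`. -/
def MemH (k : ℕ) (Ω : Set E3) (u : E3 → ℝ) : Prop :=
  ∀ a ∈ multiIndices k, ∃ w, IsWeakDeriv Ω a u w ∧ MemLp w 2 (volume.restrict Ω)

/-- The squared norm of `H^k(Ω)`. -/
def hNormSq (k : ℕ) (Ω : Set E3) (u : E3 → ℝ) : ℝ :=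
  ∑ a ∈ multiIndices k, ∫ x in Ω, (weakDeriv Ω a u x) ^ 2

/-- The norm of `H^k_N(Ω)`, the space of `N`-vectors with components in `H^k(Ω)`. -/
def hNorm (k : ℕ) (Ω : Set E3) {N : ℕ} (U : Fin N → E3 → ℝ) : ℝ :=
  Real.sqrt (∑ n, hNormSq k Ω (U n))

/-- The norm of `L²(Ω)`. -/
def l2Norm (Ω : Set E3) (f : E3 → ℝ) : ℝ := Real.sqrt (∫ x in Ω, (f x) ^ 2)

/-! ### Boundary traces on the faces of the cube -/

/-- The point of the plane `{x_i = s A}` whose two other coordinates are `y`. -/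
def facePoint (A : ℝ) (i : Fin 3) (s : ℝ) (y : Fin 2 → ℝ) : E3 :=
  WithLp.toLp 2 (i.insertNth (s * A) y)

/-- The square `(-A, A)²`, which parametrizes each face. -/
def square (A : ℝ) : Set (Fin 2 → ℝ) := {y | ∀ j, -A < y j ∧ y j < A}

/-- For `u` in `H¹` of the cube, `g` is the trace of `u` on the open face `{x_i = s A}`, where
`s = 1` or `s = -1`: Green's formula holds against all test functions whose support meets the
boundary of the cube only in this face. -/
def HasFaceTrace (A : ℝ) (i : Fin 3) (s : ℝ) (u g : E3 → ℝ) : Prop :=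
  MemLp (fun y => g (facePoint A i s y)) 2 (volume.restrict (square A)) ∧
    ∀ φ : E3 → ℝ, ContDiff ℝ ∞ φ → HasCompactSupport φ →
      tsupport φ ⊆ {x | -A < s * x i ∧ ∀ j, j ≠ i → -A < x j ∧ x j < A} →
      ∫ x in cube A, (u x * partialD i φ x + weakD (cube A) i u x * φ x) =
        s * ∫ y in square A, g (facePoint A i s y) * φ (facePoint A i s y)

/-- `g` is the outward normal derivative of `u` on the face `{x_i = s A}`, `s = 1` or `s = -1`. -/
def HasNormalTrace (A : ℝ) (i : Fin 3) (s : ℝ) (u g : E3 → ℝ) : Prop :=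
  HasFaceTrace A i s (fun x => s * weakD (cube A) i u x) g

/-- The outward normal derivative of `u` vanishes on the four lateral faces. -/
def LateralNeumann (A : ℝ) (u : E3 → ℝ) : Prop :=
  ∀ i : Fin 3, i ≠ 2 → ∀ s : ℝ, s = 1 ∨ s = -1 → HasNormalTrace A i s u 0

/-- The subspace of functions `u` in `H³` of the cube such that `u = 0` on the bottom face and
`∂_n u = 0` on all faces but the top one. -/
def MemH0bsc (A : ℝ) (u : E3 → ℝ) : Prop :=
  MemH 3 (cube A) u ∧ HasFaceTrace A 2 (-1) u 0 ∧ HasNormalTrace A 2 (-1) u 0 ∧ LateralNeumann A u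

/-- The boundary conditions of the problem with backscattering data: Cauchy data `φ₀`, `φ₁` on the
bottom face, zero Neumann data on the lateral faces and on the top face. -/
def BoundaryConditions (A : ℝ) {N : ℕ} (φ₀ φ₁ U : Fin N → E3 → ℝ) : Prop :=
  ∀ n, HasFaceTrace A 2 (-1) (U n) (φ₀ n) ∧ HasNormalTrace A 2 (-1) (U n) (φ₁ n) ∧
    LateralNeumann A (U n) ∧ HasNormalTrace A 2 1 (U n) 0

/-! ### The orthonormal basis of `L²(-d, d)` -/

/-- One Gram-Schmidt step: subtract from `f` its projections on the functions `e i` and divide by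
the norm in `L²(-d, d)`. -/
def gramSchmidtStep (d : ℝ) {n : ℕ} (e : Fin n → ℝ → ℝ) (f : ℝ → ℝ) : ℝ → ℝ :=
  let r : ℝ → ℝ := fun t => f t - ∑ i, (∫ s in (-d)..d, f s * e i s) * e i t
  fun t => r t / Real.sqrt (∫ s in (-d)..d, (r s) ^ 2)

/-- The functions obtained from `t^n e^t`, `n = 0, 1, …`, by the Gram-Schmidt orthonormalization
in `L²(-d, d)`, numbered from zero. -/
def psi (d : ℝ) (n : ℕ) : ℝ → ℝ :=
  gramSchmidtStep d (fun i : Fin n => psi d i) fun t => t ^ n * Real.exp t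
termination_by n
decreasing_by exact i.2

/-- The matrix with entries `{Ψ_n', Ψ_m}` (row `m`, column `n`) for the first `N` functions. -/
def basisMatrix (d : ℝ) (N : ℕ) : Matrix (Fin N) (Fin N) ℝ :=
  Matrix.of fun m n => ∫ s in (-d)..d, deriv (psi d n) s * psi d m s

/-! ### The elliptic system -/

/-- The projection on `Ψ_m` of the derivative in the source position of
`2 (x - x₀)_j |x - x₀|⁻² Ψ_n`. -/
def rawFirst (A b d : ℝ) (N : ℕ) (j : Fin 3) (x : E3) : Matrix (Fin N) (Fin N) ℝ :=
  Matrix.of fun m n => ∫ s in (-d)..d,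
    deriv (fun t => 2 * (x - source A b t) j / ‖x - source A b t‖ ^ 2 * psi d n t) s * psi d m s

/-- The projection on `Ψ_m` of the derivative in the source position of `4 |x - x₀|⁻² Ψ_n`. -/
def rawZeroth (A b d : ℝ) (N : ℕ) (x : E3) : Matrix (Fin N) (Fin N) ℝ :=
  Matrix.of fun m n => ∫ s in (-d)..d,
    deriv (fun t => 4 / ‖x - source A b t‖ ^ 2 * psi d n t) s * psi d m s

/-- The coefficient matrix of `∂_j U` in the elliptic system. -/
def coeffFirst (A b d : ℝ) (N : ℕ) (j : Fin 3) (x : E3) : Matrix (Fin N) (Fin N) ℝ :=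
  -((basisMatrix d N)⁻¹ * rawFirst A b d N j x)

/-- The coefficient matrix of `U` in the elliptic system. -/
def coeffZeroth (A b d : ℝ) (N : ℕ) (x : E3) : Matrix (Fin N) (Fin N) ℝ :=
  (basisMatrix d N)⁻¹ * rawZeroth A b d N x

/-- The norm of a matrix function in `C_{N²}` of the closed cube: the Euclidean norm of the vector
of the maximum norms of the entries. -/
def matNorm (A : ℝ) {N : ℕ} (M : E3 → Matrix (Fin N) (Fin N) ℝ) : ℝ :=
  Real.sqrt (∑ m, ∑ n, (sSup ((fun x => |M x m n|) '' closedCube A)) ^ 2)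

/-- The operator `L(U) = ΔU + A₁ U_x + A₂ U_y + A₃ U_z + A₀ U`. -/
def opL (A b d : ℝ) {N : ℕ} (U : Fin N → E3 → ℝ) : Fin N → E3 → ℝ := fun m x =>
  weakLaplacian (cube A) (U m) x
    + ∑ j, ∑ n, coeffFirst A b d N j x m n * weakD (cube A) j (U n) x
    + ∑ n, coeffZeroth A b d N x m n * U n x

/-- The functional `J_γ(V) = ∫ |L(V + F)|² + γ ‖V‖²` with the norm of `H³_N` of the cube. -/
def functionalJ (A b d : ℝ) {N : ℕ} (F : Fin N → E3 → ℝ) (γ : ℝ) (V : Fin N → E3 → ℝ) : ℝ :=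
  (∫ x in cube A, ∑ m, (opL A b d (fun n x => V n x + F n x) m x) ^ 2)
    + γ * (hNorm 3 (cube A) V) ^ 2

/-- `V` minimizes `J_γ` over the vectors with components in the subspace `MemH0bsc`. -/
def IsMinimizer (A b d : ℝ) {N : ℕ} (F : Fin N → E3 → ℝ) (γ : ℝ) (V : Fin N → E3 → ℝ) : Prop :=
  (∀ n, MemH0bsc A (V n)) ∧
    ∀ W : Fin N → E3 → ℝ, (∀ n, MemH0bsc A (W n)) →
      functionalJ A b d F γ V ≤ functionalJ A b d F γ W

/-! ### Reconstruction of the coefficient -/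

/-- The truncated series `∑ n, u_n(x) Ψ_n(s)`. -/
def truncatedSeries (d : ℝ) {N : ℕ} (U : Fin N → E3 → ℝ) (s : ℝ) : E3 → ℝ :=
  fun x => ∑ n, U n x * psi d n s

/-- The coefficient `q` reconstructed from `U` with the source `x₀ = source A b s`: with the
truncated series `u`, it solves
`Δu - 2 |x - x₀|⁻² ((x - x₀) · ∇u - 2 u) = - q / (2 π)`. -/
def reconstruct (A b d : ℝ) {N : ℕ} (s : ℝ) (U : Fin N → E3 → ℝ) : E3 → ℝ := fun x =>
  -(2 * Real.pi) * (weakLaplacian (cube A) (truncatedSeries d U s) x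
    - 2 / ‖x - source A b s‖ ^ 2 *
      (∑ j, (x - source A b s) j * weakD (cube A) j (truncatedSeries d U s) x
        - 2 * truncatedSeries d U s x))

end Lavrentev

end

open MeasureTheory Set Filter Topology
open scoped ContDiff

noncomputable section

namespace Lavrentev

/-! ### Classical partial derivatives -/

/-! The error is governed by `W = V - (U' - F')`, which has zero Cauchy data on the bottom face and
zero Neumann data on the lateral faces. Write `M = 1 + ‖U'‖ + ‖F'‖` with `H³` norms. The vector `U'
- F'` is an admissible competitor in the minimization, and since `L U' = 0` its residual is `L (F -
F')`, of size `O(δ)`. Minimality with parameter `δ²` therefore gives `∫ |L W|² = O(δ² M²)` together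
with an `H³` bound on `V` of size `O(M)`, free of `δ` (`BoundaryConditions.energy`).

The stability of the ill-posed Cauchy problem comes from a Carleman estimate with weight `exp (2 l
(A + 1 - z)²)`, which is largest at the bottom and decreases towards the top (`ZeroJet.carleman`). A
cutoff in `z` removes the top face, about which nothing is assumed. For large `l` the lower order
terms of `L` are absorbed, and the commutator with the cutoff lives where the weight is smaller than
on the subdomain (`exists_first_order_estimate`). Taking `l` with `exp (2 l (2 A + 1)²) = 1 / δ`
turns the two exponentials into powers of `δ`. Second derivatives follow from the identity `∫ |D²u|²
= ∫ |Δu|²` for functions with these boundary values (`exists_second_order_estimate`).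

The outcome is `‖error‖² ≤ C M² δ^(4α)` with `C` depending on `ε` (`exists_error_estimate`). Since
`B` may not depend on `ε`, half of the exponent is given away: for small `δ` the factor `C δ^(2α)`
is at most one, so `B = 1` works. The reconstructed coefficient is linear in the vector and of
second order, hence inherits the rate (`sq_l2Norm_reconstruct_sub_le`).

Boundary values enter only through `Green`: a zero trace on a face means that test functions may be
nonzero there. One integration by parts for pairs of Sobolev functions, `Green.integral_by_parts`,
replaces trace theory. The number `N` never enters a constant, because matrices are measured in the
Frobenius norm. -/

lemma contDiff_partialD {φ : E3 → ℝ} (h : ContDiff ℝ ∞ φ) (i : Fin 3) :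
    ContDiff ℝ ∞ (partialD i φ) :=
  (h.fderiv_right (m := ∞) (by simp)).clm_apply contDiff_const

lemma contDiff_iterate_partialD {φ : E3 → ℝ} (h : ContDiff ℝ ∞ φ) (i : Fin 3) (n : ℕ) :
    ContDiff ℝ ∞ ((partialD i)^[n] φ) := by
  induction n with
  | zero => exact h
  | succ n ih => rw [Function.iterate_succ_apply']; exact contDiff_partialD ih i

lemma contDiff_multiD {φ : E3 → ℝ} (h : ContDiff ℝ ∞ φ) (a : Fin 3 → ℕ) :
    ContDiff ℝ ∞ (multiD a φ) :=
  contDiff_iterate_partialD (contDiff_iterate_partialD (contDiff_iterate_partialD h _ _) _ _) _ _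

lemma tsupport_partialD (φ : E3 → ℝ) (i : Fin 3) : tsupport (partialD i φ) ⊆ tsupport φ := by
  refine closure_minimal (fun x hx => ?_) (isClosed_tsupport φ)
  by_contra hn
  apply hx
  have : fderiv ℝ φ x = 0 := by
    by_contra h
    exact hn (tsupport_fderiv_subset ℝ (subset_tsupport _ h))
  simp [partialD, this]

lemma tsupport_iterate_partialD (φ : E3 → ℝ) (i : Fin 3) (n : ℕ) :
    tsupport ((partialD i)^[n] φ) ⊆ tsupport φ := by
  induction n with
  | zero => exact subset_rfl
  | succ n ih => rw [Function.iterate_succ_apply']; exact (tsupport_partialD _ i).trans ih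

lemma tsupport_multiD (φ : E3 → ℝ) (a : Fin 3 → ℕ) : tsupport (multiD a φ) ⊆ tsupport φ :=
  ((tsupport_iterate_partialD _ _ _).trans (tsupport_iterate_partialD _ _ _)).trans
    (tsupport_iterate_partialD _ _ _)

lemma hasCompactSupport_partialD {φ : E3 → ℝ} (h : HasCompactSupport φ) (i : Fin 3) :
    HasCompactSupport (partialD i φ) :=
  h.of_isClosed_subset (isClosed_tsupport _) (tsupport_partialD φ i)

lemma partialD_comm {φ : E3 → ℝ} (h : ContDiff ℝ ∞ φ) (i j : Fin 3) :
    partialD i (partialD j φ) = partialD j (partialD i φ) := by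
  have hd : Differentiable ℝ (fderiv ℝ φ) :=
    (h.fderiv_right (m := ∞) (by simp)).differentiable (by simp)
  have key : ∀ (k l : Fin 3) (x : E3), partialD k (partialD l φ) x =
      fderiv ℝ (fderiv ℝ φ) x (EuclideanSpace.single k 1) (EuclideanSpace.single l 1) := by
    intro k l x
    have := (hd x).hasFDerivAt.clm_apply (hasFDerivAt_const (EuclideanSpace.single l (1 : ℝ)) x)
    change fderiv ℝ (fun y => fderiv ℝ φ y (EuclideanSpace.single l 1)) x
      (EuclideanSpace.single k 1) = _
    rw [this.fderiv]
    simp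
  ext x
  rw [key, key]
  exact (h.contDiffAt.isSymmSndFDerivAt
    (by simpa using WithTop.coe_le_coe.2 (le_top : (2 : ℕ∞) ≤ ⊤))).eq _ _

lemma iterate_partialD_comm {φ : E3 → ℝ} (h : ContDiff ℝ ∞ φ) (i j : Fin 3) (n : ℕ) :
    (partialD i)^[n] (partialD j φ) = partialD j ((partialD i)^[n] φ) := by
  induction n with
  | zero => rfl
  | succ n ih =>
    rw [Function.iterate_succ_apply', ih, Function.iterate_succ_apply',
      partialD_comm (contDiff_iterate_partialD h i n)]

lemma multiD_zero (φ : E3 → ℝ) : multiD 0 φ = φ := rfl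

/-- `multiD` fixes an order of differentiation, so the innermost derivative has to be commuted into
its place. -/
lemma multiD_partialD {φ : E3 → ℝ} (h : ContDiff ℝ ∞ φ) (a : Fin 3 → ℕ) (i : Fin 3) :
    multiD a (partialD i φ) = multiD (a + Pi.single i 1) φ := by
  have h2 := contDiff_iterate_partialD h 2 (a 2)
  have h1 := contDiff_iterate_partialD h2 1 (a 1)
  fin_cases i
  · simp [multiD, iterate_partialD_comm h, iterate_partialD_comm h2]
  · simp [multiD, iterate_partialD_comm h]
  · simp [multiD]

lemma multiD_single (φ : E3 → ℝ) (i : Fin 3) : multiD (Pi.single i 1) φ = partialD i φ := by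
  fin_cases i <;> rfl

lemma partialD_mul {f g : E3 → ℝ} (hf : ContDiff ℝ ∞ f) (hg : ContDiff ℝ ∞ g) (i : Fin 3) (x : E3) :
    partialD i (fun y => f y * g y) x = partialD i f x * g x + f x * partialD i g x := by
  have h1 := ((hf.differentiable (by simp)) x).hasFDerivAt
  have h2 := ((hg.differentiable (by simp)) x).hasFDerivAt
  have h3 : HasFDerivAt (fun y => f y * g y) _ x := h1.mul h2
  rw [partialD, h3.fderiv]
  simp [partialD]
  ring

lemma partialD_comp_coord {m : ℝ → ℝ} (hm : ContDiff ℝ ∞ m) (k i : Fin 3) (x : E3) :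
    partialD i (fun y => m (y k)) x = if k = i then deriv m (x k) else 0 := by
  have h1 : HasFDerivAt (fun y : E3 => y k) (EuclideanSpace.proj k : E3 →L[ℝ] ℝ) x :=
    (EuclideanSpace.proj k : E3 →L[ℝ] ℝ).hasFDerivAt
  have h2 : HasDerivAt m (deriv m (x k)) (x k) :=
    ((hm.differentiable (by simp)) _).hasDerivAt
  have h3 := h2.comp_hasFDerivAt x h1
  rw [partialD, show (fun y : E3 => m (y k)) = m ∘ fun y : E3 => y k from rfl, h3.fderiv]
  simp

lemma contDiff_comp_coord {m : ℝ → ℝ} (hm : ContDiff ℝ ∞ m) (k : Fin 3) :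
    ContDiff ℝ ∞ (fun y : E3 => m (y k)) :=
  hm.comp (EuclideanSpace.proj k : E3 →L[ℝ] ℝ).contDiff

/-! ### The domains -/

lemma continuous_coord (i : Fin 3) : Continuous fun x : E3 => x i :=
  (EuclideanSpace.proj i : E3 →L[ℝ] ℝ).continuous

lemma isOpen_cube (A : ℝ) : IsOpen (cube A) := by
  have h : cube A = ⋂ i : Fin 3, {x : E3 | -A < x i} ∩ {x : E3 | x i < A} := by
    ext x
    simp [cube]
  rw [h]
  refine isOpen_iInter_of_finite fun i => ?_
  exact (isOpen_lt continuous_const (continuous_coord i)).inter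
    (isOpen_lt (continuous_coord i) continuous_const)

lemma isOpen_cubeEps (A ε : ℝ) : IsOpen (cubeEps A ε) :=
  (isOpen_cube A).inter (isOpen_lt (continuous_coord 2) continuous_const)

lemma cubeEps_subset (A ε : ℝ) : cubeEps A ε ⊆ cube A := fun _ h => h.1

lemma cube_subset_closedCube (A : ℝ) : cube A ⊆ closedCube A :=
  fun _ h i => ⟨(h i).1.le, (h i).2.le⟩

lemma isCompact_closedCube (A : ℝ) : IsCompact (closedCube A) := by
  have h : closedCube A = (EuclideanSpace.equiv (Fin 3) ℝ).toHomeomorph ⁻¹'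
      (Icc (fun _ => -A) (fun _ => A)) := by
    ext x
    simp only [closedCube, mem_ofPred_eq, mem_preimage, mem_Icc, Pi.le_def]
    exact forall_and
  rw [h]
  exact (Homeomorph.isCompact_preimage _).2 isCompact_Icc

instance isFiniteMeasure_cube (A : ℝ) : IsFiniteMeasure (volume.restrict (cube A)) :=
  ⟨by
    rw [Measure.restrict_apply_univ]
    exact (measure_mono (cube_subset_closedCube A)).trans_lt (isCompact_closedCube A).measure_lt_top⟩

/-! ### Weak derivatives -/

lemma integrableOn_mul_of_tsupport {Ω : Set E3} {f φ : E3 → ℝ}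
    (hΩ : MeasurableSet Ω) (hf : LocallyIntegrableOn f Ω)
    (hφ : Continuous φ) (hc : HasCompactSupport φ) (hs : tsupport φ ⊆ Ω) :
    IntegrableOn (fun x => f x * φ x) Ω := by
  have h1 : IntegrableOn f (tsupport φ) := hf.integrableOn_compact_subset hs hc
  have h2 : IntegrableOn (fun x => f x * φ x) (tsupport φ) :=
    h1.mul_continuousOn hφ.continuousOn hc
  refine h2.of_forall_sdiff_eq_zero hΩ fun x hx => ?_
  simp [image_eq_zero_of_notMem_tsupport hx.2]

lemma locallyIntegrableOn_of_memLp {Ω : Set E3} {f : E3 → ℝ} (hf : MemLp f 2 (volume.restrict Ω)) :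
    LocallyIntegrableOn f Ω :=
  locallyIntegrableOn_of_locallyIntegrable_restrict (hf.locallyIntegrable (by norm_num))

/-- The fundamental lemma of the calculus of variations. As `weakDeriv` is an arbitrary choice of
representative, its values can be identified only almost everywhere, always by way of this lemma. -/
lemma IsWeakDeriv.ae_unique {Ω : Set E3} (hΩ : IsOpen Ω) {a : Fin 3 → ℕ} {u w₁ w₂ : E3 → ℝ}
    (h₁ : IsWeakDeriv Ω a u w₁) (h₂ : IsWeakDeriv Ω a u w₂) : w₁ =ᵐ[volume.restrict Ω] w₂ := by
  have h := hΩ.ae_eq_zero_of_integral_contDiff_smul_eq_zero (μ := volume)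
    (f := fun x => w₁ x - w₂ x) (h₁.2.1.sub h₂.2.1) (fun φ hφ hc hs => by
      have e : ∀ w : E3 → ℝ, LocallyIntegrableOn w Ω → IntegrableOn (fun x => w x * φ x) Ω :=
        fun w hw => integrableOn_mul_of_tsupport hΩ.measurableSet hw hφ.continuous hc hs
      have e1 := h₁.2.2 φ hφ hc hs
      have e2 := h₂.2.2 φ hφ hc hs
      rw [e1] at e2
      have e3 := mul_left_cancel₀ (pow_ne_zero _ (by norm_num : (-1 : ℝ) ≠ 0)) e2
      have e4 : ∫ x, φ x • (w₁ x - w₂ x) = ∫ x in Ω, φ x • (w₁ x - w₂ x) := by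
        symm
        apply setIntegral_eq_integral_of_forall_compl_eq_zero
        intro x hx
        simp [image_eq_zero_of_notMem_tsupport (fun h => hx (hs h))]
      rw [e4]
      have e5 : ∀ x, φ x • (w₁ x - w₂ x) = w₁ x * φ x - w₂ x * φ x := fun x => by
        simp only [smul_eq_mul]; ring
      simp only [e5]
      rw [integral_sub (e _ h₁.2.1) (e _ h₂.2.1), e3, sub_self])
  rw [Filter.EventuallyEq, ae_restrict_iff' hΩ.measurableSet]
  filter_upwards [h] with x hx hm
  exact sub_eq_zero.1 (hx hm)

lemma weakDeriv_isWeakDeriv {Ω : Set E3} {a : Fin 3 → ℕ} {u w : E3 → ℝ}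
    (h : IsWeakDeriv Ω a u w) : IsWeakDeriv Ω a u (weakDeriv Ω a u) := by
  have h' : ∃ w, IsWeakDeriv Ω a u w := ⟨w, h⟩
  rw [weakDeriv, dif_pos h']
  exact h'.choose_spec

lemma IsWeakDeriv.weakDeriv_ae {Ω : Set E3} (hΩ : IsOpen Ω) {a : Fin 3 → ℕ} {u w : E3 → ℝ}
    (h : IsWeakDeriv Ω a u w) : weakDeriv Ω a u =ᵐ[volume.restrict Ω] w :=
  (weakDeriv_isWeakDeriv h).ae_unique hΩ h

lemma IsWeakDeriv.zero {Ω : Set E3} {u : E3 → ℝ} (h : LocallyIntegrableOn u Ω) :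
    IsWeakDeriv Ω 0 u u :=
  ⟨h, h, fun φ _ _ _ => by simp [multiD_zero]⟩

lemma IsWeakDeriv.mono {Ω Ω' : Set E3} (hΩ' : MeasurableSet Ω) (hs : Ω' ⊆ Ω) {a : Fin 3 → ℕ}
    {u w : E3 → ℝ} (h : IsWeakDeriv Ω a u w) : IsWeakDeriv Ω' a u w := by
  refine ⟨h.1.mono_set hs, h.2.1.mono_set hs, fun φ hφ hc hsupp => ?_⟩
  have key : ∀ f ψ : E3 → ℝ, tsupport ψ ⊆ Ω' →
      ∫ x in Ω', f x * ψ x = ∫ x in Ω, f x * ψ x := by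
    intro f ψ hψ
    symm
    apply setIntegral_eq_of_subset_of_forall_sdiff_eq_zero hΩ' hs
    intro x hx
    simp [image_eq_zero_of_notMem_tsupport (fun h => hx.2 (hψ h))]
  rw [key u _ ((tsupport_multiD φ a).trans hsupp), key w _ hsupp]
  exact h.2.2 φ hφ hc (hsupp.trans hs)

lemma IsWeakDeriv.add {Ω : Set E3} (hΩ : IsOpen Ω) {a : Fin 3 → ℕ} {u w u' w' : E3 → ℝ}
    (h : IsWeakDeriv Ω a u w) (h' : IsWeakDeriv Ω a u' w') :
    IsWeakDeriv Ω a (fun x => u x + u' x) (fun x => w x + w' x) := by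
  refine ⟨h.1.add h'.1, h.2.1.add h'.2.1, fun φ hφ hc hs => ?_⟩
  have e : ∀ f ψ : E3 → ℝ, LocallyIntegrableOn f Ω → ContDiff ℝ ∞ ψ → tsupport ψ ⊆ tsupport φ →
      IntegrableOn (fun x => f x * ψ x) Ω := fun f ψ hf hψ ht =>
    integrableOn_mul_of_tsupport hΩ.measurableSet hf hψ.continuous
      (hc.of_isClosed_subset (isClosed_tsupport _) ht) (ht.trans hs)
  simp only [add_mul]
  rw [integral_add (e _ _ h.1 (contDiff_multiD hφ a) (tsupport_multiD φ a))
    (e _ _ h'.1 (contDiff_multiD hφ a) (tsupport_multiD φ a)),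
    integral_add (e _ _ h.2.1 hφ subset_rfl) (e _ _ h'.2.1 hφ subset_rfl),
    h.2.2 φ hφ hc hs, h'.2.2 φ hφ hc hs, mul_add]

lemma IsWeakDeriv.const_mul {Ω : Set E3} {a : Fin 3 → ℕ} {u w : E3 → ℝ}
    (h : IsWeakDeriv Ω a u w) (c : ℝ) :
    IsWeakDeriv Ω a (fun x => c * u x) (fun x => c * w x) := by
  refine ⟨h.1.smul c, h.2.1.smul c, fun φ hφ hc hs => ?_⟩
  simp only [mul_assoc]
  rw [integral_const_mul, integral_const_mul, h.2.2 φ hφ hc hs]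
  ring

lemma IsWeakDeriv.sub {Ω : Set E3} (hΩ : IsOpen Ω) {a : Fin 3 → ℕ} {u w u' w' : E3 → ℝ}
    (h : IsWeakDeriv Ω a u w) (h' : IsWeakDeriv Ω a u' w') :
    IsWeakDeriv Ω a (fun x => u x - u' x) (fun x => w x - w' x) := by
  simpa [sub_eq_add_neg] using h.add hΩ (h'.const_mul (-1))

lemma IsWeakDeriv.sum {Ω : Set E3} (hΩ : IsOpen Ω) {a : Fin 3 → ℕ} {ι : Type*} (s : Finset ι)
    {u w : ι → E3 → ℝ} (h : ∀ n ∈ s, IsWeakDeriv Ω a (u n) (w n)) :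
    IsWeakDeriv Ω a (fun x => ∑ n ∈ s, u n x) (fun x => ∑ n ∈ s, w n x) := by
  classical
  induction s using Finset.induction_on with
  | empty =>
    simp only [Finset.sum_empty]
    exact ⟨locallyIntegrableOn_zero, locallyIntegrableOn_zero, fun φ _ _ _ => by simp⟩
  | insert n s hn ih =>
    simp only [Finset.sum_insert hn]
    exact (h n (by simp)).add hΩ (ih fun m hm => h m (by simp [hm]))

/-- Differentiating a weak derivative once more. -/
lemma IsWeakDeriv.step {Ω : Set E3} {a : Fin 3 → ℕ} {i : Fin 3} {u w v : E3 → ℝ}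
    (h : IsWeakDeriv Ω a u w) (h' : IsWeakDeriv Ω (a + Pi.single i 1) u v) :
    IsWeakDeriv Ω (Pi.single i 1) w v := by
  refine ⟨h.2.1, h'.2.1, fun φ hφ hc hs => ?_⟩
  have e1 := h.2.2 (partialD i φ) (contDiff_partialD hφ i) (hasCompactSupport_partialD hc i)
    ((tsupport_partialD φ i).trans hs)
  have e2 := h'.2.2 φ hφ hc hs
  rw [multiD_partialD hφ, e2] at e1
  rw [multiD_single]
  have hs1 : ∑ j, (Pi.single i 1 : Fin 3 → ℕ) j = 1 := by simp
  simp only [Pi.add_apply, Finset.sum_add_distrib, hs1, pow_succ] at e1 ⊢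
  have h3 : ((-1 : ℝ) ^ (∑ j, a j)) ≠ 0 := pow_ne_zero _ (by norm_num)
  apply mul_left_cancel₀ h3
  linarith

lemma mem_multiIndices {k : ℕ} {a : Fin 3 → ℕ} : a ∈ multiIndices k ↔ ∑ i, a i ≤ k := by
  simp only [multiIndices, Finset.mem_filter, Fintype.mem_piFinset, Finset.mem_range,
    and_iff_right_iff_imp]
  intro h i
  have := Finset.single_le_sum (f := a) (fun _ _ => Nat.zero_le _) (Finset.mem_univ i)
  omega

lemma MemH.spec {k : ℕ} {Ω : Set E3} (hΩ : IsOpen Ω) {u : E3 → ℝ} (h : MemH k Ω u)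
    {a : Fin 3 → ℕ} (ha : ∑ i, a i ≤ k) :
    IsWeakDeriv Ω a u (weakDeriv Ω a u) ∧ MemLp (weakDeriv Ω a u) 2 (volume.restrict Ω) := by
  obtain ⟨w, hw, hm⟩ := h a (mem_multiIndices.2 ha)
  exact ⟨weakDeriv_isWeakDeriv hw, hm.ae_eq (hw.weakDeriv_ae hΩ).symm⟩

lemma MemH.weakDeriv_zero_ae {k : ℕ} {Ω : Set E3} (hΩ : IsOpen Ω) {u : E3 → ℝ} (h : MemH k Ω u) :
    weakDeriv Ω 0 u =ᵐ[volume.restrict Ω] u :=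
  (IsWeakDeriv.zero (h.spec hΩ (a := 0) (by simp)).1.1).weakDeriv_ae hΩ

lemma MemH.memLp {k : ℕ} {Ω : Set E3} (hΩ : IsOpen Ω) {u : E3 → ℝ} (h : MemH k Ω u) :
    MemLp u 2 (volume.restrict Ω) :=
  (h.spec hΩ (a := 0) (by simp)).2.ae_eq (h.weakDeriv_zero_ae hΩ)

lemma MemH.add {k : ℕ} {Ω : Set E3} (hΩ : IsOpen Ω) {u v : E3 → ℝ} (h : MemH k Ω u)
    (h' : MemH k Ω v) : MemH k Ω (fun x => u x + v x) := fun a ha => by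
  obtain ⟨w, hw, hm⟩ := h a ha
  obtain ⟨w', hw', hm'⟩ := h' a ha
  exact ⟨_, hw.add hΩ hw', hm.add hm'⟩

lemma MemH.sub {k : ℕ} {Ω : Set E3} (hΩ : IsOpen Ω) {u v : E3 → ℝ} (h : MemH k Ω u)
    (h' : MemH k Ω v) : MemH k Ω (fun x => u x - v x) := fun a ha => by
  obtain ⟨w, hw, hm⟩ := h a ha
  obtain ⟨w', hw', hm'⟩ := h' a ha
  exact ⟨_, hw.sub hΩ hw', hm.sub hm'⟩

lemma MemH.mono {k l : ℕ} (hkl : k ≤ l) {Ω : Set E3} {u : E3 → ℝ} (h : MemH l Ω u) :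
    MemH k Ω u := fun a ha =>
  h a (mem_multiIndices.2 ((mem_multiIndices.1 ha).trans hkl))

lemma MemH.weakDeriv_add {k : ℕ} {Ω : Set E3} (hΩ : IsOpen Ω) {u v : E3 → ℝ} (h : MemH k Ω u)
    (h' : MemH k Ω v) {a : Fin 3 → ℕ} (ha : ∑ i, a i ≤ k) :
    weakDeriv Ω a (fun x => u x + v x) =ᵐ[volume.restrict Ω]
      fun x => weakDeriv Ω a u x + weakDeriv Ω a v x :=
  ((h.spec hΩ ha).1.add hΩ (h'.spec hΩ ha).1).weakDeriv_ae hΩ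

lemma MemH.weakDeriv_sub {k : ℕ} {Ω : Set E3} (hΩ : IsOpen Ω) {u v : E3 → ℝ} (h : MemH k Ω u)
    (h' : MemH k Ω v) {a : Fin 3 → ℕ} (ha : ∑ i, a i ≤ k) :
    weakDeriv Ω a (fun x => u x - v x) =ᵐ[volume.restrict Ω]
      fun x => weakDeriv Ω a u x - weakDeriv Ω a v x :=
  ((h.spec hΩ ha).1.sub hΩ (h'.spec hΩ ha).1).weakDeriv_ae hΩ

lemma MemH.weakDeriv_restrict {k : ℕ} {Ω Ω' : Set E3} (hΩ : IsOpen Ω) (hΩ' : IsOpen Ω')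
    (hs : Ω' ⊆ Ω) {u : E3 → ℝ} (h : MemH k Ω u) {a : Fin 3 → ℕ} (ha : ∑ i, a i ≤ k) :
    weakDeriv Ω' a u =ᵐ[volume.restrict Ω'] weakDeriv Ω a u :=
  ((h.spec hΩ ha).1.mono hΩ.measurableSet hs).weakDeriv_ae hΩ'

/-! ### Mollification -/

/-- The convolution of `h` with the normalized bump function `f`. -/
def mollify (f : ContDiffBump (0 : E3)) (h : E3 → ℝ) : E3 → ℝ :=
  convolution (f.normed volume) h (ContinuousLinearMap.lsmul ℝ ℝ) volume

lemma mollify_eq (f : ContDiffBump (0 : E3)) (h : E3 → ℝ) (x : E3) :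
    mollify f h x = ∫ y, f.normed volume (x - y) * h y := by
  rw [mollify, convolution_eq_swap]
  rfl

lemma integrable_bump_mul (f : ContDiffBump (0 : E3)) {h : E3 → ℝ} (hh : Integrable h) (x : E3) :
    Integrable fun y => f.normed volume (x - y) * h y := by
  obtain ⟨C, hC⟩ := f.hasCompactSupport_normed.exists_bound_of_continuous
    (f.continuous_normed (μ := volume))
  refine hh.bdd_mul (c := C) ?_ (ae_of_all _ fun y => hC _)
  exact (f.continuous_normed.comp (by fun_prop)).aestronglyMeasurable

lemma contDiff_mollify (f : ContDiffBump (0 : E3)) {h : E3 → ℝ} (hh : Integrable h) :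
    ContDiff ℝ ∞ (mollify f h) :=
  f.hasCompactSupport_normed.contDiff_convolution_left _ f.contDiff_normed hh.locallyIntegrable

lemma partialD_mollify (f : ContDiffBump (0 : E3)) {h : E3 → ℝ} (hh : Integrable h) (i : Fin 3)
    (x : E3) : partialD i (mollify f h) x = ∫ y, partialD i (f.normed volume) (x - y) * h y := by
  have h1 := (f.hasCompactSupport_normed (μ := volume)).hasFDerivAt_convolution_left
    (ContinuousLinearMap.lsmul ℝ ℝ) f.contDiff_normed hh.locallyIntegrable x
  have h2 := ((f.hasCompactSupport_normed (μ := volume)).fderiv ℝ).convolutionExists_left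
    (ContinuousLinearMap.precompL E3 (ContinuousLinearMap.lsmul ℝ ℝ))
    ((f.contDiff_normed (n := 1)).continuous_fderiv (by simp)) hh.locallyIntegrable x
  rw [partialD, mollify, h1.fderiv, convolution_eq_swap,
    ContinuousLinearMap.integral_apply h2.integrable_swap]
  rfl

/-- Jensen's inequality for the probability density `f.normed volume (x - y)`: the variance `∫ θ (h
- S)²` about the mean `S` is nonnegative. -/
lemma sq_mollify_le (f : ContDiffBump (0 : E3)) {h : E3 → ℝ} (hh : Integrable h)
    (h2 : Integrable fun x => h x ^ 2) (x : E3) :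
    mollify f h x ^ 2 ≤ mollify f (fun x => h x ^ 2) x := by
  set S := mollify f h x with hS
  have hθ : Integrable fun y => f.normed volume (x - y) :=
    (f.integrable_normed (μ := volume)).comp_sub_left x
  have e0 : ∫ y, f.normed volume (x - y) = 1 := by
    rw [integral_sub_left_eq_self (fun y => f.normed volume y), f.integral_normed]
  have i1 := integrable_bump_mul f hh x
  have i2 := integrable_bump_mul f h2 x
  have e : ∫ y, f.normed volume (x - y) * (h y - S) ^ 2 =
      mollify f (fun x => h x ^ 2) x - 2 * S * S + S ^ 2 := by
    have : ∀ y, f.normed volume (x - y) * (h y - S) ^ 2 =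
        f.normed volume (x - y) * h y ^ 2 - 2 * S * (f.normed volume (x - y) * h y)
          + S ^ 2 * f.normed volume (x - y) := fun y => by ring
    simp only [this]
    have i3 : Integrable fun y => f.normed volume (x - y) * h y ^ 2
        - 2 * S * (f.normed volume (x - y) * h y) := i2.sub (i1.const_mul _)
    rw [integral_add i3 (hθ.const_mul _), integral_sub i2 (i1.const_mul _),
      integral_const_mul, integral_const_mul, e0, ← mollify_eq, ← mollify_eq, ← hS]
    ring
  have p : 0 ≤ ∫ y, f.normed volume (x - y) * (h y - S) ^ 2 :=
    integral_nonneg fun y => mul_nonneg (f.nonneg_normed _) (sq_nonneg _)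
  nlinarith

/-- Mollification does not increase the `L²` norm, and the dilation by `c ≥ 1` contributes the
Jacobian `c⁻³ ≤ 1`. The bound is thus uniform in both parameters. -/
lemma integral_sq_mollify_le (f : ContDiffBump (0 : E3)) {h : E3 → ℝ} (hh : Integrable h)
    (h2 : Integrable fun x => h x ^ 2) {c : ℝ} (hc : 1 ≤ c) :
    Integrable (fun x => mollify f h (c • x) ^ 2) ∧
      ∫ x, mollify f h (c • x) ^ 2 ≤ ∫ x, h x ^ 2 := by
  have i1 : Integrable (mollify f fun x => h x ^ 2) :=
    (f.integrable_normed (μ := volume)).integrable_convolution _ h2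
  have i2 : ∫ x, mollify f (fun x => h x ^ 2) x = ∫ x, h x ^ 2 := by
    have := integral_convolution (ContinuousLinearMap.lsmul ℝ ℝ)
      (f.integrable_normed (μ := volume)) h2
    rw [mollify, this, f.integral_normed]
    simp
  have i3 : Integrable fun x => mollify f (fun x => h x ^ 2) (c • x) :=
    i1.comp_smul (by positivity)
  have cont : Continuous fun x => mollify f h (c • x) ^ 2 :=
    ((contDiff_mollify f hh).continuous.comp (by fun_prop)).pow 2
  have i4 : Integrable (fun x => mollify f h (c • x) ^ 2) :=
    i3.mono' cont.aestronglyMeasurable (ae_of_all _ fun x => by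
      rw [Real.norm_of_nonneg (sq_nonneg _)]
      exact sq_mollify_le f hh h2 _)
  refine ⟨i4, (integral_mono i4 i3 fun x => sq_mollify_le f hh h2 _).trans ?_⟩
  rw [Measure.integral_comp_smul, i2, abs_of_nonneg (by positivity), smul_eq_mul]
  refine mul_le_of_le_one_left (integral_nonneg fun x => sq_nonneg _) ?_
  exact inv_le_one_of_one_le₀ (one_le_pow₀ hc)

lemma abs_integral_mul_le {X : Type*} [MeasurableSpace X] {μ : Measure X} {f g : X → ℝ}
    (hf : Integrable (fun x => f x ^ 2) μ) (hg : Integrable (fun x => g x ^ 2) μ) {m : ℝ}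
    (hm : 0 < m) :
    |∫ x, f x * g x ∂μ| ≤ (m * ∫ x, f x ^ 2 ∂μ) + m⁻¹ * ∫ x, g x ^ 2 ∂μ := by
  rw [← integral_const_mul, ← integral_const_mul,
    ← integral_add (hf.const_mul _) (hg.const_mul _), ← Real.norm_eq_abs]
  refine norm_integral_le_of_norm_le ((hf.const_mul _).add (hg.const_mul _)) (ae_of_all _ ?_)
  intro x
  rw [Real.norm_eq_abs, abs_le]
  have e : m * m⁻¹ = 1 := mul_inv_cancel₀ hm.ne'
  have p : 0 < m⁻¹ := inv_pos.2 hm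
  constructor
  · have : 0 ≤ m * (f x + m⁻¹ * g x) ^ 2 := by positivity
    have e2 : m * (f x + m⁻¹ * g x) ^ 2 = m * f x ^ 2 + m⁻¹ * g x ^ 2 + 2 * (f x * g x) := by
      linear_combination (2 * f x * g x + m⁻¹ * g x ^ 2) * e
    nlinarith [mul_nonneg hm.le (sq_nonneg (f x)), mul_nonneg p.le (sq_nonneg (g x))]
  · have : 0 ≤ m * (f x - m⁻¹ * g x) ^ 2 := by positivity
    have e2 : m * (f x - m⁻¹ * g x) ^ 2 = m * f x ^ 2 + m⁻¹ * g x ^ 2 - 2 * (f x * g x) := by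
      linear_combination (-2 * f x * g x + m⁻¹ * g x ^ 2) * e
    nlinarith [mul_nonneg hm.le (sq_nonneg (f x)), mul_nonneg p.le (sq_nonneg (g x))]

/-- Weak convergence is all that the integration by parts needs. The mollify-and-dilate operators
are uniformly bounded on `L²`, so it suffices to treat a continuous compactly supported `β` close to
`h`, for which dominated convergence applies. -/
lemma tendsto_integral_mul_mollify {f : ℕ → ContDiffBump (0 : E3)} {c : ℕ → ℝ}
    (hf : Tendsto (fun n => (f n).rOut) atTop (𝓝 0)) (hc1 : ∀ n, 1 ≤ c n)
    (hc : Tendsto c atTop (𝓝 1)) {w h : E3 → ℝ} (hw : Integrable w)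
    (hw2 : Integrable fun x => w x ^ 2) (hh : Integrable h) (hh2 : MemLp h 2) :
    Tendsto (fun n => ∫ x, w x * mollify (f n) h (c n • x)) atTop (𝓝 (∫ x, w x * h x)) := by
  have hhi : Integrable fun x => h x ^ 2 := hh2.integrable_sq
  rw [Metric.tendsto_atTop]
  intro e he
  set W := ∫ x, w x ^ 2 with hW
  have hW0 : 0 ≤ W := integral_nonneg fun x => sq_nonneg _
  -- The parameter of the weighted Young inequality: it makes `m * W ≤ e / 6`, while the
  -- approximation error `m * (e / 6)` of `β` makes the other term at most `e / 6`.
  set m := e / (6 * (W + 1)) with hm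
  have hm0 : 0 < m := by positivity
  obtain ⟨β, hβc, hβs, hβ⟩ := MemLp.exist_eLpNorm_sub_le (by norm_num) (by norm_num) hh2
    (ε := Real.sqrt (m * (e / 6))) (by positivity)
  have hβ2 : MemLp β 2 := hβs.continuous.memLp_of_hasCompactSupport hβc
  have hβ1 : Integrable β := hβs.continuous.integrable_of_hasCompactSupport hβc
  have hd2 : MemLp (fun x => h x - β x) 2 := hh2.sub hβ2
  have hd1 : Integrable (fun x => h x - β x) := hh.sub hβ1
  have hdi : Integrable fun x => (h x - β x) ^ 2 := hd2.integrable_sq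
  have hdle : ∫ x, (h x - β x) ^ 2 ≤ m * (e / 6) := by
    have h1 := hd2.eLpNorm_eq_integral_rpow_norm (by norm_num) (by norm_num)
    have h2 : eLpNorm (fun x => h x - β x) 2 volume ≤ ENNReal.ofReal √(m * (e / 6)) := hβ
    rw [h1, ENNReal.ofReal_le_ofReal_iff (by positivity)] at h2
    simp only [ENNReal.toReal_ofNat, Real.rpow_ofNat, Real.norm_eq_abs, sq_abs] at h2
    rw [← one_div, ← Real.sqrt_eq_rpow] at h2
    exact (Real.sqrt_le_sqrt_iff (by positivity)).1 h2
  have bound : ∀ g : E3 → ℝ, Integrable (fun x => g x ^ 2) → (∫ x, g x ^ 2) ≤ m * (e / 6) →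
      |∫ x, w x * g x| ≤ e / 3 := by
    intro g hg hle
    refine (abs_integral_mul_le hw2 hg hm0).trans ?_
    have h1 : m * W ≤ e / 6 := by
      rw [hm, div_mul_eq_mul_div, div_le_div_iff₀ (by positivity) (by norm_num)]
      nlinarith
    have h2 : m⁻¹ * ∫ x, g x ^ 2 ≤ e / 6 := by
      calc m⁻¹ * ∫ x, g x ^ 2 ≤ m⁻¹ * (m * (e / 6)) := by gcongr
        _ = e / 6 := by field_simp
    linarith
  obtain ⟨C, hC⟩ := hβc.exists_bound_of_continuous hβs.continuous
  have hmb : ∀ n x, ‖mollify (f n) β x‖ ≤ C := by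
    intro n x
    rw [mollify_eq]
    have hθ : Integrable fun y => (f n).normed volume (x - y) :=
      ((f n).integrable_normed (μ := volume)).comp_sub_left x
    refine (norm_integral_le_of_norm_le (hθ.mul_const C) (ae_of_all _ fun y => ?_)).trans ?_
    · rw [norm_mul, Real.norm_of_nonneg ((f n).nonneg_normed _)]
      exact mul_le_mul_of_nonneg_left (hC y) ((f n).nonneg_normed _)
    · rw [integral_mul_const, integral_sub_left_eq_self (fun y => (f n).normed volume y),
        (f n).integral_normed, one_mul]
  have hmid : Tendsto (fun n => ∫ x, w x * mollify (f n) β (c n • x)) atTop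
      (𝓝 (∫ x, w x * β x)) := by
    refine tendsto_integral_of_dominated_convergence (fun x => ‖w x‖ * C) (fun n => ?_)
      (hw.norm.mul_const C) (fun n => ae_of_all _ fun x => ?_) (ae_of_all _ fun x => ?_)
    · exact hw.aestronglyMeasurable.mul
        (((contDiff_mollify (f n) hβ1).continuous.comp (by fun_prop)).aestronglyMeasurable)
    · rw [norm_mul]
      exact mul_le_mul_of_nonneg_left (hmb _ _) (norm_nonneg _)
    · refine Tendsto.const_mul _ ?_
      refine ContDiffBump.convolution_tendsto_right (g := fun _ => β) (k := fun n => c n • x)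
        (x₀ := x) hf (Eventually.of_forall fun _ => hβs.continuous.aestronglyMeasurable)
        ((hβs.continuous.tendsto x).comp tendsto_snd) ?_
      simpa using hc.smul_const x
  obtain ⟨n₀, hn₀⟩ := Metric.tendsto_atTop.1 hmid (e / 3) (by positivity)
  refine ⟨n₀, fun n hn => ?_⟩
  have hsplit : ∀ x, mollify (f n) h (c n • x) = mollify (f n) (fun y => h y - β y) (c n • x)
      + mollify (f n) β (c n • x) := by
    intro x
    simp only [mollify_eq]
    rw [← integral_add (integrable_bump_mul _ hd1 _) (integrable_bump_mul _ hβ1 _)]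
    congr 1; ext y; ring
  obtain ⟨k1, k2⟩ := integral_sq_mollify_le (f n) hd1 hdi (hc1 n)
  have b1 := bound _ k1 (k2.trans hdle)
  have b2 := bound _ hdi hdle
  have b3 := hn₀ n hn
  rw [Real.dist_eq] at b3 ⊢
  have mm : ∀ {p q : E3 → ℝ}, AEStronglyMeasurable q volume → Integrable (fun x => p x ^ 2) →
      AEStronglyMeasurable p volume → Integrable (fun x => q x ^ 2) →
      Integrable fun x => p x * q x := fun hq hp hpm hq2 =>
    ((memLp_two_iff_integrable_sq hpm).2 hp).integrable_mul ((memLp_two_iff_integrable_sq hq).2 hq2)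
  have j1 : Integrable fun x => w x * mollify (f n) (fun y => h y - β y) (c n • x) :=
    mm ((contDiff_mollify (f n) hd1).continuous.comp (by fun_prop)).aestronglyMeasurable hw2
      hw.aestronglyMeasurable k1
  have j2 : Integrable fun x => w x * mollify (f n) β (c n • x) :=
    mm ((contDiff_mollify (f n) hβ1).continuous.comp (by fun_prop)).aestronglyMeasurable hw2
      hw.aestronglyMeasurable (integral_sq_mollify_le (f n) hβ1 hβ2.integrable_sq (hc1 n)).1
  have j3 : Integrable fun x => w x * (h x - β x) :=
    mm hd1.aestronglyMeasurable hw2 hw.aestronglyMeasurable hdi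
  have j4 : Integrable fun x => w x * β x :=
    mm hβ1.aestronglyMeasurable hw2 hw.aestronglyMeasurable hβ2.integrable_sq
  have s1 : ∫ x, w x * mollify (f n) h (c n • x) =
      (∫ x, w x * mollify (f n) (fun y => h y - β y) (c n • x))
        + ∫ x, w x * mollify (f n) β (c n • x) := by
    rw [← integral_add j1 j2]
    congr 1; ext x; rw [hsplit]; ring
  have s2 : ∫ x, w x * h x = (∫ x, w x * (h x - β x)) + ∫ x, w x * β x := by
    rw [← integral_add j3 j4]
    congr 1; ext x; ring
  rw [s1, s2]
  rw [abs_le] at b1 b2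
  rw [abs_lt] at b3 ⊢
  constructor <;> linarith

/-! ### Green's formula against classes of test functions -/

/-- `f` and `g` are in `L²(Ω)`, and `∫ (f ∂_i φ + g φ) = 0` over `Ω` for all test functions `φ` on
the whole space with support in `S`. For `S = Ω` this says that `g` is the weak derivative `∂_i f`;
for larger `S` it says in addition that the trace of `f` vanishes on a part of the boundary. -/
structure Green (Ω S : Set E3) (i : Fin 3) (f g : E3 → ℝ) : Prop where
  left : MemLp f 2 (volume.restrict Ω)
  right : MemLp g 2 (volume.restrict Ω)
  eq : ∀ φ : E3 → ℝ, ContDiff ℝ ∞ φ → HasCompactSupport φ → tsupport φ ⊆ S →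
    ∫ x in Ω, (f x * partialD i φ x + g x * φ x) = 0

lemma Green.mono {Ω S S' : Set E3} {i : Fin 3} {f g : E3 → ℝ} (h : Green Ω S i f g)
    (hS : S' ⊆ S) : Green Ω S' i f g :=
  ⟨h.left, h.right, fun φ h1 h2 h3 => h.eq φ h1 h2 (h3.trans hS)⟩

lemma memLp_of_bounded {Ω : Set E3} [IsFiniteMeasure (volume.restrict Ω)] {φ : E3 → ℝ}
    (h : Continuous φ) (hc : HasCompactSupport φ) : MemLp φ 2 (volume.restrict Ω) :=
  h.memLp_of_hasCompactSupport hc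

/-- Integration by parts for a function with vanishing trace and a weakly differentiable one. -/
lemma Green.integral_by_parts {A : ℝ} (hA : 0 < A) {i : Fin 3} {a b w g : E3 → ℝ}
    (h : Green (cube A) univ i a b) (h' : Green (cube A) (cube A) i w g) :
    ∫ x in cube A, (a x * g x + b x * w x) = 0 := by
  have hQ : MeasurableSet (cube A) := (isOpen_cube A).measurableSet
  set a' := (cube A).indicator a with ha'
  set b' := (cube A).indicator b with hb'
  set w' := (cube A).indicator w with hw'
  set g' := (cube A).indicator g with hg'
  have m2 : ∀ {f : E3 → ℝ}, MemLp f 2 (volume.restrict (cube A)) →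
      MemLp ((cube A).indicator f) 2 := fun hf => (memLp_indicator_iff_restrict hQ).2 hf
  have m1 : ∀ {f : E3 → ℝ}, MemLp f 2 (volume.restrict (cube A)) →
      Integrable ((cube A).indicator f) := fun hf =>
    (integrable_indicator_iff hQ).2 (hf.integrable (by norm_num))
  -- The dilation factor `c n` and the radius below are matched: mollifying enlarges the cube by `A
  -- / (2 (n + 1))`, while the dilation has room for `A / (n + 1)`. The dilated mollification of `a`
  -- is thus a legitimate test function for `w`.
  let c : ℕ → ℝ := fun n => 1 + 1 / ((n : ℝ) + 1)
  let f : ℕ → ContDiffBump (0 : E3) := fun n =>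
    ⟨A / (4 * ((n : ℝ) + 1)), A / (2 * ((n : ℝ) + 1)), by positivity, by
      apply div_lt_div_of_pos_left hA (by positivity)
      nlinarith [Nat.cast_nonneg (α := ℝ) n]⟩
  have hc1 : ∀ n, 1 ≤ c n := fun n => by
    have : (0 : ℝ) ≤ 1 / ((n : ℝ) + 1) := by positivity
    simp only [c]; linarith
  have hc : Tendsto c atTop (𝓝 1) := by
    have := (tendsto_one_div_add_atTop_nhds_zero_nat (𝕜 := ℝ)).const_add 1
    rwa [add_zero] at this
  have hf : Tendsto (fun n => (f n).rOut) atTop (𝓝 0) := by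
    have := (tendsto_one_div_add_atTop_nhds_zero_nat (𝕜 := ℝ)).const_mul (A / 2)
    rw [mul_zero] at this
    refine this.congr fun n => ?_
    simp only [f]
    field_simp
  have key : ∀ n, (∫ x, w' x * mollify (f n) b' (c n • x)) * c n
      + ∫ x, g' x * mollify (f n) a' (c n • x) = 0 := by
    intro n
    -- Green's formula for `a` holds against all test functions, so the extension of `a` by zero has
    -- the weak derivative `b'` on the whole space, and mollification commutes with that derivative.
    have hD : ∀ x, partialD i (mollify (f n) a') x = mollify (f n) b' x := by
      intro x
      rw [partialD_mollify _ (m1 h.left), mollify_eq]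
      set φ : E3 → ℝ := fun y => (f n).normed volume (x - y) with hφ
      have hs : ContDiff ℝ ∞ φ :=
        (f n).contDiff_normed.comp (contDiff_const.sub contDiff_id)
      have hcs : HasCompactSupport φ :=
        (f n).hasCompactSupport_normed.comp_homeomorph (Homeomorph.subLeft x)
      have hpd : ∀ y, partialD i φ y = - partialD i ((f n).normed volume) (x - y) := by
        intro y
        have h1 : HasFDerivAt ((f n).normed volume) (fderiv ℝ ((f n).normed volume) (x - y))
            (x - y) :=
          ((((f n).contDiff_normed (n := 1)).differentiable (by simp)) _).hasFDerivAt
        have h2 : HasFDerivAt (fun y : E3 => x - y) (-(ContinuousLinearMap.id ℝ E3)) y :=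
          (hasFDerivAt_id y).const_sub x
        have h3 : HasFDerivAt φ _ y := h1.comp y h2
        rw [partialD, h3.fderiv]
        simp [partialD]
      have e := h.eq φ hs hcs (subset_univ _)
      have i1 : IntegrableOn (fun y => partialD i ((f n).normed volume) (x - y) * a y) (cube A) := by
        have : MemLp (fun y => partialD i ((f n).normed volume) (x - y)) 2
            (volume.restrict (cube A)) := by
          have := memLp_of_bounded (Ω := cube A) (contDiff_partialD hs i).continuous
            (hasCompactSupport_partialD hcs i)
          refine (this.neg).ae_eq (ae_of_all _ fun y => ?_)
          simp [hpd]
        exact this.integrable_mul h.left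
      have i2 : IntegrableOn (fun y => φ y * b y) (cube A) :=
        (memLp_of_bounded hs.continuous hcs).integrable_mul h.right
      have e1 : ∫ y, partialD i ((f n).normed volume) (x - y) * a' y =
          ∫ y in cube A, partialD i ((f n).normed volume) (x - y) * a y := by
        rw [← integral_indicator hQ]
        congr 1; ext y
        by_cases hy : y ∈ cube A <;> simp [ha', hy]
      have e2 : ∫ y, (f n).normed volume (x - y) * b' y = ∫ y in cube A, φ y * b y := by
        rw [← integral_indicator hQ]
        congr 1; ext y
        by_cases hy : y ∈ cube A <;> simp [hb', hy, hφ]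
      rw [e1, e2, ← sub_eq_zero, ← integral_sub i1 i2, ← neg_eq_zero, ← integral_neg, ← e]
      congr 1; ext y
      rw [hpd]; ring
    have hcn : 0 < c n := lt_of_lt_of_le one_pos (hc1 n)
    set φ : E3 → ℝ := fun x => mollify (f n) a' (c n • x) with hφ
    have hs : ContDiff ℝ ∞ φ := (contDiff_mollify (f n) (m1 h.left)).comp (by fun_prop)
    have hpd : ∀ x, partialD i φ x = c n * mollify (f n) b' (c n • x) := by
      intro x
      have h1 : HasFDerivAt (mollify (f n) a') (fderiv ℝ (mollify (f n) a') (c n • x)) (c n • x) :=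
        (((contDiff_mollify (f n) (m1 h.left)).differentiable (by simp)) _).hasFDerivAt
      have h2 : HasFDerivAt (fun y : E3 => c n • y) (c n • ContinuousLinearMap.id ℝ E3) x :=
        (hasFDerivAt_id x).const_smul (c n)
      have h3 : HasFDerivAt φ _ x := h1.comp x h2
      rw [partialD, h3.fderiv, ← hD]
      simp [partialD]
    -- If `mollify (f n) a'` does not vanish at `c n • x`, then `c n • x` is within `rOut` of the
    -- cube, which bounds the coordinates of `x` by `A'`.
    set A' : ℝ := (A + A / (2 * ((n : ℝ) + 1))) / c n with hA'
    have hlt : A' < A := by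
      rw [hA', div_lt_iff₀ hcn]
      simp only [c]
      have : A / (2 * ((n : ℝ) + 1)) < A / ((n : ℝ) + 1) := by
        apply div_lt_div_of_pos_left hA (by positivity)
        nlinarith [Nat.cast_nonneg (α := ℝ) n]
      have e : A * (1 + 1 / ((n : ℝ) + 1)) = A + A / ((n : ℝ) + 1) := by ring
      rw [e]
      linarith
    have hsupp : tsupport φ ⊆ closedCube A' := by
      refine closure_minimal (fun x hx => ?_) (isCompact_closedCube A').isClosed
      have hx' : mollify (f n) a' (c n • x) ≠ 0 := hx
      rw [mollify_eq] at hx'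
      obtain ⟨y, hy⟩ : ∃ y, (f n).normed volume (c n • x - y) * a' y ≠ 0 := by
        by_contra! hcon
        exact hx' (by simp [hcon])
      have hy1 : y ∈ cube A := by
        by_contra hny
        simp [ha', hny] at hy
      have hy2 : c n • x - y ∈ Metric.ball (0 : E3) (f n).rOut := by
        rw [← (f n).support_normed_eq (μ := volume)]
        exact left_ne_zero_of_mul hy
      rw [mem_ball_zero_iff] at hy2
      intro j
      have hj := (PiLp.norm_apply_le (c n • x - y) j).trans hy2.le
      rw [Real.norm_eq_abs, abs_le] at hj
      simp only [PiLp.sub_apply, PiLp.smul_apply, smul_eq_mul] at hj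
      have hr : (f n).rOut = A / (2 * ((n : ℝ) + 1)) := rfl
      rw [hr] at hj
      have := hy1 j
      rw [hA', ← neg_div, div_le_iff₀ hcn, le_div_iff₀ hcn]
      constructor <;> nlinarith
    have hsub : closedCube A' ⊆ cube A := fun x hx j =>
      ⟨by linarith [(hx j).1], by linarith [(hx j).2]⟩
    have hcs : HasCompactSupport φ :=
      (isCompact_closedCube A').of_isClosed_subset (isClosed_tsupport _) hsupp
    have e := h'.eq φ hs hcs (hsupp.trans hsub)
    have i1 : IntegrableOn (fun x => w x * partialD i φ x) (cube A) :=
      h'.left.integrable_mul (memLp_of_bounded (contDiff_partialD hs i).continuous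
        (hasCompactSupport_partialD hcs i))
    have i2 : IntegrableOn (fun x => g x * φ x) (cube A) :=
      h'.right.integrable_mul (memLp_of_bounded hs.continuous hcs)
    rw [integral_add i1 i2, ← integral_indicator hQ, ← integral_indicator hQ] at e
    rw [← integral_mul_const, ← e]
    simp only [hpd]
    congr 2 <;> ext x <;> by_cases hx : x ∈ cube A <;> simp [hw', hg', hx, hφ]
    ring
  have sq : ∀ {f : E3 → ℝ}, MemLp f 2 (volume.restrict (cube A)) →
      Integrable fun x => (cube A).indicator f x ^ 2 := fun hf => (m2 hf).integrable_sq
  have l1 := tendsto_integral_mul_mollify hf hc1 hc (m1 h'.left) (sq h'.left) (m1 h.right)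
    (m2 h.right)
  have l2 := tendsto_integral_mul_mollify hf hc1 hc (m1 h'.right) (sq h'.right) (m1 h.left)
    (m2 h.left)
  have l3 := tendsto_nhds_unique (((l1.mul hc).add l2).congr key) tendsto_const_nhds
  have i1 : Integrable fun x => w' x * b' x := (m2 h'.left).integrable_mul (m2 h.right)
  have i2 : Integrable fun x => g' x * a' x := (m2 h'.right).integrable_mul (m2 h.left)
  rw [mul_one, ← integral_add i1 i2] at l3
  rw [← integral_indicator hQ, ← l3]
  congr 1; ext x
  by_cases hx : x ∈ cube A
  · simp [ha', hb', hw', hg', hx]; ring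
  · simp [hw', hg', hx]

/-! ### Operations on Green's formula -/

lemma memLp_mul_of_continuous {A : ℝ} {m f : E3 → ℝ} (hm : Continuous m)
    (hf : MemLp f 2 (volume.restrict (cube A))) :
    MemLp (fun x => m x * f x) 2 (volume.restrict (cube A)) := by
  obtain ⟨C, hC⟩ := (isCompact_closedCube A).exists_bound_of_continuousOn hm.continuousOn
  refine MemLp.of_le_mul (c := C) hf (hm.aestronglyMeasurable.mul hf.aestronglyMeasurable) ?_
  filter_upwards [ae_restrict_mem (isOpen_cube A).measurableSet] with x hx
  rw [norm_mul]
  exact mul_le_mul_of_nonneg_right (hC x (cube_subset_closedCube A hx)) (norm_nonneg _)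

lemma Green.integrable {A : ℝ} {S : Set E3} {i : Fin 3} {f g : E3 → ℝ}
    (h : Green (cube A) S i f g) {φ : E3 → ℝ} (hφ : ContDiff ℝ ∞ φ) (hc : HasCompactSupport φ) :
    Integrable (fun x => f x * partialD i φ x + g x * φ x) (volume.restrict (cube A)) :=
  (h.left.integrable_mul (memLp_of_bounded (contDiff_partialD hφ i).continuous
    (hasCompactSupport_partialD hc i))).add
    (h.right.integrable_mul (memLp_of_bounded hφ.continuous hc))

lemma Green.congr {Ω S : Set E3} {i : Fin 3} {f g f' g' : E3 → ℝ} (h : Green Ω S i f g)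
    (hf : f =ᵐ[volume.restrict Ω] f') (hg : g =ᵐ[volume.restrict Ω] g') : Green Ω S i f' g' := by
  refine ⟨h.left.ae_eq hf, h.right.ae_eq hg, fun φ h1 h2 h3 => ?_⟩
  rw [← h.eq φ h1 h2 h3]
  apply integral_congr_ae
  filter_upwards [hf, hg] with x h1 h2
  rw [h1, h2]

lemma Green.add {A : ℝ} {S : Set E3} {i : Fin 3} {f g f' g' : E3 → ℝ}
    (h : Green (cube A) S i f g) (h' : Green (cube A) S i f' g') :
    Green (cube A) S i (fun x => f x + f' x) (fun x => g x + g' x) := by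
  refine ⟨h.left.add h'.left, h.right.add h'.right, fun φ h1 h2 h3 => ?_⟩
  have e := integral_add (h.integrable h1 h2) (h'.integrable h1 h2)
  rw [h.eq φ h1 h2 h3, h'.eq φ h1 h2 h3, add_zero] at e
  rw [← e]
  congr 1; ext x; ring

/-- The product rule. -/
lemma Green.mul {A : ℝ} {S S' : Set E3} {i : Fin 3} {f g m : E3 → ℝ}
    (h : Green (cube A) S i f g) (hm : ContDiff ℝ ∞ m) (hS : tsupport m ∩ S' ⊆ S) :
    Green (cube A) S' i (fun x => m x * f x) (fun x => partialD i m x * f x + m x * g x) := by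
  refine ⟨memLp_mul_of_continuous hm.continuous h.left,
    (memLp_mul_of_continuous (contDiff_partialD hm i).continuous h.left).add
      (memLp_mul_of_continuous hm.continuous h.right), fun φ h1 h2 h3 => ?_⟩
  have e := h.eq (fun x => m x * φ x) (hm.mul h1) h2.mul_left (fun x hx =>
    hS ⟨closure_mono (Function.support_mul_subset_left m φ) hx,
      h3 (closure_mono (Function.support_mul_subset_right m φ) hx)⟩)
  rw [← e]
  congr 1; ext x
  rw [partialD_mul hm h1]
  ring

lemma Green.const_mul {A : ℝ} {S : Set E3} {i : Fin 3} {f g : E3 → ℝ}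
    (h : Green (cube A) S i f g) (c : ℝ) :
    Green (cube A) S i (fun x => c * f x) (fun x => c * g x) := by
  refine ⟨h.left.const_mul c, h.right.const_mul c, fun φ h1 h2 h3 => ?_⟩
  have e : ∀ x, c * f x * partialD i φ x + c * g x * φ x =
      c * (f x * partialD i φ x + g x * φ x) := fun x => by ring
  simp only [e]
  rw [integral_const_mul, h.eq φ h1 h2 h3, mul_zero]

/-- No bound on the derivatives is required: these cutoffs are used only in coordinates in which no
derivative is taken. -/
lemma exists_cutoff_seq {A : ℝ} (hA : 0 < A) : ∃ h : ℕ → ℝ → ℝ, (∀ n, ContDiff ℝ ∞ (h n)) ∧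
    (∀ n t, |h n t| ≤ 1) ∧ (∀ n, tsupport (h n) ⊆ Ioo (-A) A) ∧
    ∀ t ∈ Ioo (-A) A, Tendsto (fun n => h n t) atTop (𝓝 1) := by
  let f : ℕ → ContDiffBump (0 : ℝ) := fun n =>
    ⟨A * (1 - 1 / ((n : ℝ) + 2)), A * (1 - 1 / ((n : ℝ) + 3)), by
      have : 1 / ((n : ℝ) + 2) < 1 := by
        rw [div_lt_one (by positivity)]; linarith [Nat.cast_nonneg (α := ℝ) n]
      exact mul_pos hA (by linarith), by
      have : 1 / ((n : ℝ) + 3) < 1 / ((n : ℝ) + 2) :=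
        one_div_lt_one_div_of_lt (by positivity) (by linarith)
      exact mul_lt_mul_of_pos_left (by linarith) hA⟩
  refine ⟨fun n => f n, fun n => (f n).contDiff, fun n t => ?_, fun n => ?_, fun t ht => ?_⟩
  · rw [abs_of_nonneg (f n).nonneg]
    exact (f n).le_one
  · rw [(f n).tsupport_eq, Real.closedBall_eq_Icc]
    have h3 : 0 < 1 / ((n : ℝ) + 3) := by positivity
    have h4 : A * (1 - 1 / ((n : ℝ) + 3)) < A := by nlinarith
    refine Icc_subset_Ioo ?_ ?_ <;> simp only [f, zero_sub, zero_add] <;> linarith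
  · have l : Tendsto (fun n : ℕ => A * (1 - 1 / ((n : ℝ) + 2))) atTop (𝓝 A) := by
      have h1 : Tendsto (fun n : ℕ => 1 / ((n : ℝ) + 2)) atTop (𝓝 0) := by
        have := (tendsto_one_div_add_atTop_nhds_zero_nat (𝕜 := ℝ)).comp (tendsto_add_atTop_nat 1)
        refine this.congr fun n => ?_
        simp only [Function.comp_apply, Nat.cast_add, Nat.cast_one]
        ring
      simpa using (h1.const_sub 1).const_mul A
    refine tendsto_const_nhds.congr' ?_
    filter_upwards [l.eventually (lt_mem_nhds (abs_lt.2 ht))] with n hn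
    refine ((f n).one_of_mem_closedBall ?_).symm
    rw [mem_closedBall_zero_iff, Real.norm_eq_abs]
    exact hn.le

lemma partialD_eq_zero_of_const {φ : E3 → ℝ} (hφ : ContDiff ℝ ∞ φ) {i : Fin 3}
    (h : ∀ (x : E3) (t : ℝ), φ (x + t • EuclideanSpace.single i 1) = φ x) (x : E3) :
    partialD i φ x = 0 := by
  have h1 := ((hφ.differentiable (by simp)) x).lineDeriv_eq_fderiv
    (v := EuclideanSpace.single i (1 : ℝ))
  rw [partialD, ← h1, lineDeriv]
  simp [h]

/-- The derivative in direction `i` does not see cutoffs in the other coordinates, so Green's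
formula extends to test functions which do not vanish near the other faces. -/
lemma Green.lateral {A : ℝ} (hA : 0 < A) {S : Set E3} {i : Fin 3} {f g : E3 → ℝ}
    (h : Green (cube A) {x | x ∈ S ∧ ∀ j, j ≠ i → -A < x j ∧ x j < A} i f g) :
    Green (cube A) S i f g := by
  refine ⟨h.left, h.right, fun φ h1 h2 h3 => ?_⟩
  obtain ⟨c, c1, c2, c3, c4⟩ := exists_cutoff_seq hA
  let η : ℕ → E3 → ℝ := fun n x => ∏ j ∈ Finset.univ.erase i, c n (x j)
  have η1 : ∀ n, ContDiff ℝ ∞ (η n) := fun n =>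
    contDiff_prod fun j _ => contDiff_comp_coord (c1 n) j
  have η2 : ∀ n x, partialD i (η n) x = 0 := fun n x => by
    refine partialD_eq_zero_of_const (η1 n) (fun x t => ?_) x
    refine Finset.prod_congr rfl fun j hj => ?_
    have : j ≠ i := Finset.ne_of_mem_erase hj
    simp [this]
  have η3 : ∀ n j, j ≠ i → tsupport (η n) ⊆ {x | -A < x j ∧ x j < A} := by
    intro n j hj
    have : tsupport (η n) ⊆ (fun x : E3 => x j) ⁻¹' tsupport (c n) := by
      refine closure_minimal (fun x hx => ?_) ((isClosed_tsupport _).preimage (continuous_coord j))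
      refine subset_tsupport _ fun h0 => hx ?_
      exact Finset.prod_eq_zero (Finset.mem_erase.2 ⟨hj, Finset.mem_univ j⟩) h0
    exact fun x hx => c3 n (this hx)
  have key : ∀ n, ∫ x in cube A, η n x * (f x * partialD i φ x + g x * φ x) = 0 := by
    intro n
    have e := h.eq (fun x => η n x * φ x) ((η1 n).mul h1) h2.mul_left (fun x hx =>
      ⟨h3 (closure_mono (Function.support_mul_subset_right _ _) hx), fun j hj =>
        η3 n j hj (closure_mono (Function.support_mul_subset_left _ _) hx)⟩)
    rw [← e]
    congr 1; ext x
    rw [partialD_mul (η1 n) h1, η2]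
    ring
  have l : Tendsto (fun n => ∫ x in cube A, η n x * (f x * partialD i φ x + g x * φ x)) atTop
      (𝓝 (∫ x in cube A, (f x * partialD i φ x + g x * φ x))) := by
    have hi := h.integrable h1 h2
    refine tendsto_integral_of_dominated_convergence
      (fun x => ‖f x * partialD i φ x + g x * φ x‖) (fun n => ?_) hi.norm
      (fun n => ae_of_all _ fun x => ?_) ?_
    · exact (η1 n).continuous.aestronglyMeasurable.mul hi.aestronglyMeasurable
    · rw [norm_mul]
      refine mul_le_of_le_one_left (norm_nonneg _) ?_
      rw [Real.norm_eq_abs, Finset.abs_prod]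
      exact Finset.prod_le_one (fun _ _ => abs_nonneg _) fun j _ => c2 n _
    · filter_upwards [ae_restrict_mem (isOpen_cube A).measurableSet] with x hx
      have : Tendsto (fun n => η n x) atTop (𝓝 1) := by
        have := tendsto_finsetProd (Finset.univ.erase i) fun j _ => c4 (x j) (hx j)
        simpa using this
      simpa using this.mul_const (f x * partialD i φ x + g x * φ x)
  simp only [key] at l
  exact tendsto_nhds_unique l tendsto_const_nhds

/-- Vanishing of the trace on a face is inherited by tangential derivatives. -/
lemma Green.tangential {A : ℝ} (hA : 0 < A) {i j : Fin 3} (hij : i ≠ j) {f g f' g' : E3 → ℝ}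
    (h : Green (cube A) univ i f g) (hf : Green (cube A) (cube A) j f f')
    (hg : Green (cube A) (cube A) j g g') : Green (cube A) univ i f' g' := by
  have ext : ∀ {f f' : E3 → ℝ}, Green (cube A) (cube A) j f f' →
      Green (cube A) {x | -A < x j ∧ x j < A} j f f' := by
    intro f f' hf
    refine Green.lateral hA (hf.mono fun x hx k => ?_)
    by_cases hk : k = j
    · rw [hk]; exact hx.1
    · exact hx.2 k hk
  refine Green.lateral hA ⟨hf.right, hg.right, fun φ h1 h2 h3 => ?_⟩
  have hs : tsupport φ ⊆ {x | -A < x j ∧ x j < A} := fun x hx => (h3 hx).2 j hij.symm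
  have pi := contDiff_partialD h1 i
  have pj := contDiff_partialD h1 j
  have ci := hasCompactSupport_partialD h2 i
  have cj := hasCompactSupport_partialD h2 j
  have e1 := (ext hf).eq (partialD i φ) pi ci ((tsupport_partialD φ i).trans hs)
  have e2 := (ext hg).eq φ h1 h2 hs
  have e3 := h.eq (partialD j φ) pj cj (subset_univ _)
  have i1 := (ext hf).integrable pi ci
  have i2 := (ext hg).integrable h1 h2
  have i3 := h.integrable pj cj
  -- The derivative `∂_j` is moved from `f'` and `g'` to the test function, where it commutes with
  -- `∂_i`. What remains is Green's formula for the pair `f`, `g` tested with `∂_j φ`.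
  have e : ∫ x in cube A, (f' x * partialD i φ x + g' x * φ x) =
      (∫ x in cube A, (f x * partialD j (partialD i φ) x + f' x * partialD i φ x))
      + (∫ x in cube A, (g x * partialD j φ x + g' x * φ x))
      - ∫ x in cube A, (f x * partialD i (partialD j φ) x + g x * partialD j φ x) := by
    have i12 : Integrable (fun x => f x * partialD j (partialD i φ) x + f' x * partialD i φ x
        + (g x * partialD j φ x + g' x * φ x)) (volume.restrict (cube A)) := i1.add i2
    rw [← integral_add i1 i2, ← integral_sub i12 i3]
    congr 1; ext x
    rw [partialD_comm h1 i j]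
    ring
  rw [e, e1, e2, e3]
  ring

/-- Zero traces on two opposite faces. -/
lemma Green.glue {A : ℝ} (hA : 0 < A) {i : Fin 3} {S : Set E3} {f g : E3 → ℝ}
    (h : Green (cube A) {x | -A < x i ∧ x ∈ S} i f g)
    (h' : Green (cube A) {x | x i < A ∧ x ∈ S} i f g) : Green (cube A) S i f g := by
  refine ⟨h.left, h.right, fun φ h1 h2 h3 => ?_⟩
  -- A partition of unity in the coordinate `x i`: `θ` vanishes near one of the two faces and `1 -
  -- θ` near the other, so each piece of the test function meets only one of them.
  have hθ : ContDiff ℝ ∞ fun t : ℝ => Real.smoothTransition ((t + A / 2) / A) :=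
    Real.smoothTransition.contDiff.comp (by fun_prop)
  have hθ1 := contDiff_comp_coord hθ i
  set θ : E3 → ℝ := fun x => Real.smoothTransition ((x i + A / 2) / A) with hθd
  have hθ2 : ContDiff ℝ ∞ fun x => 1 - θ x := contDiff_const.sub hθ1
  have s1 : tsupport θ ⊆ {x | -(A / 2) ≤ x i} := by
    refine closure_minimal (fun x hx => ?_) (isClosed_le continuous_const (continuous_coord i))
    by_contra hn
    simp only [mem_ofPred_eq, not_le] at hn
    exact hx (Real.smoothTransition.zero_of_nonpos
      (div_nonpos_of_nonpos_of_nonneg (by linarith) hA.le))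
  have s2 : tsupport (fun x => 1 - θ x) ⊆ {x | x i ≤ A / 2} := by
    refine closure_minimal (fun x hx => ?_) (isClosed_le (continuous_coord i) continuous_const)
    by_contra hn
    simp only [mem_ofPred_eq, not_le] at hn
    refine hx ?_
    simp only [hθd]
    rw [Real.smoothTransition.one_of_one_le, sub_self]
    rw [le_div_iff₀ hA]
    linarith
  have c1 : HasCompactSupport fun x => θ x * φ x := h2.mul_left
  have c2 : HasCompactSupport fun x => (1 - θ x) * φ x := h2.mul_left
  have e1 := h.eq (fun x => θ x * φ x) (hθ1.mul h1) c1 (fun x hx =>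
    ⟨lt_of_lt_of_le (by linarith) (s1 (closure_mono (Function.support_mul_subset_left _ _) hx)),
      h3 (closure_mono (Function.support_mul_subset_right _ _) hx)⟩)
  have e2 := h'.eq (fun x => (1 - θ x) * φ x) (hθ2.mul h1) c2 (fun x hx =>
    ⟨lt_of_le_of_lt (s2 (closure_mono (Function.support_mul_subset_left _ _) hx)) (by linarith),
      h3 (closure_mono (Function.support_mul_subset_right _ _) hx)⟩)
  have i1 := h.integrable (hθ1.mul h1) c1
  have i2 := h'.integrable (hθ2.mul h1) c2
  rw [← add_zero (∫ x in cube A, (f x * partialD i φ x + g x * φ x)), ← e1]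
  have e : ∀ x, partialD i φ x = partialD i (fun x => θ x * φ x) x
      + partialD i (fun x => (1 - θ x) * φ x) x := by
    intro x
    rw [partialD_mul hθ1 h1, partialD_mul hθ2 h1]
    have : partialD i (fun x => 1 - θ x) x = - partialD i θ x := by
      have := ((hθ1.differentiable (by simp)) x).hasFDerivAt.const_sub 1
      rw [partialD, this.fderiv]
      simp [partialD]
    rw [this]
    ring
  rw [e1, add_zero, ← add_zero (0 : ℝ)]
  nth_rewrite 1 [← e1]
  rw [← e2, ← integral_add i1 i2]
  congr 1; ext x
  rw [e]
  ring

/-! ### Jets of functions with vanishing traces -/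

/-- The weak derivatives up to order three of a function on the cube with zero normal derivatives
on the lateral faces, and with zero Cauchy data on those faces orthogonal to the third axis which
`S` allows test functions to meet. -/
structure ZeroJet (A : ℝ) (S : Set E3) (u : E3 → ℝ) (u1 : Fin 3 → E3 → ℝ)
    (u2 : Fin 3 → Fin 3 → E3 → ℝ) (u3 : Fin 3 → Fin 3 → Fin 3 → E3 → ℝ) : Prop where
  symm2 : ∀ i j, u2 i j = u2 j i
  weak0 : ∀ i, Green (cube A) (cube A) i u (u1 i)
  weak1 : ∀ i j, Green (cube A) (cube A) j (u1 i) (u2 i j)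
  weak2 : ∀ i j k, Green (cube A) (cube A) k (u2 i j) (u3 i j k)
  lateral : ∀ i, i ≠ 2 → Green (cube A) univ i (u1 i) (u2 i i)
  bottom0 : Green (cube A) S 2 u (u1 2)
  bottom1 : Green (cube A) S 2 (u1 2) (u2 2 2)

lemma IsWeakDeriv.green {Ω : Set E3} {i : Fin 3} {f g : E3 → ℝ} (hΩ : IsOpen Ω)
    (h : IsWeakDeriv Ω (Pi.single i 1) f g) (hf : MemLp f 2 (volume.restrict Ω))
    (hg : MemLp g 2 (volume.restrict Ω)) : Green Ω Ω i f g := by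
  refine ⟨hf, hg, fun φ h1 h2 h3 => ?_⟩
  have e := h.2.2 φ h1 h2 h3
  have hs1 : ∑ j, (Pi.single i 1 : Fin 3 → ℕ) j = 1 := by simp
  rw [multiD_single, hs1, pow_one, neg_one_mul] at e
  rw [integral_add (integrableOn_mul_of_tsupport hΩ.measurableSet h.1
    (contDiff_partialD h1 i).continuous (hasCompactSupport_partialD h2 i)
    ((tsupport_partialD φ i).trans h3))
    (integrableOn_mul_of_tsupport hΩ.measurableSet h.2.1 h1.continuous h2 h3), e]
  ring

lemma Green.isWeakDeriv {Ω : Set E3} (hΩ : IsOpen Ω) {i : Fin 3} {f g : E3 → ℝ}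
    (h : Green Ω Ω i f g) : IsWeakDeriv Ω (Pi.single i 1) f g := by
  have hf := locallyIntegrableOn_of_memLp h.left
  have hg := locallyIntegrableOn_of_memLp h.right
  refine ⟨hf, hg, fun φ h1 h2 h3 => ?_⟩
  have e := h.eq φ h1 h2 h3
  rw [integral_add (integrableOn_mul_of_tsupport hΩ.measurableSet hf
    (contDiff_partialD h1 i).continuous (hasCompactSupport_partialD h2 i)
    ((tsupport_partialD φ i).trans h3))
    (integrableOn_mul_of_tsupport hΩ.measurableSet hg h1.continuous h2 h3)] at e
  have hs1 : ∑ j, (Pi.single i 1 : Fin 3 → ℕ) j = 1 := by simp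
  rw [multiD_single, hs1]
  linarith

/-- With zero boundary datum the trace condition is already Green's formula. The only change is from
the chosen representative `weakD` to a given weak derivative `g`. -/
lemma HasFaceTrace.green {A : ℝ} {i : Fin 3} {s : ℝ} {f g : E3 → ℝ}
    (h : HasFaceTrace A i s f 0) (hw : Green (cube A) (cube A) i f g) :
    Green (cube A) {x | -A < s * x i ∧ ∀ j, j ≠ i → -A < x j ∧ x j < A} i f g := by
  refine ⟨hw.left, hw.right, fun φ h1 h2 h3 => ?_⟩
  have e := h.2 φ h1 h2 h3
  simp only [Pi.zero_apply, zero_mul, integral_zero, mul_zero] at e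
  rw [← e]
  apply integral_congr_ae
  filter_upwards [(hw.isWeakDeriv (isOpen_cube A)).weakDeriv_ae (isOpen_cube A)] with x hx
  rw [weakD, hx]

lemma HasNormalTrace.green {A : ℝ} {i : Fin 3} {s : ℝ} (hs : s = 1 ∨ s = -1) {u f g : E3 → ℝ}
    (h : HasNormalTrace A i s u 0) (hf : weakD (cube A) i u = f)
    (hw : Green (cube A) (cube A) i f g) :
    Green (cube A) {x | -A < s * x i ∧ ∀ j, j ≠ i → -A < x j ∧ x j < A} i f g := by
  subst hf
  -- The normal derivative carries the sign `s`; a second multiplication by `s` removes it, since `s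
  -- * s = 1`.
  have h1 := (HasFaceTrace.green h (hw.const_mul s)).const_mul s
  have hss : s * s = 1 := by rcases hs with rfl | rfl <;> norm_num
  refine h1.congr (ae_of_all _ fun x => ?_) (ae_of_all _ fun x => ?_) <;>
    simp only [← mul_assoc, hss, one_mul]

lemma weakDeriv_green {A : ℝ} {u : E3 → ℝ} (h : MemH 3 (cube A) u) {a : Fin 3 → ℕ} (i : Fin 3)
    (ha : ∑ j, a j ≤ 2) :
    Green (cube A) (cube A) i (weakDeriv (cube A) a u)
      (weakDeriv (cube A) (a + Pi.single i 1) u) := by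
  have ha' : ∑ j, (a + Pi.single i 1 : Fin 3 → ℕ) j ≤ 3 := by
    simp only [Pi.add_apply, Finset.sum_add_distrib]
    simp
    omega
  obtain ⟨h1, h2⟩ := h.spec (isOpen_cube A) (a := a) (by omega)
  obtain ⟨h3, h4⟩ := h.spec (isOpen_cube A) ha'
  exact (h1.step h3).green (isOpen_cube A) h2 h4

/-- The multi-index `e_i + e_j`. -/
abbrev idx2 (i j : Fin 3) : Fin 3 → ℕ := Pi.single i 1 + Pi.single j 1

/-- The multi-index `e_i + e_j + e_k`. -/
abbrev idx3 (i j k : Fin 3) : Fin 3 → ℕ := Pi.single i 1 + Pi.single j 1 + Pi.single k 1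

lemma sum_idx2 (i j : Fin 3) : ∑ k, idx2 i j k = 2 := by
  simp [idx2, Finset.sum_add_distrib]

/-- The boundary conditions become admissible supports of test functions. Opposite lateral faces are
glued, so lateral test functions are unrestricted. In the third direction the set `{x 2 < A}`
records that nothing is known on the top face. -/
lemma MemH0bsc.zeroJet {A : ℝ} (hA : 0 < A) {u : E3 → ℝ} (h : MemH0bsc A u) :
    ZeroJet A {x | x 2 < A} u (fun i => weakD (cube A) i u)
      (fun i j => weakDeriv (cube A) (idx2 i j) u)
      (fun i j k => weakDeriv (cube A) (idx3 i j k) u) := by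
  obtain ⟨h3, hb0, hb1, hl⟩ := h
  have w0 : ∀ i, Green (cube A) (cube A) i u (weakD (cube A) i u) := fun i => by
    have := weakDeriv_green h3 (a := 0) i (by simp)
    rw [zero_add] at this
    exact this.congr (h3.weakDeriv_zero_ae (isOpen_cube A)) (ae_eq_refl _)
  have w1 : ∀ i j, Green (cube A) (cube A) j (weakD (cube A) i u)
      (weakDeriv (cube A) (idx2 i j) u) := fun i j => weakDeriv_green h3 j (by simp)
  refine ⟨fun i j => ?_, w0, w1,
    fun i j k => weakDeriv_green h3 k (sum_idx2 i j).le, fun i hi => ?_, ?_, ?_⟩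
  · simp only [idx2, add_comm]
  · have t1 := (hl i hi 1 (Or.inl rfl)).green (Or.inl rfl) rfl (w1 i i)
    have t2 := (hl i hi (-1) (Or.inr rfl)).green (Or.inr rfl) rfl (w1 i i)
    refine Green.glue hA (Green.lateral hA (t1.mono ?_)) (Green.lateral hA (t2.mono ?_))
    · rintro x ⟨⟨h1, -⟩, h2⟩
      exact ⟨by simpa using h1, h2⟩
    · rintro x ⟨⟨h1, -⟩, h2⟩
      exact ⟨by simpa using h1, h2⟩
  · refine Green.lateral hA ((hb0.green (w0 2)).mono ?_)
    rintro x ⟨h1, h2⟩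
    exact ⟨by simpa using h1, h2⟩
  · refine Green.lateral hA ((hb1.green (Or.inr rfl) rfl (w1 2 2)).mono ?_)
    rintro x ⟨h1, h2⟩
    exact ⟨by simpa using h1, h2⟩

/-- The `i`-th component of the third unit vector. -/
def ez (i : Fin 3) : ℝ := if i = 2 then 1 else 0

lemma Green.mulZ {A : ℝ} {S S' : Set E3} {i : Fin 3} {f g : E3 → ℝ}
    (h : Green (cube A) S i f g) {m : ℝ → ℝ} (hm : ContDiff ℝ ∞ m)
    (hS : tsupport (fun x : E3 => m (x 2)) ∩ S' ⊆ S) :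
    Green (cube A) S' i (fun x => m (x 2) * f x)
      (fun x => ez i * deriv m (x 2) * f x + m (x 2) * g x) := by
  refine (h.mul (contDiff_comp_coord hm 2) hS).congr (ae_eq_refl _) (ae_of_all _ fun x => ?_)
  simp only [partialD_comp_coord hm, ez, eq_comm (a := (2 : Fin 3))]
  split_ifs <;> simp

/-- Multiplication of a jet by a function of the third coordinate. -/
lemma ZeroJet.mulZ {A : ℝ} {S S' : Set E3} {u : E3 → ℝ} {u1 : Fin 3 → E3 → ℝ}
    {u2 : Fin 3 → Fin 3 → E3 → ℝ} {u3 : Fin 3 → Fin 3 → Fin 3 → E3 → ℝ}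
    (h : ZeroJet A S u u1 u2 u3) {m : ℝ → ℝ} (hm : ContDiff ℝ ∞ m)
    (hS : tsupport (fun x : E3 => m (x 2)) ∩ S' ⊆ S) :
    ZeroJet A S' (fun x => m (x 2) * u x)
      (fun i x => ez i * deriv m (x 2) * u x + m (x 2) * u1 i x)
      (fun i j x => ez i * ez j * deriv (deriv m) (x 2) * u x
        + deriv m (x 2) * (ez i * u1 j x + ez j * u1 i x) + m (x 2) * u2 i j x)
      (fun i j k x => ez i * ez j * ez k * deriv (deriv (deriv m)) (x 2) * u x
        + deriv (deriv m) (x 2) * (ez i * ez j * u1 k x + ez i * ez k * u1 j x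
          + ez j * ez k * u1 i x)
        + deriv m (x 2) * (ez i * u2 j k x + ez j * u2 i k x + ez k * u2 i j x)
        + m (x 2) * u3 i j k x) := by
  have hm1 : ContDiff ℝ ∞ (deriv m) := (contDiff_infty_iff_deriv.1 hm).2
  have hm2 : ContDiff ℝ ∞ (deriv (deriv m)) := (contDiff_infty_iff_deriv.1 hm1).2
  have s1 : tsupport (fun x : E3 => deriv m (x 2)) ∩ S' ⊆ S := by
    refine (inter_subset_inter_left _ ?_).trans hS
    have e : (fun x : E3 => deriv m (x 2)) = partialD 2 (fun x : E3 => m (x 2)) := by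
      ext x; rw [partialD_comp_coord hm, if_pos rfl]
    rw [e]
    exact tsupport_partialD _ _
  have triv : ∀ m : E3 → ℝ, tsupport m ∩ cube A ⊆ cube A := fun _ => inter_subset_right
  refine ⟨fun i j => ?_, fun i => (h.weak0 i).mulZ hm (triv _), fun i j => ?_, fun i j k => ?_, fun i hi => ?_, h.bottom0.mulZ hm hS, ?_⟩
  · ext x; rw [h.symm2 i j]; ring
  · refine ((((h.weak0 j).mulZ hm1 (triv _)).const_mul (ez i)).add
      ((h.weak1 i j).mulZ hm (triv _))).congr (ae_of_all _ fun x => ?_) (ae_of_all _ fun x => ?_)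
    · simp only; ring
    · simp only; ring
  · refine (((((h.weak0 k).mulZ hm2 (triv _)).const_mul (ez i * ez j)).add
      ((((h.weak1 j k).mulZ hm1 (triv _)).const_mul (ez i)).add
        (((h.weak1 i k).mulZ hm1 (triv _)).const_mul (ez j)))).add
      ((h.weak2 i j k).mulZ hm (triv _))).congr (ae_of_all _ fun x => ?_) (ae_of_all _ fun x => ?_)
    · simp only; ring
    · simp only; ring
  -- The factor depends on the third coordinate only, so lateral differentiation does not reach it
  -- and the Neumann conditions survive.
  · have e : ez i = 0 := if_neg hi
    refine ((h.lateral i hi).mulZ hm (by simp)).congr (ae_of_all _ fun x => ?_)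
      (ae_of_all _ fun x => ?_)
    · simp only [e]; ring
    · simp only [e]; ring
  -- The normal derivative of the product is `m' u + m ∂_z u`; it has zero trace because both Cauchy
  -- data vanish.
  · refine (((h.bottom0.mulZ hm1 s1).const_mul (ez 2)).add
      (h.bottom1.mulZ hm hS)).congr (ae_of_all _ fun x => ?_) (ae_of_all _ fun x => ?_)
    · simp only; ring
    · simp only; ring

/-! ### Integral identities and inequalities for jets -/

/-- `f` is integrable over the cube, with integral zero. -/
def ZeroInt (A : ℝ) (f : E3 → ℝ) : Prop :=
  Integrable f (volume.restrict (cube A)) ∧ ∫ x in cube A, f x = 0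

lemma ZeroInt.add {A : ℝ} {f g : E3 → ℝ} (hf : ZeroInt A f) (hg : ZeroInt A g) :
    ZeroInt A fun x => f x + g x :=
  ⟨hf.1.add hg.1, by rw [integral_add hf.1 hg.1, hf.2, hg.2, add_zero]⟩

lemma ZeroInt.const_mul {A : ℝ} {f : E3 → ℝ} (hf : ZeroInt A f) (c : ℝ) :
    ZeroInt A fun x => c * f x :=
  ⟨hf.1.const_mul c, by rw [integral_const_mul, hf.2, mul_zero]⟩

lemma ZeroInt.sum {A : ℝ} {ι : Type*} (s : Finset ι) {f : ι → E3 → ℝ}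
    (hf : ∀ i ∈ s, ZeroInt A (f i)) : ZeroInt A fun x => ∑ i ∈ s, f i x :=
  ⟨integrable_finsetSum s fun i hi => (hf i hi).1, by
    rw [integral_finsetSum s fun i hi => (hf i hi).1]
    exact Finset.sum_eq_zero fun i hi => (hf i hi).2⟩

lemma ZeroInt.congr {A : ℝ} {f g : E3 → ℝ} (hf : ZeroInt A f) (h : ∀ x, f x = g x) :
    ZeroInt A g := by
  rwa [← funext h]

lemma Green.zeroInt {A : ℝ} (hA : 0 < A) {i : Fin 3} {a b w g : E3 → ℝ}
    (h : Green (cube A) univ i a b) (h' : Green (cube A) (cube A) i w g) :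
    ZeroInt A fun x => a x * g x + b x * w x :=
  ⟨(h.left.integrable_mul h'.right).add (h.right.integrable_mul h'.left),
    h.integral_by_parts hA h'⟩

/-- Reduces integral estimates to pointwise polynomial inequalities: all integrations by parts are
collected in the one term `z` of zero integral. -/
lemma ZeroInt.integral_le {A : ℝ} {f g z : E3 → ℝ} (hz : ZeroInt A z)
    (hf : Integrable f (volume.restrict (cube A))) (hg : Integrable g (volume.restrict (cube A)))
    (h : ∀ x ∈ cube A, f x ≤ g x + z x) : ∫ x in cube A, f x ≤ ∫ x in cube A, g x := by
  rw [← add_zero (∫ x in cube A, g x), ← hz.2, ← integral_add hg hz.1]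
  exact setIntegral_mono_on hf (hg.add hz.1) (isOpen_cube A).measurableSet h

section Jets

variable {A : ℝ} {u : E3 → ℝ} {u1 : Fin 3 → E3 → ℝ} {u2 : Fin 3 → Fin 3 → E3 → ℝ}
  {u3 : Fin 3 → Fin 3 → Fin 3 → E3 → ℝ}

lemma Green.mulZ_cube {m : ℝ → ℝ} (hm : ContDiff ℝ ∞ m)
    {i : Fin 3} {f g : E3 → ℝ} (hf : Green (cube A) (cube A) i f g) :
    Green (cube A) (cube A) i (fun x => m (x 2) * f x)
      (fun x => ez i * deriv m (x 2) * f x + m (x 2) * g x) :=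
  hf.mulZ hm inter_subset_right

/-- Two integrations by parts: `∫ u_ii u_jj = -∫ u_j u_iij = ∫ u_ij²`. The first uses the zero trace
of `u_j` on the faces orthogonal to axis `j`. The second uses that of `u_ij` on the faces orthogonal
to axis `i`, inherited from `u_i` by tangential differentiation. Third derivatives occur only in
between and cancel. -/
lemma ZeroJet.mixed (hA : 0 < A) (h : ZeroJet A univ u u1 u2 u3) (i j : Fin 3) :
    ZeroInt A fun x => u2 i i x * u2 j j x - u2 i j x ^ 2 := by
  have key : ∀ i j, i ≠ j → i ≠ 2 → ZeroInt A fun x => u2 i i x * u2 j j x - u2 i j x ^ 2 := by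
    intro i j hij hi
    have g1 : Green (cube A) univ j (u1 j) (u2 j j) := by
      by_cases hj : j = 2
      · subst hj; exact h.bottom1
      · exact h.lateral j hj
    have g2 := (h.lateral i hi).tangential hA hij (h.weak1 i j) (h.weak2 i i j)
    refine ((g1.zeroInt hA (h.weak2 i i j)).add
      ((g2.zeroInt hA (h.weak1 j i)).const_mul (-1))).congr fun x => ?_
    rw [h.symm2 j i]
    ring
  by_cases hij : i = j
  · subst hij
    exact ⟨by simp [pow_two], by simp [pow_two]⟩
  by_cases hi : i = 2
  · refine (key j i (Ne.symm hij) fun hj => hij (hi.trans hj.symm)).congr fun x => ?_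
    rw [h.symm2 j i]
    ring
  · exact key i j hij hi

/-- The second derivatives are controlled by the Laplacian. -/
lemma ZeroJet.integral_second_le (hA : 0 < A) (h : ZeroJet A univ u u1 u2 u3) (i j : Fin 3) :
    ∫ x in cube A, u2 i j x ^ 2 ≤ ∫ x in cube A, (∑ k, u2 k k x) ^ 2 := by
  have m : ∀ i j, MemLp (u2 i j) 2 (volume.restrict (cube A)) := fun i j => (h.weak1 i j).right
  have z := (ZeroInt.sum Finset.univ fun k _ =>
    ZeroInt.sum Finset.univ fun l _ => h.mixed hA k l).const_mul (-1)
  refine z.integral_le (m i j).integrable_sq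
    (memLp_finsetSum Finset.univ fun k _ => m k k).integrable_sq fun x _ => ?_
  have e : (∑ k, u2 k k x) ^ 2 + -1 * ∑ k, ∑ l, (u2 k k x * u2 l l x - u2 k l x ^ 2) =
      ∑ k, ∑ l, u2 k l x ^ 2 := by
    simp only [Finset.sum_sub_distrib]
    rw [← Finset.sum_mul_sum]
    ring
  rw [e]
  refine (Finset.single_le_sum (f := fun l => u2 i l x ^ 2) (fun _ _ => sq_nonneg _)
    (Finset.mem_univ j)).trans ?_
  exact Finset.single_le_sum (f := fun k => ∑ l, u2 k l x ^ 2)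
    (fun _ _ => Finset.sum_nonneg fun _ _ => sq_nonneg _) (Finset.mem_univ i)

/-! ### The Carleman weight and the Carleman estimate -/

/-- The Carleman weight, a function of the third coordinate. -/
def weight (A l : ℝ) (z : ℝ) : ℝ := Real.exp (l * (A + 1 - z) ^ 2)

lemma contDiff_weight (A l : ℝ) : ContDiff ℝ ∞ (weight A l) := by
  unfold weight; fun_prop

lemma deriv_weight (A l : ℝ) :
    deriv (weight A l) = fun z => l * (-2 * (A + 1 - z)) * weight A l z := by
  ext z
  have h1 : HasDerivAt (fun z => l * (A + 1 - z) ^ 2) (l * (-2 * (A + 1 - z))) z := by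
    have := (((hasDerivAt_id z).const_sub (A + 1)).pow 2).const_mul l
    refine this.congr_deriv ?_
    simp
  rw [show weight A l = fun z => Real.exp (l * (A + 1 - z) ^ 2) from rfl, h1.exp.deriv]
  ring

lemma deriv_deriv_weight (A l z : ℝ) :
    deriv (deriv (weight A l)) z =
      (l ^ 2 * (-2 * (A + 1 - z)) ^ 2 + 2 * l) * weight A l z := by
  have h1 : HasDerivAt (fun z => l * (-2 * (A + 1 - z))) (2 * l) z := by
    have := (((hasDerivAt_id z).const_sub (A + 1)).const_mul (-2)).const_mul l
    refine this.congr_deriv ?_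
    ring
  have h2 : HasDerivAt (weight A l) (deriv (weight A l) z) z :=
    (((contDiff_weight A l).differentiable (by simp)) z).hasDerivAt
  have h3 : HasDerivAt (fun z => l * (-2 * (A + 1 - z)) * weight A l z) _ z := h1.mul h2
  rw [deriv_weight, h3.deriv, deriv_weight]
  ring

/-- The Carleman estimate for the conjugated Laplacian. -/
lemma ZeroJet.carleman_conjugated (hA : 0 < A) (h : ZeroJet A univ u u1 u2 u3) :
    ∃ z₁ z₂ : E3 → ℝ, ZeroInt A z₁ ∧ ZeroInt A z₂ ∧ ∀ l : ℝ, ∃ z : E3 → ℝ, ZeroInt A z ∧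
      ∀ x : E3, 16 * l * u1 2 x ^ 2 + 16 * l ^ 3 * ((-2 * (A + 1 - x 2)) ^ 2 * u x ^ 2) ≤
        ((∑ i, u2 i i x) + l ^ 2 * (-2 * (A + 1 - x 2)) ^ 2 * u x
          - 2 * l * (-2 * (A + 1 - x 2)) * u1 2 x - 2 * l * u x) ^ 2 + z x ∧
      u x * ((∑ i, u2 i i x) + l ^ 2 * (-2 * (A + 1 - x 2)) ^ 2 * u x
          - 2 * l * (-2 * (A + 1 - x 2)) * u1 2 x - 2 * l * u x) =
        -(∑ i, u1 i x ^ 2) + l ^ 2 * (-2 * (A + 1 - x 2)) ^ 2 * u x ^ 2 + z₁ x + l * z₂ x := by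
  set p : ℝ → ℝ := fun z => -2 * (A + 1 - z) with hp
  have hps : ContDiff ℝ ∞ p := by fun_prop
  have hp1 : deriv p = fun _ => 2 := by
    ext z
    have := ((hasDerivAt_id z).const_sub (A + 1)).const_mul (-2)
    exact (this.congr_deriv (by ring)).deriv
  have hp3s : ContDiff ℝ ∞ fun z => p z ^ 3 := by fun_prop
  have hp3 : deriv (fun z => p z ^ 3) = fun z => 6 * p z ^ 2 := by
    ext z
    have := (((hps.differentiable (by simp)) z).hasDerivAt.pow 3).deriv
    rw [show (fun z => p z ^ 3) = p ^ 3 from rfl, this, hp1]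
    simp
    ring
  have full : ∀ (i : Fin 3), Green (cube A) univ i (u1 i) (u2 i i) := by
    intro i
    by_cases hi : i = 2
    · subst hi; exact h.bottom1
    · exact h.lateral i hi
  have ez2 : ez 2 = 1 := if_pos rfl
  have tang : ∀ i, i ≠ 2 → Green (cube A) univ 2 (u1 i) (u2 2 i) := fun i hi =>
    h.bottom0.tangential hA hi.symm (h.weak0 i) (h.weak1 2 i)
  -- the integrations by parts
  have z1 : ZeroInt A fun x => 2 * u1 2 x ^ 2 + 2 * p (x 2) * u1 2 x * u2 2 2 x := by
    refine ((full 2).zeroInt hA (Green.mulZ_cube hps (h.weak1 2 2))).congr fun x => ?_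
    simp only [ez2, hp1]; ring
  have z2 : ∀ i, ZeroInt A fun x => u1 i x ^ 2 + u x * u2 i i x := fun i => by
    refine ((full i).zeroInt hA (h.weak0 i)).congr fun x => ?_
    ring
  have z3 : ∀ i, i ≠ 2 → ZeroInt A fun x => p (x 2) * u1 i x * u2 2 i x
      + p (x 2) * u2 i i x * u1 2 x := fun i hi => by
    have ez0 : ez i = 0 := if_neg hi
    refine ((full i).zeroInt hA (Green.mulZ_cube hps (h.weak1 2 i))).congr fun x => ?_
    simp only [ez0]; ring
  have z4 : ∀ i, i ≠ 2 → ZeroInt A fun x => 2 * u1 i x ^ 2 + 2 * p (x 2) * u1 i x * u2 2 i x :=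
    fun i hi => by
      refine ((tang i hi).zeroInt hA (Green.mulZ_cube hps (h.weak1 i 2))).congr fun x => ?_
      simp only [ez2, hp1, h.symm2 i 2]; ring
  have z5 : ZeroInt A fun x => 6 * p (x 2) ^ 2 * u x ^ 2 + 2 * p (x 2) ^ 3 * u x * u1 2 x := by
    refine (h.bottom0.zeroInt hA (Green.mulZ_cube hp3s (h.weak0 2))).congr fun x => ?_
    simp only [ez2, hp3]; ring
  have z6 : ZeroInt A fun x => 2 * u x ^ 2 + 2 * p (x 2) * u x * u1 2 x := by
    refine (h.bottom0.zeroInt hA (Green.mulZ_cube hps (h.weak0 2))).congr fun x => ?_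
    simp only [ez2, hp1]; ring
  refine ⟨_, _, ((z2 0).add (z2 1)).add (z2 2), z6.const_mul (-1), fun l => ⟨_,
    (((((z1.const_mul (4 * l)).add (((z2 2).add ((z2 0).add (z2 1))).const_mul (8 * l))).add
      (((z3 0 (by decide)).add (z3 1 (by decide))).const_mul (8 * l))).add
      (((z4 0 (by decide)).add (z4 1 (by decide))).const_mul (-4 * l))).add
      (z5.const_mul (4 * l ^ 3))), fun x => ⟨?_, ?_⟩⟩⟩
  · change 16 * l * u1 2 x ^ 2 + 16 * l ^ 3 * (p (x 2) ^ 2 * u x ^ 2) ≤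
        ((∑ i, u2 i i x) + l ^ 2 * p (x 2) ^ 2 * u x
          - 2 * l * p (x 2) * u1 2 x - 2 * l * u x) ^ 2 + _
    simp only [Fin.sum_univ_three]
    generalize p (x 2) = q
    -- This is `(S u - T u)² ≥ 0`, that is, `(S u + T u)² ≥ 4 S u T u`.
    have key := sq_nonneg (u2 0 0 x + u2 1 1 x + u2 2 2 x + l ^ 2 * q ^ 2 * u x
      + 2 * l * q * u1 2 x + 2 * l * u x)
    linarith
  · change u x * ((∑ i, u2 i i x) + l ^ 2 * p (x 2) ^ 2 * u x
          - 2 * l * p (x 2) * u1 2 x - 2 * l * u x) =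
        -(∑ i, u1 i x ^ 2) + l ^ 2 * p (x 2) ^ 2 * u x ^ 2 + _ + _
    simp only [Fin.sum_univ_three]
    ring

lemma integrable_mul_sq {A : ℝ} {m f : E3 → ℝ} (hm : Continuous m)
    (hf : MemLp f 2 (volume.restrict (cube A))) :
    Integrable (fun x => m x ^ 2 * f x ^ 2) (volume.restrict (cube A)) :=
  (memLp_mul_of_continuous hm hf).integrable_sq.congr (ae_of_all _ fun _ => mul_pow _ _ _)

/-- The Carleman estimate for the Laplacian with the weight `exp (2 l (A + 1 - z)²)`. -/
lemma ZeroJet.carleman (hA : 0 < A) (h : ZeroJet A univ u u1 u2 u3) {l : ℝ} (hl : 1 ≤ l) :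
    ∫ x in cube A, weight A l (x 2) ^ 2 * (l * ∑ i, u1 i x ^ 2 + l ^ 3 * u x ^ 2) ≤
      ∫ x in cube A, weight A l (x 2) ^ 2 * (∑ i, u2 i i x) ^ 2 := by
  -- The conjugated estimate is applied to `v = weight * u`. Its operator acting on `v` is the
  -- weight times the Laplacian of `u`.
  have hv := h.mulZ (contDiff_weight A l) (S' := univ) (subset_univ _)
  obtain ⟨z₁, z₂, hz₁, hz₂, hz⟩ := hv.carleman_conjugated hA
  obtain ⟨z, hz, hx⟩ := hz l
  have mW : ∀ {f : E3 → ℝ}, MemLp f 2 (volume.restrict (cube A)) →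
      Integrable (fun x => weight A l (x 2) ^ 2 * f x ^ 2) (volume.restrict (cube A)) := fun hf =>
    integrable_mul_sq (contDiff_comp_coord (contDiff_weight A l) 2).continuous hf
  -- The commutator bound controls `v_z` and `v` but not the lateral derivatives, which come from
  -- `l` times the pairing identity. The pairing costs `P² / 2` for the product `l v P` and about `3
  -- l³ q² v²` in all. Five sixteenths of the commutator bound supply `5 l³ q² v²` at the price of
  -- `5 P² / 16`, and `1 / 2 + 5 / 16 < 1`.
  refine ((hz.const_mul (5 / 16)).add ((hz₁.add (hz₂.const_mul l)).const_mul l)).integral_le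
    ?_ (mW (memLp_finsetSum Finset.univ fun k _ => (h.weak1 k k).right)) fun x hxQ => ?_
  · have : Integrable (fun x => (∑ i, l * (weight A l (x 2) ^ 2 * u1 i x ^ 2))
        + l ^ 3 * (weight A l (x 2) ^ 2 * u x ^ 2)) (volume.restrict (cube A)) :=
      (integrable_finsetSum _ fun i _ => (mW (h.weak0 i).right).const_mul _).add
        ((mW (h.weak0 0).left).const_mul _)
    refine this.congr (ae_of_all _ fun x => ?_)
    simp only [Fin.sum_univ_three]; ring
  · obtain ⟨e1, e2⟩ := hx x
    -- The shift by one in the weight keeps its logarithmic derivative away from zero up to the top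
    -- face.
    have hp : 1 ≤ A + 1 - x 2 := by linarith [(hxQ 2).2]
    have ez2 : ez 2 = 1 := if_pos rfl
    have ez0 : ez 0 = 0 := if_neg (by decide)
    have ez1 : ez 1 = 0 := if_neg (by decide)
    rw [deriv_deriv_weight, deriv_weight] at *
    simp only [Fin.sum_univ_three, ez0, ez1, ez2] at e1 e2 ⊢
    generalize weight A l (x 2) = m at *
    generalize hq : -2 * (A + 1 - x 2) = q at *
    have hq2 : 4 ≤ q ^ 2 := by nlinarith
    generalize u x = a at *
    generalize u1 0 x = a0 at *
    generalize u1 1 x = a1 at *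
    generalize u1 2 x = a2 at *
    generalize u2 0 0 x = s0 at *
    generalize u2 1 1 x = s1 at *
    generalize u2 2 2 x = s2 at *
    have hP : ∀ P, P = m * (s0 + s1 + s2) → ∀ b, b = l * q * m * a + m * a2 →
        m ^ 2 * (l * (a0 ^ 2 + a1 ^ 2 + a2 ^ 2) + l ^ 3 * a ^ 2) ≤
          m ^ 2 * (s0 + s1 + s2) ^ 2 + (5 / 16 * z x + l * (z₁ x + l * z₂ x)) := by
      intro P hP b hb
      have e1' : 16 * l * b ^ 2 + 16 * l ^ 3 * (q ^ 2 * (m * a) ^ 2) ≤ P ^ 2 + z x := by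
        rw [hP, hb]; linarith [e1]
      have e2' : m * a * P = -((m * a0) ^ 2 + (m * a1) ^ 2 + b ^ 2)
          + l ^ 2 * q ^ 2 * (m * a) ^ 2 + z₁ x + l * z₂ x := by
        rw [hP, hb]; linarith [e2]
      have e3 : m ^ 2 * (l * (a0 ^ 2 + a1 ^ 2 + a2 ^ 2) + l ^ 3 * a ^ 2) =
          l * ((m * a0) ^ 2 + (m * a1) ^ 2 + (b - l * q * (m * a)) ^ 2) + l ^ 3 * (m * a) ^ 2 := by
        rw [hb]; ring
      have e4 : m ^ 2 * (s0 + s1 + s2) ^ 2 = P ^ 2 := by rw [hP]; ring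
      rw [e3, e4]
      generalize m * a = V at *
      generalize m * a0 = w0 at *
      generalize m * a1 = w1 at *
      have f1 : 0 ≤ (P + l * V) ^ 2 := sq_nonneg _
      have f2 : 0 ≤ l * (b + l * q * V) ^ 2 := by positivity
      have f3 : l ^ 2 * V ^ 2 ≤ l ^ 3 * V ^ 2 :=
        mul_le_mul_of_nonneg_right (pow_le_pow_right₀ hl (by norm_num)) (sq_nonneg _)
      have f4 : 4 * (l ^ 3 * V ^ 2) ≤ q ^ 2 * (l ^ 3 * V ^ 2) :=
        mul_le_mul_of_nonneg_right hq2 (by positivity)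
      have f5 : 0 ≤ l * b ^ 2 := by positivity
      have f6 : 0 ≤ l ^ 3 * V ^ 2 := by positivity
      have e5 : l * (V * P) = l * (-(w0 ^ 2 + w1 ^ 2 + b ^ 2)
          + l ^ 2 * q ^ 2 * V ^ 2 + z₁ x + l * z₂ x) := by rw [e2']
      nlinarith only [f1, f2, f3, f4, f5, f6, e5, e1', sq_nonneg P]
    exact hP _ rfl _ rfl

end Jets

/-! ### The coefficients of the elliptic system -/

lemma contDiff_psi (d : ℝ) (n : ℕ) : ContDiff ℝ ∞ (psi d n) := by
  induction n using Nat.strong_induction_on with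
  | _ n ih =>
    rw [psi]
    have h : ∀ i : Fin n, ContDiff ℝ ∞ (psi d i) := fun i => ih i i.2
    refine ContDiff.div_const (ContDiff.sub (by fun_prop) (ContDiff.sum fun i _ => ?_)) _
    exact contDiff_const.mul (h i)

lemma norm_sub_source_sq (A b t : ℝ) (x : E3) :
    ‖x - source A b t‖ ^ 2 = (x 0 - t) ^ 2 + x 1 ^ 2 + (x 2 + A + b) ^ 2 := by
  rw [EuclideanSpace.norm_sq_eq]
  simp [Fin.sum_univ_three, source]
  ring

lemma le_norm_sub_source_sq {A b : ℝ} (hb : 0 < b) (t : ℝ) {x : E3} (hx : x ∈ closedCube A) :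
    b ^ 2 ≤ ‖x - source A b t‖ ^ 2 := by
  rw [norm_sub_source_sq]
  have := (hx 2).1
  nlinarith [sq_nonneg (x 0 - t), sq_nonneg (x 1)]

/-- Covers both families of coefficients at once, the numerators being affine in the source
position. On the closed cube the squared distance to the source is at least `b²`; replacing it by
its maximum with `b²` changes nothing there and gives an integrand that is continuous everywhere. -/
lemma continuous_entry {A b : ℝ} (hb : 0 < b) (d : ℝ) {α : E3 → ℝ} (hα : Continuous α) (β : ℝ)
    {ψ χ : ℝ → ℝ} (hψ : ContDiff ℝ ∞ ψ) (hχ : ContDiff ℝ ∞ χ) :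
    ∃ c : E3 → ℝ, Continuous c ∧ ∀ x ∈ closedCube A,
      ∫ s in (-d)..d, deriv (fun t => (α x + β * t) / ‖x - source A b t‖ ^ 2 * ψ t) s * χ s
        = c x := by
  let D : E3 → ℝ → ℝ := fun x s => max ((x 0 - s) ^ 2 + x 1 ^ 2 + (x 2 + A + b) ^ 2) (b ^ 2)
  have hD0 : ∀ x s, D x s ≠ 0 := fun x s =>
    (lt_of_lt_of_le (by positivity : 0 < b ^ 2) (le_max_right _ _)).ne'
  have hψ' : Continuous (deriv ψ) := hψ.continuous_deriv (by simp)
  let F : E3 → ℝ → ℝ := fun x s =>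
    ((β * D x s - (α x + β * s) * (-2 * (x 0 - s))) / (D x s) ^ 2 * ψ s
      + (α x + β * s) / D x s * deriv ψ s) * χ s
  refine ⟨fun x => ∫ s in (-d)..d, F x s, ?_, fun x hx => ?_⟩
  · refine intervalIntegral.continuous_parametric_intervalIntegral_of_continuous' ?_ _ _
    have c0 := (continuous_coord 0).comp (continuous_fst (X := E3) (Y := ℝ))
    have c1 := (continuous_coord 1).comp (continuous_fst (X := E3) (Y := ℝ))
    have c2 := (continuous_coord 2).comp (continuous_fst (X := E3) (Y := ℝ))
    have cα := hα.comp (continuous_fst (X := E3) (Y := ℝ))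
    have cψ := hψ.continuous.comp (continuous_snd (X := E3) (Y := ℝ))
    have cψ' := hψ'.comp (continuous_snd (X := E3) (Y := ℝ))
    have cχ := hχ.continuous.comp (continuous_snd (X := E3) (Y := ℝ))
    have cs := continuous_snd (X := E3) (Y := ℝ)
    have cD : Continuous fun q : E3 × ℝ => D q.1 q.2 :=
      ((((c0.sub cs).pow 2).add (c1.pow 2)).add
        (((c2.add continuous_const).add continuous_const).pow 2)).max continuous_const
    have cl : Continuous fun q : E3 × ℝ => α q.1 + β * q.2 := cα.add (continuous_const.mul cs)
    exact ((((continuous_const.mul cD).sub (cl.mul (continuous_const.mul (c0.sub cs)))).div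
      (cD.pow 2) fun q => pow_ne_zero 2 (hD0 _ _)).mul cψ |>.add
        ((cl.div cD fun q => hD0 _ _).mul cψ')).mul cχ
  · refine intervalIntegral.integral_congr fun s _ => ?_
    have hD : ∀ s, ‖x - source A b s‖ ^ 2 = D x s := fun s => by
      have := le_norm_sub_source_sq hb s hx
      rw [norm_sub_source_sq] at this ⊢
      exact (max_eq_left this).symm
    have h1 : HasDerivAt (fun t => α x + β * t) β s :=
      (((hasDerivAt_id s).const_mul β).const_add (α x)).congr_deriv (by simp)
    have h2 : HasDerivAt (fun t => ‖x - source A b t‖ ^ 2) (-2 * (x 0 - s)) s := by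
      have : HasDerivAt (fun t => (x 0 - t) ^ 2 + x 1 ^ 2 + (x 2 + A + b) ^ 2)
          (-2 * (x 0 - s)) s := by
        refine (((((hasDerivAt_id s).const_sub (x 0)).pow 2).add_const _).add_const
          _).congr_deriv ?_
        simp
      exact this.congr_of_eventuallyEq (Eventually.of_forall fun t => norm_sub_source_sq A b t x)
    have h3 : HasDerivAt ψ (deriv ψ s) s := ((hψ.differentiable (by simp)) s).hasDerivAt
    have h4 := ((h1.div h2 (by rw [hD]; exact hD0 x s)).mul h3).deriv
    have h5 : deriv (fun t => (α x + β * t) / ‖x - source A b t‖ ^ 2 * ψ t) s = _ := h4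
    change deriv (fun t => (α x + β * t) / ‖x - source A b t‖ ^ 2 * ψ t) s * χ s = F x s
    rw [h5]
    simp only [F, Pi.div_apply, hD]

lemma continuous_rawFirst {A b : ℝ} (hb : 0 < b) (d : ℝ) (N : ℕ) (j : Fin 3) (m n : Fin N) :
    ∃ c : E3 → ℝ, Continuous c ∧ ∀ x ∈ closedCube A, rawFirst A b d N j x m n = c x := by
  obtain ⟨c, hc, h⟩ := continuous_entry (A := A) hb d
    (α := fun x => 2 * (x j - source A b 0 j))
    (continuous_const.mul ((continuous_coord j).sub continuous_const))
    -- The source moves along the first axis only, so only the first component of `2 (x - x₀)`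
    -- depends on `s`.
    (if j = 0 then -2 else 0) (contDiff_psi d n) (contDiff_psi d m)
  refine ⟨c, hc, fun x hx => ?_⟩
  rw [← h x hx, rawFirst]
  simp only [Matrix.of_apply]
  congr 1; ext s; congr 2; ext t; congr 2
  fin_cases j <;> simp [source]
  ring

lemma continuous_rawZeroth {A b : ℝ} (hb : 0 < b) (d : ℝ) (N : ℕ) (m n : Fin N) :
    ∃ c : E3 → ℝ, Continuous c ∧ ∀ x ∈ closedCube A, rawZeroth A b d N x m n = c x := by
  obtain ⟨c, hc, h⟩ := continuous_entry (A := A) hb d (α := fun _ => 4) continuous_const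
    0 (contDiff_psi d n) (contDiff_psi d m)
  refine ⟨c, hc, fun x hx => ?_⟩
  rw [← h x hx, rawZeroth]
  simp

lemma continuous_matrix_mul {A : ℝ} {N : ℕ} (P : Matrix (Fin N) (Fin N) ℝ)
    {R : E3 → Matrix (Fin N) (Fin N) ℝ}
    (h : ∀ m n, ∃ c : E3 → ℝ, Continuous c ∧ ∀ x ∈ closedCube A, R x m n = c x) (m n : Fin N) :
    ∃ c : E3 → ℝ, Continuous c ∧ ∀ x ∈ closedCube A, (P * R x) m n = c x := by
  choose c hc h using h
  refine ⟨fun x => ∑ k, P m k * c k n x,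
    continuous_finsetSum _ fun k _ => continuous_const.mul (hc k n), fun x hx => ?_⟩
  rw [Matrix.mul_apply]
  exact Finset.sum_congr rfl fun k _ => by rw [h k n x hx]

lemma continuous_coeffFirst {A b : ℝ} (hb : 0 < b) (d : ℝ) (N : ℕ) (j : Fin 3) (m n : Fin N) :
    ∃ c : E3 → ℝ, Continuous c ∧ ∀ x ∈ closedCube A, coeffFirst A b d N j x m n = c x := by
  obtain ⟨c, hc, h⟩ := continuous_matrix_mul (basisMatrix d N)⁻¹ (continuous_rawFirst hb d N j) m n
  exact ⟨fun x => -c x, hc.neg, fun x hx => by rw [coeffFirst, Matrix.neg_apply, h x hx]⟩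

lemma continuous_coeffZeroth {A b : ℝ} (hb : 0 < b) (d : ℝ) (N : ℕ) (m n : Fin N) :
    ∃ c : E3 → ℝ, Continuous c ∧ ∀ x ∈ closedCube A, coeffZeroth A b d N x m n = c x :=
  continuous_matrix_mul (basisMatrix d N)⁻¹ (continuous_rawZeroth hb d N) m n

/-- The Frobenius norm of a matrix function is bounded by its `matNorm`. -/
lemma sum_sq_le_of_matNorm {A K : ℝ} {N : ℕ} {M : E3 → Matrix (Fin N) (Fin N) ℝ}
    (h : ∀ m n, ∃ c : E3 → ℝ, Continuous c ∧ ∀ x ∈ closedCube A, M x m n = c x)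
    (hK : matNorm A M ≤ K) {x : E3} (hx : x ∈ closedCube A) : ∑ m, ∑ n, M x m n ^ 2 ≤ K ^ 2 := by
  rw [matNorm] at hK
  have h0 : 0 ≤ ∑ m, ∑ n, (sSup ((fun x => |M x m n|) '' closedCube A)) ^ 2 :=
    Finset.sum_nonneg fun _ _ => Finset.sum_nonneg fun _ _ => sq_nonneg _
  have h1 := pow_le_pow_left₀ (Real.sqrt_nonneg _) hK 2
  rw [Real.sq_sqrt h0] at h1
  refine le_trans (Finset.sum_le_sum fun m _ => Finset.sum_le_sum fun n _ => ?_) h1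
  obtain ⟨c, hc, e⟩ := h m n
  -- The supremum of an unbounded set of reals is zero by convention, so `matNorm` controls the
  -- entries only because they are continuous on the compact cube.
  have hb : BddAbove ((fun x => |M x m n|) '' closedCube A) := by
    obtain ⟨C, hC⟩ := (isCompact_closedCube A).exists_bound_of_continuousOn hc.continuousOn
    refine ⟨C, ?_⟩
    rintro _ ⟨y, hy, rfl⟩
    simp only [e y hy]
    exact hC y hy
  have := le_csSup hb ⟨x, hx, rfl⟩
  rw [← sq_abs (M x m n)]
  exact pow_le_pow_left₀ (abs_nonneg _) this 2

/-- Cauchy–Schwarz in each row. The Frobenius norm makes the bound independent of the size `N`. -/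
lemma sum_sq_mulVec_le {N : ℕ} {K : ℝ} {C : Matrix (Fin N) (Fin N) ℝ}
    (h : ∑ m, ∑ n, C m n ^ 2 ≤ K ^ 2) (y : Fin N → ℝ) :
    ∑ m, (∑ n, C m n * y n) ^ 2 ≤ K ^ 2 * ∑ n, y n ^ 2 := by
  refine le_trans (Finset.sum_le_sum fun m _ => Finset.sum_mul_sq_le_sq_mul_sq _ _ _) ?_
  rw [← Finset.sum_mul]
  exact mul_le_mul_of_nonneg_right h (Finset.sum_nonneg fun _ _ => sq_nonneg _)

lemma memLp_coeff_mul {A : ℝ} {N : ℕ} {M : E3 → Matrix (Fin N) (Fin N) ℝ} {m n : Fin N}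
    (h : ∃ c : E3 → ℝ, Continuous c ∧ ∀ x ∈ closedCube A, M x m n = c x) {f : E3 → ℝ}
    (hf : MemLp f 2 (volume.restrict (cube A))) :
    MemLp (fun x => M x m n * f x) 2 (volume.restrict (cube A)) := by
  obtain ⟨c, hc, e⟩ := h
  refine (memLp_mul_of_continuous hc hf).ae_eq ?_
  filter_upwards [ae_restrict_mem (isOpen_cube A).measurableSet] with x hx
  rw [e x (cube_subset_closedCube A hx)]

/-! ### Cutoff functions of one variable -/

/-- A smooth function equal to one before `a` and to zero after `a'`, with derivatives bounded
by `C`. -/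
structure IsCutoff (a a' C : ℝ) (ζ : ℝ → ℝ) : Prop where
  smooth : ContDiff ℝ ∞ ζ
  abs_le : ∀ z, |ζ z| ≤ 1
  one : ∀ z, z < a → ζ z = 1 ∧ deriv ζ z = 0 ∧ deriv (deriv ζ) z = 0
  zero : ∀ z, a' < z → ζ z = 0 ∧ deriv ζ z = 0 ∧ deriv (deriv ζ) z = 0
  abs_deriv_le : ∀ z, |deriv ζ z| ≤ C ∧ |deriv (deriv ζ) z| ≤ C

lemma exists_isCutoff {a a' : ℝ} (h : a < a') : ∃ C ζ, 0 < C ∧ IsCutoff a a' C ζ := by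
  have h' : 0 < a' - a := sub_pos.2 h
  set ζ : ℝ → ℝ := fun z => Real.smoothTransition ((a' - z) / (a' - a)) with hζ
  have hs : ContDiff ℝ ∞ ζ := Real.smoothTransition.contDiff.comp (by fun_prop)
  have h1 : ∀ z, z < a → ζ z = 1 := fun z hz =>
    Real.smoothTransition.one_of_one_le (by rw [le_div_iff₀ h']; linarith)
  have h0 : ∀ z, a' < z → ζ z = 0 := fun z hz =>
    Real.smoothTransition.zero_of_nonpos (div_nonpos_of_nonpos_of_nonneg (by linarith) h'.le)
  have loc : ∀ {f : ℝ → ℝ} {c : ℝ} {s : Set ℝ}, IsOpen s → (∀ z ∈ s, f z = c) →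
      ∀ z ∈ s, deriv f z = 0 := by
    intro f c s hs hf z hz
    have : f =ᶠ[𝓝 z] fun _ => c := by
      filter_upwards [hs.mem_nhds hz] with y hy using hf y hy
    rw [this.deriv_eq, deriv_const]
  have d1 := loc isOpen_Iio h1
  have d1' := loc isOpen_Ioi h0
  have d2 := loc isOpen_Iio d1
  have d2' := loc isOpen_Ioi d1'
  have hs1 : ContDiff ℝ ∞ (deriv ζ) := (contDiff_infty_iff_deriv.1 hs).2
  have hs2 : ContDiff ℝ ∞ (deriv (deriv ζ)) := (contDiff_infty_iff_deriv.1 hs1).2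
  have bd : ∀ f : ℝ → ℝ, Continuous f → (∀ z ∈ Iio a, f z = 0) → (∀ z ∈ Ioi a', f z = 0) →
      ∃ C, 0 < C ∧ ∀ z, |f z| ≤ C := by
    intro f hf hl hr
    obtain ⟨C, hC⟩ := (isCompact_Icc (a := a) (b := a')).exists_bound_of_continuousOn
      hf.continuousOn
    refine ⟨max C 1, by positivity, fun z => ?_⟩
    by_cases hz : z ∈ Icc a a'
    · exact (hC z hz).trans (le_max_left _ _)
    · have : f z = 0 := by
        rw [mem_Icc, not_and_or, not_le, not_le] at hz
        exact hz.elim (hl z) (hr z)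
      rw [this, abs_zero]
      positivity
  obtain ⟨C1, p1, b1⟩ := bd _ hs1.continuous d1 d1'
  obtain ⟨C2, p2, b2⟩ := bd _ hs2.continuous d2 d2'
  refine ⟨max C1 C2, ζ, by positivity, hs, fun z => ?_, fun z hz => ⟨h1 z hz, d1 z hz, d2 z hz⟩,
    fun z hz => ⟨h0 z hz, d1' z hz, d2' z hz⟩,
    fun z => ⟨(b1 z).trans (le_max_left _ _), (b2 z).trans (le_max_right _ _)⟩⟩
  rw [abs_of_nonneg (Real.smoothTransition.nonneg _)]
  exact Real.smoothTransition.le_one _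

/-! ### Estimates for the system -/

/-- The sum of the squares of the components of `W` and of their first derivatives. -/
def density (A : ℝ) {N : ℕ} (W : Fin N → E3 → ℝ) (x : E3) : ℝ :=
  ∑ n, (∑ i, weakD (cube A) i (W n) x ^ 2 + W n x ^ 2)

lemma density_nonneg (A : ℝ) {N : ℕ} (W : Fin N → E3 → ℝ) (x : E3) : 0 ≤ density A W x :=
  Finset.sum_nonneg fun _ _ => add_nonneg (Finset.sum_nonneg fun _ _ => sq_nonneg _) (sq_nonneg _)

lemma memLp_weakD {A : ℝ} {u : E3 → ℝ} {k : ℕ} (hk : 1 ≤ k) (h : MemH k (cube A) u) (i : Fin 3) :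
    MemLp (weakD (cube A) i u) 2 (volume.restrict (cube A)) :=
  (h.spec (isOpen_cube A) (by simpa using hk)).2

lemma memLp_weakLaplacian {A : ℝ} {u : E3 → ℝ} {k : ℕ} (hk : 2 ≤ k) (h : MemH k (cube A) u) :
    MemLp (weakLaplacian (cube A) u) 2 (volume.restrict (cube A)) :=
  memLp_finsetSum _ fun i _ => (h.spec (isOpen_cube A) (by simpa using hk)).2

lemma integrable_density {A : ℝ} {N k : ℕ} (hk : 1 ≤ k) {W : Fin N → E3 → ℝ}
    (h : ∀ n, MemH k (cube A) (W n)) : Integrable (density A W) (volume.restrict (cube A)) :=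
  integrable_finsetSum _ fun n _ => (integrable_finsetSum _ fun i _ =>
    (memLp_weakD hk (h n) i).integrable_sq).add ((h n).memLp (isOpen_cube A)).integrable_sq

section System

variable {A b d K : ℝ} {N : ℕ}

lemma memLp_opL (hb : 0 < b) {k : ℕ} (hk : 2 ≤ k) {W : Fin N → E3 → ℝ}
    (h : ∀ n, MemH k (cube A) (W n)) (m : Fin N) :
    MemLp (opL A b d W m) 2 (volume.restrict (cube A)) :=
  ((memLp_weakLaplacian hk (h m)).add (memLp_finsetSum _ fun j _ => memLp_finsetSum _ fun n _ =>
    memLp_coeff_mul (continuous_coeffFirst hb d N j m n)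
      (memLp_weakD (by omega) (h n) j))).add (memLp_finsetSum _ fun n _ =>
    memLp_coeff_mul (continuous_coeffZeroth hb d N m n) ((h n).memLp (isOpen_cube A)))

lemma integrable_sum_sq_opL (hb : 0 < b) {k : ℕ} (hk : 2 ≤ k) {W : Fin N → E3 → ℝ}
    (h : ∀ n, MemH k (cube A) (W n)) :
    Integrable (fun x => ∑ m, opL A b d W m x ^ 2) (volume.restrict (cube A)) :=
  integrable_finsetSum _ fun m _ => (memLp_opL hb hk h m).integrable_sq

lemma sum_sq_add_le {ι : Type*} (s : Finset ι) (f g : ι → ℝ) :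
    ∑ i ∈ s, (f i + g i) ^ 2 ≤ 2 * ∑ i ∈ s, f i ^ 2 + 2 * ∑ i ∈ s, g i ^ 2 := by
  rw [Finset.mul_sum, Finset.mul_sum, ← Finset.sum_add_distrib]
  exact Finset.sum_le_sum fun i _ => by nlinarith [sq_nonneg (f i - g i)]

lemma sum_sq_add_three_le {ι : Type*} (s : Finset ι) (f g h : ι → ℝ) :
    ∑ i ∈ s, (f i + g i + h i) ^ 2 ≤
      3 * ∑ i ∈ s, f i ^ 2 + 3 * ∑ i ∈ s, g i ^ 2 + 3 * ∑ i ∈ s, h i ^ 2 := by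
  rw [Finset.mul_sum, Finset.mul_sum, Finset.mul_sum, ← Finset.sum_add_distrib,
    ← Finset.sum_add_distrib]
  exact Finset.sum_le_sum fun i _ => by
    nlinarith [sq_nonneg (f i - g i), sq_nonneg (f i - h i), sq_nonneg (g i - h i)]

/-- The lower order terms of the system are bounded by the norms of the coefficients. -/
lemma sum_sq_lower_le (hb : 0 < b) (h1 : ∀ j, matNorm A (coeffFirst A b d N j) ≤ K)
    (h0 : matNorm A (coeffZeroth A b d N) ≤ K) {x : E3} (hx : x ∈ closedCube A)
    (y : Fin 3 → Fin N → ℝ) (y0 : Fin N → ℝ) :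
    ∑ m, (∑ j, ∑ n, coeffFirst A b d N j x m n * y j n
      + ∑ n, coeffZeroth A b d N x m n * y0 n) ^ 2 ≤
      4 * K ^ 2 * (∑ n, (∑ j, y j n ^ 2 + y0 n ^ 2)) := by
  have e1 : ∀ j, ∑ m, (∑ n, coeffFirst A b d N j x m n * y j n) ^ 2 ≤ K ^ 2 * ∑ n, y j n ^ 2 :=
    fun j => sum_sq_mulVec_le (sum_sq_le_of_matNorm (continuous_coeffFirst hb d N j) (h1 j) hx) _
  have e0 : ∑ m, (∑ n, coeffZeroth A b d N x m n * y0 n) ^ 2 ≤ K ^ 2 * ∑ n, y0 n ^ 2 :=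
    sum_sq_mulVec_le (sum_sq_le_of_matNorm (continuous_coeffZeroth hb d N) h0 hx) _
  have four : ∀ a b c d : ℝ, (a + b + c + d) ^ 2 ≤ 4 * (a ^ 2 + b ^ 2 + c ^ 2 + d ^ 2) := by
    intro a b c d
    nlinarith [sq_nonneg (a - b), sq_nonneg (a - c), sq_nonneg (a - d), sq_nonneg (b - c),
      sq_nonneg (b - d), sq_nonneg (c - d)]
  have p := e1 0
  have q := e1 1
  have r := e1 2
  simp only [Fin.sum_univ_three]
  refine (Finset.sum_le_sum fun m _ => four _ _ _ _).trans ?_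
  simp only [← Finset.mul_sum, Finset.sum_add_distrib]
  linarith

/-- The Laplacian of the product of a component with a cutoff function. -/
def cutLap (A : ℝ) (ζ : ℝ → ℝ) (u : E3 → ℝ) (x : E3) : ℝ :=
  ∑ i, (ez i * ez i * deriv (deriv ζ) (x 2) * u x
        + deriv ζ (x 2) * (ez i * weakD (cube A) i u x + ez i * weakD (cube A) i u x)
        + ζ (x 2) * weakDeriv (cube A) (idx2 i i) u x)

/-- The gradient of the product of a component with a cutoff function. -/
def cutGrad (A : ℝ) (ζ : ℝ → ℝ) (u : E3 → ℝ) (i : Fin 3) (x : E3) : ℝ :=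
  ez i * deriv ζ (x 2) * u x + ζ (x 2) * weakD (cube A) i u x

lemma weakLaplacian_eq (A : ℝ) (u : E3 → ℝ) (x : E3) :
    weakLaplacian (cube A) u x = ∑ i, weakDeriv (cube A) (idx2 i i) u x := by
  refine Finset.sum_congr rfl fun i _ => ?_
  rw [idx2, ← Pi.single_add]

lemma ez_zero : ez 0 = 0 := if_neg (by decide)
lemma ez_one : ez 1 = 0 := if_neg (by decide)
lemma ez_two : ez 2 = 1 := if_pos rfl

/-- The Laplacian after a cutoff, in terms of the operator of the system. -/
lemma sum_sq_cutLap_le (hb : 0 < b) (h1 : ∀ j, matNorm A (coeffFirst A b d N j) ≤ K)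
    (h0 : matNorm A (coeffZeroth A b d N) ≤ K) {a a' C : ℝ} {ζ : ℝ → ℝ} (hζ : IsCutoff a a' C ζ)
    (W : Fin N → E3 → ℝ) {x : E3} (hx : x ∈ closedCube A) :
    ∑ m, cutLap A ζ (W m) x ^ 2 ≤ 3 * ∑ m, opL A b d W m x ^ 2
      + 12 * K ^ 2 * (∑ n, (∑ i, cutGrad A ζ (W n) i x ^ 2 + (ζ (x 2) * W n x) ^ 2))
      + (36 + 9 * K ^ 2) * C ^ 2 * (if a ≤ x 2 ∧ x 2 ≤ a' then density A W x else 0) := by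
  set ζ0 := ζ (x 2) with hζ0
  set ζ1 := deriv ζ (x 2) with hζ1
  set ζ2 := deriv (deriv ζ) (x 2) with hζ2
  -- The commutator of `L` with the cutoff: `L (ζ W) = ζ L W + R`. Since `ζ` depends on the third
  -- coordinate only, just the coefficient of `∂_z` appears, and `R` vanishes outside the strip
  -- where `ζ` varies.
  set R : Fin N → ℝ := fun m => ζ2 * W m x + 2 * ζ1 * weakD (cube A) 2 (W m) x
    + ∑ n, coeffFirst A b d N 2 x m n * (ζ1 * W n x) with hR
  have split : ∀ m, cutLap A ζ (W m) x = ζ0 * opL A b d W m x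
      + -(∑ j, ∑ n, coeffFirst A b d N j x m n * cutGrad A ζ (W n) j x
        + ∑ n, coeffZeroth A b d N x m n * (ζ0 * W n x)) + R m := by
    intro m
    have e1 : ∀ j, ∑ n, coeffFirst A b d N j x m n * cutGrad A ζ (W n) j x =
        ez j * ∑ n, coeffFirst A b d N j x m n * (ζ1 * W n x)
          + ζ0 * ∑ n, coeffFirst A b d N j x m n * weakD (cube A) j (W n) x := by
      intro j
      rw [Finset.mul_sum, Finset.mul_sum, ← Finset.sum_add_distrib]
      refine Finset.sum_congr rfl fun n _ => ?_
      rw [cutGrad]; ring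
    have e2 : ∑ n, coeffZeroth A b d N x m n * (ζ0 * W n x) =
        ζ0 * ∑ n, coeffZeroth A b d N x m n * W n x := by
      rw [Finset.mul_sum]
      exact Finset.sum_congr rfl fun n _ => by ring
    simp only [e1, e2, opL, weakLaplacian_eq, cutLap, hR, Fin.sum_univ_three, ez_zero, ez_one,
      ez_two]
    ring
  have t := sum_sq_add_three_le Finset.univ (fun m => ζ0 * opL A b d W m x)
    (fun m => -(∑ j, ∑ n, coeffFirst A b d N j x m n * cutGrad A ζ (W n) j x
        + ∑ n, coeffZeroth A b d N x m n * (ζ0 * W n x))) R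
  have t1 : ∑ m, (ζ0 * opL A b d W m x) ^ 2 ≤ ∑ m, opL A b d W m x ^ 2 := by
    refine Finset.sum_le_sum fun m _ => ?_
    rw [mul_pow]
    refine mul_le_of_le_one_left (sq_nonneg _) ?_
    rw [← sq_abs]
    exact pow_le_one₀ (abs_nonneg _) (hζ.abs_le _)
  have t2 := sum_sq_lower_le hb h1 h0 hx (fun j n => cutGrad A ζ (W n) j x) fun n => ζ0 * W n x
  have t3 : ∑ m, R m ^ 2 ≤
      (12 + 3 * K ^ 2) * C ^ 2 * (if a ≤ x 2 ∧ x 2 ≤ a' then density A W x else 0) := by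
    by_cases hz : a ≤ x 2 ∧ x 2 ≤ a'
    · rw [if_pos hz]
      have c1 : ζ1 ^ 2 ≤ C ^ 2 := sq_le_sq' (abs_le.1 (hζ.abs_deriv_le _).1).1
        (abs_le.1 (hζ.abs_deriv_le _).1).2
      have c2 : ζ2 ^ 2 ≤ C ^ 2 := sq_le_sq' (abs_le.1 (hζ.abs_deriv_le _).2).1
        (abs_le.1 (hζ.abs_deriv_le _).2).2
      have s := sum_sq_add_three_le Finset.univ (fun m => ζ2 * W m x)
        (fun m => 2 * ζ1 * weakD (cube A) 2 (W m) x)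
        (fun m => ∑ n, coeffFirst A b d N 2 x m n * (ζ1 * W n x))
      have s1 := sum_sq_mulVec_le
        (sum_sq_le_of_matNorm (continuous_coeffFirst hb d N 2) (h1 2) hx) fun n => ζ1 * W n x
      simp only [mul_pow, ← Finset.mul_sum] at s s1
      have d1 : ∑ n, W n x ^ 2 + ∑ n, weakD (cube A) 2 (W n) x ^ 2 ≤ density A W x := by
        rw [← Finset.sum_add_distrib]
        refine Finset.sum_le_sum fun n _ => ?_
        rw [Fin.sum_univ_three]
        linarith [sq_nonneg (weakD (cube A) 0 (W n) x), sq_nonneg (weakD (cube A) 1 (W n) x)]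
      have p1 : 0 ≤ ∑ n, W n x ^ 2 := Finset.sum_nonneg fun _ _ => sq_nonneg _
      have p2 : 0 ≤ ∑ n, weakD (cube A) 2 (W n) x ^ 2 := Finset.sum_nonneg fun _ _ => sq_nonneg _
      refine s.trans ?_
      generalize ∑ n, W n x ^ 2 = w at *
      generalize ∑ n, weakD (cube A) 2 (W n) x ^ 2 = g at *
      have k1 := mul_le_mul_of_nonneg_right c2 p1
      have k2 := mul_le_mul_of_nonneg_right c1 p2
      have k3 := mul_le_mul_of_nonneg_left (mul_le_mul_of_nonneg_right c1 p1) (sq_nonneg K)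
      have k4 := mul_le_mul_of_nonneg_left d1 (mul_nonneg (by positivity : 0 ≤ 12 + 3 * K ^ 2)
        (sq_nonneg C))
      nlinarith [mul_nonneg (sq_nonneg C) p1, mul_nonneg (mul_nonneg (sq_nonneg K) (sq_nonneg C)) p2]
    · rw [if_neg hz]
      have : ζ1 = 0 ∧ ζ2 = 0 := by
        rw [not_and_or, not_le, not_le] at hz
        rcases hz with hz | hz
        · exact (hζ.one _ hz).2
        · exact (hζ.zero _ hz).2
      simp [hR, this.1, this.2]
  simp only [neg_sq] at t
  simp only [split]
  linarith

/-- The cutoff vanishes near the top face, which supplies the zero Cauchy data missing there: test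
functions become unrestricted, as the integrations by parts require. -/
lemma MemH0bsc.cutJet (hA : 0 < A) {a a' C : ℝ} (ha' : a' < A) {ζ : ℝ → ℝ}
    (hζ : IsCutoff a a' C ζ) {u : E3 → ℝ} (h : MemH0bsc A u) :
    ∃ u3, ZeroJet A univ (fun x => ζ (x 2) * u x) (cutGrad A ζ u)
      (fun i j x => ez i * ez j * deriv (deriv ζ) (x 2) * u x
        + deriv ζ (x 2) * (ez i * weakD (cube A) j u x + ez j * weakD (cube A) i u x)
        + ζ (x 2) * weakDeriv (cube A) (idx2 i j) u x) u3 := by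
  refine ⟨_, (h.zeroJet hA).mulZ hζ.smooth fun x hx => ?_⟩
  have : tsupport (fun x : E3 => ζ (x 2)) ⊆ {x | x 2 ≤ a'} := by
    refine closure_minimal (fun x hx => ?_) (isClosed_le (continuous_coord 2) continuous_const)
    by_contra hn
    exact hx (hζ.zero _ (not_le.1 hn)).1
  exact lt_of_le_of_lt (this hx.1) ha'

lemma weight_sq (A l z : ℝ) : weight A l z ^ 2 = Real.exp (2 * l * (A + 1 - z) ^ 2) := by
  rw [weight, ← Real.exp_nat_mul]
  congr 1
  push_cast
  ring

/-- A weighted estimate of the first derivatives away from the top face. -/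
lemma exists_first_order_estimate {ε ε' : ℝ} (hA : 0 < A) (hε' : 0 < ε') (hε : ε' < ε) (K : ℝ) :
    ∃ C l₀ : ℝ, 0 < C ∧ 1 ≤ l₀ ∧ ∀ (b d : ℝ) (N : ℕ), 0 < b →
      (∀ j, matNorm A (coeffFirst A b d N j) ≤ K) → matNorm A (coeffZeroth A b d N) ≤ K →
      ∀ W : Fin N → E3 → ℝ, (∀ n, MemH0bsc A (W n)) → ∀ l ≥ l₀,
        ∫ x in cubeEps A ε, density A W x ≤
          C * (Real.exp (2 * l * (2 * A + 1) ^ 2) * (∫ x in cube A, ∑ m, opL A b d W m x ^ 2)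
            + Real.exp (-(2 * l * ((1 + ε) ^ 2 - (1 + ε') ^ 2))) *
              ∫ x in cube A, density A W x) := by
  -- The cutoff varies only above `A - ε'`, hence strictly above the subdomain; the gap between `ε'`
  -- and `ε` yields the decaying exponential.
  obtain ⟨C, ζ, hC, hζ⟩ := exists_isCutoff (a := A - ε') (a' := A - ε' / 2) (by linarith)
  set c := (36 + 9 * K ^ 2) * C ^ 2 with hc
  have hc0 : 0 < c := by positivity
  -- For `l ≥ 24 K²` the lower order terms, of size `12 K²`, are at most half of the left-hand side
  -- of the Carleman estimate; moving them over doubles the constants `3` and `c`.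
  refine ⟨6 + 2 * c, 1 + 24 * K ^ 2, by positivity, by nlinarith [sq_nonneg K], ?_⟩
  intro b d N hb h1 h0 W hW l hl
  have hl1 : 1 ≤ l := by nlinarith [sq_nonneg K]
  have hH : ∀ n, MemH 3 (cube A) (W n) := fun n => (hW n).1
  choose u3 hJ using fun n => (hW n).cutJet hA (by linarith : A - ε' / 2 < A) hζ
  have cw : Continuous fun x : E3 => weight A l (x 2) :=
    (contDiff_comp_coord (contDiff_weight A l) 2).continuous
  set P : E3 → ℝ := fun x => ∑ n, weight A l (x 2) ^ 2 *
    (l * ∑ i, cutGrad A ζ (W n) i x ^ 2 + l ^ 3 * (ζ (x 2) * W n x) ^ 2) with hP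
  have iPn : ∀ n, Integrable (fun x => weight A l (x 2) ^ 2 *
      (l * ∑ i, cutGrad A ζ (W n) i x ^ 2 + l ^ 3 * (ζ (x 2) * W n x) ^ 2))
      (volume.restrict (cube A)) := by
    intro n
    have : Integrable (fun x => (∑ i, l * (weight A l (x 2) ^ 2 * cutGrad A ζ (W n) i x ^ 2))
        + l ^ 3 * (weight A l (x 2) ^ 2 * (ζ (x 2) * W n x) ^ 2)) (volume.restrict (cube A)) :=
      (integrable_finsetSum _ fun i _ =>
        (integrable_mul_sq cw ((hJ n).weak0 i).right).const_mul _).add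
        ((integrable_mul_sq cw ((hJ n).weak0 0).left).const_mul _)
    refine this.congr (ae_of_all _ fun x => ?_)
    simp only [Fin.sum_univ_three]; ring
  have iP : Integrable P (volume.restrict (cube A)) := integrable_finsetSum _ fun n _ => iPn n
  have iL : ∀ n, Integrable (fun x => weight A l (x 2) ^ 2 * cutLap A ζ (W n) x ^ 2)
      (volume.restrict (cube A)) := fun n =>
    integrable_mul_sq cw (memLp_finsetSum _ fun i _ => ((hJ n).weak1 i i).right)
  have iO := integrable_sum_sq_opL (d := d) hb (by norm_num) hH
  have iD := integrable_density (by norm_num) hH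
  -- `E1` bounds the squared weight on the whole cube and `E2` bounds it on the strip where the
  -- cutoff varies; `E0` is a lower bound for it on `cubeEps A ε`.
  set E1 := Real.exp (2 * l * (2 * A + 1) ^ 2) with hE1
  set E2 := Real.exp (2 * l * (1 + ε') ^ 2) with hE2
  set E0 := Real.exp (2 * l * (1 + ε) ^ 2) with hE0
  have carl : ∫ x in cube A, P x ≤ ∫ x in cube A,
      ∑ n, weight A l (x 2) ^ 2 * cutLap A ζ (W n) x ^ 2 := by
    rw [hP, integral_finsetSum _ fun n _ => iPn n, integral_finsetSum _ fun n _ => iL n]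
    exact Finset.sum_le_sum fun n _ => (hJ n).carleman hA hl1
  have hPnn : ∀ x, 0 ≤ P x := fun x => Finset.sum_nonneg fun n _ => by
    have : 0 ≤ ∑ i, cutGrad A ζ (W n) i x ^ 2 := Finset.sum_nonneg fun _ _ => sq_nonneg _
    positivity
  have pw : ∀ x ∈ cube A, ∑ n, weight A l (x 2) ^ 2 * cutLap A ζ (W n) x ^ 2 ≤
      (1 / 2) * P x + (3 * E1 * ∑ m, opL A b d W m x ^ 2 + c * E2 * density A W x) := by
    intro x hx
    have hxc := cube_subset_closedCube A hx
    have s := sum_sq_cutLap_le hb h1 h0 hζ W hxc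
    have hz := hx 2
    rw [← Finset.mul_sum]
    have w0 : 0 ≤ weight A l (x 2) ^ 2 := sq_nonneg _
    refine (mul_le_mul_of_nonneg_left s w0).trans ?_
    rw [mul_add, mul_add]
    have t1 : weight A l (x 2) ^ 2 * (3 * ∑ m, opL A b d W m x ^ 2) ≤
        3 * E1 * ∑ m, opL A b d W m x ^ 2 := by
      have : weight A l (x 2) ^ 2 ≤ E1 := by
        rw [weight_sq, hE1]
        have : (A + 1 - x 2) ^ 2 ≤ (2 * A + 1) ^ 2 :=
          pow_le_pow_left₀ (by linarith) (by linarith) 2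
        gcongr
      have q : 0 ≤ ∑ m, opL A b d W m x ^ 2 := Finset.sum_nonneg fun _ _ => sq_nonneg _
      nlinarith
    have t2 : weight A l (x 2) ^ 2 * (12 * K ^ 2 *
        (∑ n, (∑ i, cutGrad A ζ (W n) i x ^ 2 + (ζ (x 2) * W n x) ^ 2))) ≤ (1 / 2) * P x := by
      rw [hP, Finset.mul_sum, Finset.mul_sum, Finset.mul_sum]
      refine Finset.sum_le_sum fun n _ => ?_
      have g0 : 0 ≤ ∑ i, cutGrad A ζ (W n) i x ^ 2 := Finset.sum_nonneg fun _ _ => sq_nonneg _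
      generalize ∑ i, cutGrad A ζ (W n) i x ^ 2 = g at *
      have v0 := sq_nonneg (ζ (x 2) * W n x)
      generalize (ζ (x 2) * W n x) ^ 2 = v at *
      have hk : 24 * K ^ 2 ≤ l := by linarith
      have hk3 : 24 * K ^ 2 ≤ l ^ 3 := hk.trans (le_self_pow₀ hl1 (by norm_num))
      have := mul_le_mul_of_nonneg_left (add_le_add (mul_le_mul_of_nonneg_right hk g0)
        (mul_le_mul_of_nonneg_right hk3 v0)) w0
      linarith
    have t3 : weight A l (x 2) ^ 2 * (c *
        (if A - ε' ≤ x 2 ∧ x 2 ≤ A - ε' / 2 then density A W x else 0)) ≤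
        c * E2 * density A W x := by
      have dn := density_nonneg A W x
      split_ifs with hif
      · have : weight A l (x 2) ^ 2 ≤ E2 := by
          rw [weight_sq, hE2]
          have : (A + 1 - x 2) ^ 2 ≤ (1 + ε') ^ 2 :=
            pow_le_pow_left₀ (by linarith) (by linarith) 2
          gcongr
        have := mul_le_mul_of_nonneg_right this (mul_nonneg hc0.le dn)
        linarith
      · rw [mul_zero, mul_zero]
        positivity
    linarith
  have iS : Integrable (fun x => 3 * E1 * ∑ m, opL A b d W m x ^ 2 + c * E2 * density A W x)
      (volume.restrict (cube A)) := (iO.const_mul _).add (iD.const_mul _)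
  have iR : Integrable (fun x => (1 / 2) * P x + (3 * E1 * ∑ m, opL A b d W m x ^ 2
      + c * E2 * density A W x)) (volume.restrict (cube A)) :=
    (iP.const_mul _).add iS
  have main := carl.trans (setIntegral_mono_on (integrable_finsetSum _ fun n _ => iL n) iR
    (isOpen_cube A).measurableSet pw)
  rw [integral_add (iP.const_mul _) iS,
    integral_add (iO.const_mul _) (iD.const_mul _), integral_const_mul, integral_const_mul,
    integral_const_mul] at main
  have low : E0 * ∫ x in cubeEps A ε, density A W x ≤ ∫ x in cube A, P x := by
    rw [← integral_const_mul]
    refine (setIntegral_mono_on ((iD.mono_measure (Measure.restrict_mono (cubeEps_subset A ε)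
      le_rfl)).const_mul _) (iP.mono_measure (Measure.restrict_mono (cubeEps_subset A ε) le_rfl))
      (isOpen_cubeEps A ε).measurableSet fun x hx => ?_).trans
      (setIntegral_mono_set iP (ae_of_all _ hPnn) (LE.le.eventuallyLE (cubeEps_subset A ε)))
    have hz : x 2 < A - ε := hx.2
    obtain ⟨o1, o2, -⟩ := hζ.one (x 2) (by linarith)
    rw [hP, density, Finset.mul_sum]
    refine Finset.sum_le_sum fun n _ => ?_
    simp only [cutGrad, o1, o2, mul_zero, zero_mul, zero_add, one_mul]
    have w0 : E0 ≤ weight A l (x 2) ^ 2 := by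
      rw [weight_sq, hE0]
      have : (1 + ε) ^ 2 ≤ (A + 1 - x 2) ^ 2 :=
        pow_le_pow_left₀ (by linarith) (by linarith) 2
      gcongr
    have g0 : 0 ≤ ∑ i, weakD (cube A) i (W n) x ^ 2 := Finset.sum_nonneg fun _ _ => sq_nonneg _
    refine mul_le_mul w0 (add_le_add (le_mul_of_one_le_left g0 hl1)
      (le_mul_of_one_le_left (sq_nonneg _) (one_le_pow₀ hl1))) (by positivity) (sq_nonneg _)
  have hX : 0 ≤ ∫ x in cube A, ∑ m, opL A b d W m x ^ 2 :=
    integral_nonneg fun x => Finset.sum_nonneg fun _ _ => sq_nonneg _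
  have hY : 0 ≤ ∫ x in cube A, density A W x := integral_nonneg fun x => density_nonneg A W x
  have hE : Real.exp (-(2 * l * ((1 + ε) ^ 2 - (1 + ε') ^ 2))) * E0 = E2 := by
    rw [hE0, hE2, ← Real.exp_add]
    congr 1; ring
  have hE0' : 1 ≤ E0 := Real.one_le_exp (by positivity)
  generalize ∫ x in cube A, ∑ m, opL A b d W m x ^ 2 = X at *
  generalize ∫ x in cube A, density A W x = Y at *
  have hE0p : 0 < E0 := Real.exp_pos _
  -- On division by `E0` the quotient `E2 / E0` becomes the decaying exponential, while in the term
  -- with `E1` only `E0 ≥ 1` is used.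
  refine le_of_mul_le_mul_left (low.trans ?_) hE0p
  have f1 : ∫ x in cube A, P x ≤ 6 * (E1 * X) + 2 * c * (E2 * Y) := by linarith
  refine f1.trans ?_
  have f2 : E0 * ((6 + 2 * c) * (E1 * X
      + Real.exp (-(2 * l * ((1 + ε) ^ 2 - (1 + ε') ^ 2))) * Y)) =
      (6 + 2 * c) * (E0 * (E1 * X) + E2 * Y) := by rw [← hE]; ring
  rw [f2]
  have x1 : 0 ≤ E1 * X := mul_nonneg (Real.exp_pos _).le hX
  have x2 : 0 ≤ E2 * Y := mul_nonneg (Real.exp_pos _).le hY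
  nlinarith [mul_le_mul_of_nonneg_right hE0' x1, mul_nonneg hc0.le x1, mul_nonneg hc0.le x2,
    mul_nonneg hc0.le (mul_nonneg hE0p.le x1)]

/-- An estimate of the second derivatives by the first ones, away from the top face. -/
lemma exists_second_order_estimate {ε ε' : ℝ} (hA : 0 < A) (hε' : 0 < ε') (hε : ε' < ε) (K : ℝ) :
    ∃ C : ℝ, 0 < C ∧ ∀ (b d : ℝ) (N : ℕ), 0 < b →
      (∀ j, matNorm A (coeffFirst A b d N j) ≤ K) → matNorm A (coeffZeroth A b d N) ≤ K →
      ∀ W : Fin N → E3 → ℝ, (∀ n, MemH0bsc A (W n)) → ∀ i j,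
        ∑ n, ∫ x in cubeEps A ε, weakDeriv (cube A) (idx2 i j) (W n) x ^ 2 ≤
          C * ((∫ x in cube A, ∑ m, opL A b d W m x ^ 2) +
            ∫ x in cubeEps A ε', density A W x) := by
  -- The cutoff is one on `cubeEps A ε` and dies out inside `cubeEps A ε'`. No weight is needed:
  -- first order terms are not absorbed but bounded by `density` on the larger subdomain.
  obtain ⟨C, ζ, hC, hζ⟩ := exists_isCutoff (a := A - ε) (a' := A - (ε + ε') / 2) (by linarith)
  set c := 12 * K ^ 2 * (2 * C ^ 2 + 3) + (36 + 9 * K ^ 2) * C ^ 2 with hc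
  have hc0 : 0 < c := by positivity
  refine ⟨3 + c, by positivity, ?_⟩
  intro b d N hb h1 h0 W hW i j
  have hH : ∀ n, MemH 3 (cube A) (W n) := fun n => (hW n).1
  choose u3 hJ using fun n => (hW n).cutJet hA (by linarith : A - (ε + ε') / 2 < A) hζ
  have iO := integrable_sum_sq_opL (d := d) hb (by norm_num) hH
  have iD := integrable_density (by norm_num) hH
  have iL : ∀ n, Integrable (fun x => cutLap A ζ (W n) x ^ 2) (volume.restrict (cube A)) :=
    fun n => (memLp_finsetSum _ fun i _ => ((hJ n).weak1 i i).right).integrable_sq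
  have first : ∑ n, ∫ x in cubeEps A ε, weakDeriv (cube A) (idx2 i j) (W n) x ^ 2 ≤
      ∫ x in cube A, ∑ n, cutLap A ζ (W n) x ^ 2 := by
    rw [integral_finsetSum _ fun n _ => iL n]
    refine Finset.sum_le_sum fun n _ => ?_
    refine le_trans ?_ ((hJ n).integral_second_le hA i j)
    have iq := ((hJ n).weak1 i j).right.integrable_sq
    refine le_trans (le_of_eq ?_) (setIntegral_mono_set iq (ae_of_all _ fun x => sq_nonneg _)
      (LE.le.eventuallyLE (cubeEps_subset A ε)))
    refine setIntegral_congr_fun (isOpen_cubeEps A ε).measurableSet fun x hx => ?_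
    obtain ⟨o1, o2, o3⟩ := hζ.one (x 2) hx.2
    simp only [o1, o2, o3, mul_zero, zero_mul, zero_add, one_mul]
  have hm : MeasurableSet (cubeEps A ε') := (isOpen_cubeEps A ε').measurableSet
  have pw : ∀ x ∈ cube A, ∑ n, cutLap A ζ (W n) x ^ 2 ≤
      3 * ∑ m, opL A b d W m x ^ 2 + c * (cubeEps A ε').indicator (density A W) x := by
    intro x hx
    refine (sum_sq_cutLap_le hb h1 h0 hζ W (cube_subset_closedCube A hx)).trans ?_
    by_cases hz : A - (ε + ε') / 2 < x 2
    · obtain ⟨o1, o2, -⟩ := hζ.zero (x 2) hz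
      rw [if_neg (fun h => absurd h.2 (not_le.2 hz))]
      simp only [cutGrad, o1, o2]
      have : 0 ≤ c * (cubeEps A ε').indicator (density A W) x :=
        mul_nonneg hc0.le (indicator_nonneg (fun x _ => density_nonneg A W x) x)
      simpa using this
    · have hx' : x ∈ cubeEps A ε' := ⟨hx, by linarith⟩
      rw [indicator_of_mem hx']
      have d0 := density_nonneg A W x
      have t1 : ∑ n, (∑ i, cutGrad A ζ (W n) i x ^ 2 + (ζ (x 2) * W n x) ^ 2) ≤
          (2 * C ^ 2 + 3) * density A W x := by
        rw [density, Finset.mul_sum]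
        refine Finset.sum_le_sum fun n _ => ?_
        simp only [Fin.sum_univ_three, cutGrad, ez_zero, ez_one, ez_two, zero_mul, zero_add,
          one_mul]
        have c1 : deriv ζ (x 2) ^ 2 ≤ C ^ 2 := sq_le_sq' (abs_le.1 (hζ.abs_deriv_le _).1).1
          (abs_le.1 (hζ.abs_deriv_le _).1).2
        have c2 : ζ (x 2) ^ 2 ≤ 1 := by
          rw [← sq_abs]; exact pow_le_one₀ (abs_nonneg _) (hζ.abs_le _)
        generalize deriv ζ (x 2) = z1 at *
        generalize ζ (x 2) = z0 at *
        generalize weakD (cube A) 0 (W n) x = g0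
        generalize weakD (cube A) 1 (W n) x = g1
        generalize weakD (cube A) 2 (W n) x = g2
        generalize W n x = w
        have k0 := mul_le_mul_of_nonneg_right c2 (sq_nonneg g0)
        have k1 := mul_le_mul_of_nonneg_right c2 (sq_nonneg g1)
        have k2 := mul_le_mul_of_nonneg_right c2 (sq_nonneg g2)
        have k3 := mul_le_mul_of_nonneg_right c2 (sq_nonneg w)
        have k4 := mul_le_mul_of_nonneg_right c1 (sq_nonneg w)
        have k5 : (z1 * w + z0 * g2) ^ 2 ≤ 2 * (z1 ^ 2 * w ^ 2) + 2 * (z0 ^ 2 * g2 ^ 2) := by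
          nlinarith [sq_nonneg (z1 * w - z0 * g2)]
        have k6 : 0 ≤ C ^ 2 * (g0 ^ 2 + g1 ^ 2 + g2 ^ 2) := by positivity
        nlinarith [sq_nonneg g0, sq_nonneg g1, sq_nonneg g2, sq_nonneg w]
      have t2 : (if A - ε ≤ x 2 ∧ x 2 ≤ A - (ε + ε') / 2 then density A W x else 0) ≤
          density A W x := by
        split_ifs
        · exact le_rfl
        · exact d0
      have u1 := mul_le_mul_of_nonneg_left t1 (by positivity : 0 ≤ 12 * K ^ 2)
      have u2 := mul_le_mul_of_nonneg_left t2 (by positivity : 0 ≤ (36 + 9 * K ^ 2) * C ^ 2)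
      rw [hc]
      linarith
  have iI : Integrable ((cubeEps A ε').indicator (density A W)) (volume.restrict (cube A)) :=
    iD.indicator hm
  have iR : Integrable (fun x => 3 * ∑ m, opL A b d W m x ^ 2
      + c * (cubeEps A ε').indicator (density A W) x) (volume.restrict (cube A)) :=
    (iO.const_mul 3).add (iI.const_mul c)
  have main := first.trans (setIntegral_mono_on (integrable_finsetSum _ fun n _ => iL n) iR
    (isOpen_cube A).measurableSet pw)
  rw [integral_add (iO.const_mul 3) (iI.const_mul c), integral_const_mul, integral_const_mul,
    setIntegral_indicator hm, inter_eq_self_of_subset_right (cubeEps_subset A ε')] at main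
  have hX : 0 ≤ ∫ x in cube A, ∑ m, opL A b d W m x ^ 2 :=
    integral_nonneg fun x => Finset.sum_nonneg fun _ _ => sq_nonneg _
  have hY : 0 ≤ ∫ x in cubeEps A ε', density A W x :=
    integral_nonneg fun x => density_nonneg A W x
  nlinarith [mul_nonneg hc0.le hX]

end System

/-! ### Sobolev norms -/

section Norms

variable {Ω : Set E3} {k : ℕ}

lemma hNormSq_nonneg (k : ℕ) (Ω : Set E3) (u : E3 → ℝ) : 0 ≤ hNormSq k Ω u :=
  Finset.sum_nonneg fun _ _ => integral_nonneg fun _ => sq_nonneg _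

lemma hNorm_nonneg (k : ℕ) (Ω : Set E3) {N : ℕ} (U : Fin N → E3 → ℝ) : 0 ≤ hNorm k Ω U :=
  Real.sqrt_nonneg _

lemma sq_hNorm (k : ℕ) (Ω : Set E3) {N : ℕ} (U : Fin N → E3 → ℝ) :
    hNorm k Ω U ^ 2 = ∑ n, hNormSq k Ω (U n) :=
  Real.sq_sqrt (Finset.sum_nonneg fun _ _ => hNormSq_nonneg _ _ _)

lemma integral_sq_le_hNormSq (Ω : Set E3) (u : E3 → ℝ) {a : Fin 3 → ℕ} (ha : ∑ i, a i ≤ k) :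
    ∫ x in Ω, weakDeriv Ω a u x ^ 2 ≤ hNormSq k Ω u :=
  Finset.single_le_sum (f := fun a => ∫ x in Ω, weakDeriv Ω a u x ^ 2)
    (fun _ _ => integral_nonneg fun _ => sq_nonneg _) (mem_multiIndices.2 ha)

lemma MemH.integral_sq_le (hΩ : IsOpen Ω) {u : E3 → ℝ} (h : MemH k Ω u) :
    ∫ x in Ω, u x ^ 2 ≤ hNormSq k Ω u := by
  refine le_trans (le_of_eq ?_) (integral_sq_le_hNormSq Ω u (a := 0) (by simp))
  refine integral_congr_ae ?_
  filter_upwards [h.weakDeriv_zero_ae hΩ] with x hx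
  rw [hx]

lemma MemH.restrict {Ω' : Set E3} (hΩ : IsOpen Ω) (hs : Ω' ⊆ Ω) {u : E3 → ℝ}
    (h : MemH k Ω u) : MemH k Ω' u := fun a ha => by
  obtain ⟨w, hw, hm⟩ := h a ha
  exact ⟨w, hw.mono hΩ.measurableSet hs, hm.mono_measure (Measure.restrict_mono hs le_rfl)⟩

lemma hNormSq_restrict_le {Ω' : Set E3} (hΩ : IsOpen Ω) (hΩ' : IsOpen Ω') (hs : Ω' ⊆ Ω)
    {u : E3 → ℝ} (h : MemH k Ω u) : hNormSq k Ω' u ≤ hNormSq k Ω u := by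
  refine Finset.sum_le_sum fun a ha => ?_
  have ha' := mem_multiIndices.1 ha
  refine le_trans (le_of_eq ?_) (setIntegral_mono_set (h.spec hΩ ha').2.integrable_sq
    (ae_of_all _ fun x => sq_nonneg _) (LE.le.eventuallyLE hs))
  refine integral_congr_ae ?_
  filter_upwards [h.weakDeriv_restrict hΩ hΩ' hs ha'] with x hx
  rw [hx]

/-- The form with absolute values serves sums and differences alike. -/
lemma integral_sq_le_of_ae {X : Type*} [MeasurableSpace X] {μ : Measure X} {f g h : X → ℝ}
    (hg : MemLp g 2 μ) (hh : MemLp h 2 μ) (e : ∀ᵐ x ∂μ, |f x| ≤ |g x| + |h x|) :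
    ∫ x, f x ^ 2 ∂μ ≤ 2 * (∫ x, g x ^ 2 ∂μ) + 2 * ∫ x, h x ^ 2 ∂μ := by
  rw [← integral_const_mul, ← integral_const_mul,
    ← integral_add (hg.integrable_sq.const_mul 2) (hh.integrable_sq.const_mul 2)]
  refine integral_mono_of_nonneg (ae_of_all _ fun x => sq_nonneg _)
    ((hg.integrable_sq.const_mul 2).add (hh.integrable_sq.const_mul 2)) ?_
  filter_upwards [e] with x hx
  rw [← sq_abs (f x), ← sq_abs (g x), ← sq_abs (h x)]
  have := pow_le_pow_left₀ (abs_nonneg _) hx 2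
  nlinarith [sq_nonneg (|g x| - |h x|)]

lemma MemH.hNormSq_add_le (hΩ : IsOpen Ω) {u v : E3 → ℝ} (h : MemH k Ω u) (h' : MemH k Ω v) :
    hNormSq k Ω (fun x => u x + v x) ≤ 2 * hNormSq k Ω u + 2 * hNormSq k Ω v := by
  rw [hNormSq, hNormSq, hNormSq, Finset.mul_sum, Finset.mul_sum, ← Finset.sum_add_distrib]
  refine Finset.sum_le_sum fun a ha => ?_
  have ha' := mem_multiIndices.1 ha
  refine integral_sq_le_of_ae (h.spec hΩ ha').2 (h'.spec hΩ ha').2 ?_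
  filter_upwards [h.weakDeriv_add hΩ h' ha'] with x hx
  rw [hx]
  exact abs_add_le _ _

lemma MemH.hNormSq_sub_le (hΩ : IsOpen Ω) {u v : E3 → ℝ} (h : MemH k Ω u) (h' : MemH k Ω v) :
    hNormSq k Ω (fun x => u x - v x) ≤ 2 * hNormSq k Ω u + 2 * hNormSq k Ω v := by
  rw [hNormSq, hNormSq, hNormSq, Finset.mul_sum, Finset.mul_sum, ← Finset.sum_add_distrib]
  refine Finset.sum_le_sum fun a ha => ?_
  have ha' := mem_multiIndices.1 ha
  refine integral_sq_le_of_ae (h.spec hΩ ha').2 (h'.spec hΩ ha').2 ?_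
  filter_upwards [h.weakDeriv_sub hΩ h' ha'] with x hx
  rw [hx]
  exact abs_sub _ _

lemma sq_hNorm_add_le (hΩ : IsOpen Ω) {N : ℕ} {U V : Fin N → E3 → ℝ} (h : ∀ n, MemH k Ω (U n))
    (h' : ∀ n, MemH k Ω (V n)) :
    hNorm k Ω (fun n x => U n x + V n x) ^ 2 ≤ 2 * hNorm k Ω U ^ 2 + 2 * hNorm k Ω V ^ 2 := by
  simp only [sq_hNorm, Finset.mul_sum, ← Finset.sum_add_distrib]
  exact Finset.sum_le_sum fun n _ => (h n).hNormSq_add_le hΩ (h' n)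

lemma sq_hNorm_sub_le (hΩ : IsOpen Ω) {N : ℕ} {U V : Fin N → E3 → ℝ} (h : ∀ n, MemH k Ω (U n))
    (h' : ∀ n, MemH k Ω (V n)) :
    hNorm k Ω (fun n x => U n x - V n x) ^ 2 ≤ 2 * hNorm k Ω U ^ 2 + 2 * hNorm k Ω V ^ 2 := by
  simp only [sq_hNorm, Finset.mul_sum, ← Finset.sum_add_distrib]
  exact Finset.sum_le_sum fun n _ => (h n).hNormSq_sub_le hΩ (h' n)

lemma integral_density_le {A : ℝ} {N : ℕ} (hk : 1 ≤ k) {U : Fin N → E3 → ℝ}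
    (h : ∀ n, MemH k (cube A) (U n)) :
    ∫ x in cube A, density A U x ≤ 4 * hNorm k (cube A) U ^ 2 := by
  have i0 : ∀ n, Integrable (fun x => U n x ^ 2) (volume.restrict (cube A)) := fun n =>
    ((h n).memLp (isOpen_cube A)).integrable_sq
  have i1 : ∀ n i, Integrable (fun x => weakD (cube A) i (U n) x ^ 2)
      (volume.restrict (cube A)) := fun n i => (memLp_weakD hk (h n) i).integrable_sq
  have is : ∀ n, Integrable (fun x => ∑ i, weakD (cube A) i (U n) x ^ 2)
      (volume.restrict (cube A)) := fun n => integrable_finsetSum _ fun i _ => i1 n i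
  have it : ∀ n, Integrable (fun x => ∑ i, weakD (cube A) i (U n) x ^ 2 + U n x ^ 2)
      (volume.restrict (cube A)) := fun n => (is n).add (i0 n)
  simp only [density]
  rw [integral_finsetSum _ fun n _ => it n, sq_hNorm, Finset.mul_sum]
  refine Finset.sum_le_sum fun n _ => ?_
  rw [integral_add (is n) (i0 n), integral_finsetSum _ fun i _ => i1 n i, Fin.sum_univ_three]
  have e : ∀ i, ∫ x in cube A, weakD (cube A) i (U n) x ^ 2 ≤ hNormSq k (cube A) (U n) :=
    fun i => integral_sq_le_hNormSq (cube A) (U n) (by simpa using hk)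
  linarith [e 0, e 1, e 2, (h n).integral_sq_le (isOpen_cube A)]

/-- Applied to the noise `F - F'`. As `L` has order two, closeness in `H²` suffices, although the
penalty uses the `H³` norm. -/
lemma integral_sum_sq_opL_le {A b d K : ℝ} {N : ℕ} (hb : 0 < b)
    (h1 : ∀ j, matNorm A (coeffFirst A b d N j) ≤ K) (h0 : matNorm A (coeffZeroth A b d N) ≤ K)
    {U : Fin N → E3 → ℝ} (h : ∀ n, MemH 2 (cube A) (U n)) :
    ∫ x in cube A, ∑ m, opL A b d U m x ^ 2 ≤ (18 + 32 * K ^ 2) * hNorm 2 (cube A) U ^ 2 := by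
  have i2 : ∀ n i, Integrable (fun x => weakDeriv (cube A) (Pi.single i 2) (U n) x ^ 2)
      (volume.restrict (cube A)) := fun n i =>
    ((h n).spec (isOpen_cube A) (by simp)).2.integrable_sq
  have iD := integrable_density (by norm_num) h
  have iS : Integrable (fun x => 6 * ∑ n, ∑ i, weakDeriv (cube A) (Pi.single i 2) (U n) x ^ 2)
      (volume.restrict (cube A)) :=
    (integrable_finsetSum _ fun n _ => integrable_finsetSum _ fun i _ => i2 n i).const_mul _
  have pw : ∀ x ∈ cube A, ∑ m, opL A b d U m x ^ 2 ≤
      6 * ∑ n, ∑ i, weakDeriv (cube A) (Pi.single i 2) (U n) x ^ 2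
        + 8 * K ^ 2 * density A U x := by
    intro x hx
    have s := sum_sq_lower_le hb h1 h0 (cube_subset_closedCube A hx)
      (fun j n => weakD (cube A) j (U n) x) fun n => U n x
    have t := sum_sq_add_le Finset.univ (fun m => weakLaplacian (cube A) (U m) x)
      (fun m => ∑ j, ∑ n, coeffFirst A b d N j x m n * weakD (cube A) j (U n) x
        + ∑ n, coeffZeroth A b d N x m n * U n x)
    have t2 : ∑ m, weakLaplacian (cube A) (U m) x ^ 2 ≤
        3 * ∑ n, ∑ i, weakDeriv (cube A) (Pi.single i 2) (U n) x ^ 2 := by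
      rw [Finset.mul_sum]
      refine Finset.sum_le_sum fun n _ => ?_
      rw [weakLaplacian]
      refine (sq_sum_le_card_mul_sum_sq).trans (le_of_eq ?_)
      simp
    simp only [← add_assoc] at t
    rw [density]
    unfold opL
    linarith
  refine (setIntegral_mono_on (integrable_sum_sq_opL hb le_rfl h)
    (iS.add (iD.const_mul (8 * K ^ 2))) (isOpen_cube A).measurableSet pw).trans ?_
  have e0 := integral_add iS (iD.const_mul (8 * K ^ 2))
  refine e0.le.trans ?_
  rw [integral_const_mul, integral_const_mul,
    integral_finsetSum _ fun n _ => integrable_finsetSum _ fun i _ => i2 n i]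
  have e1 : ∑ n, ∫ x in cube A, ∑ i, weakDeriv (cube A) (Pi.single i 2) (U n) x ^ 2 ≤
      3 * hNorm 2 (cube A) U ^ 2 := by
    rw [sq_hNorm, Finset.mul_sum]
    refine Finset.sum_le_sum fun n _ => ?_
    rw [integral_finsetSum _ fun i _ => i2 n i, Fin.sum_univ_three]
    have e : ∀ i, ∫ x in cube A, weakDeriv (cube A) (Pi.single i 2) (U n) x ^ 2 ≤
        hNormSq 2 (cube A) (U n) := fun i => integral_sq_le_hNormSq (cube A) (U n) (by simp)
    linarith [e 0, e 1, e 2]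
  have e2 := mul_le_mul_of_nonneg_left (integral_density_le (by norm_num) h)
    (by positivity : 0 ≤ 8 * K ^ 2)
  linarith

end Norms

/-! ### Linearity of the operator -/

lemma weakD_add_ae {A : ℝ} {u v : E3 → ℝ} (h : MemH 3 (cube A) u) (h' : MemH 3 (cube A) v)
    (i : Fin 3) : weakD (cube A) i (fun x => u x + v x) =ᵐ[volume.restrict (cube A)]
      fun x => weakD (cube A) i u x + weakD (cube A) i v x :=
  h.weakDeriv_add (isOpen_cube A) h' (by simp)

lemma weakD_sub_ae {A : ℝ} {u v : E3 → ℝ} (h : MemH 3 (cube A) u) (h' : MemH 3 (cube A) v)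
    (i : Fin 3) : weakD (cube A) i (fun x => u x - v x) =ᵐ[volume.restrict (cube A)]
      fun x => weakD (cube A) i u x - weakD (cube A) i v x :=
  h.weakDeriv_sub (isOpen_cube A) h' (by simp)

lemma weakLaplacian_add_ae {A : ℝ} {u v : E3 → ℝ} (h : MemH 3 (cube A) u)
    (h' : MemH 3 (cube A) v) :
    weakLaplacian (cube A) (fun x => u x + v x) =ᵐ[volume.restrict (cube A)]
      fun x => weakLaplacian (cube A) u x + weakLaplacian (cube A) v x := by
  have : ∀ᵐ x ∂volume.restrict (cube A), ∀ i : Fin 3,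
      weakDeriv (cube A) (Pi.single i 2) (fun x => u x + v x) x =
        weakDeriv (cube A) (Pi.single i 2) u x + weakDeriv (cube A) (Pi.single i 2) v x :=
    ae_all_iff.2 fun i => h.weakDeriv_add (isOpen_cube A) h' (by simp)
  filter_upwards [this] with x hx
  simp only [weakLaplacian, hx, Finset.sum_add_distrib]

lemma weakLaplacian_sub_ae {A : ℝ} {u v : E3 → ℝ} (h : MemH 3 (cube A) u)
    (h' : MemH 3 (cube A) v) :
    weakLaplacian (cube A) (fun x => u x - v x) =ᵐ[volume.restrict (cube A)]
      fun x => weakLaplacian (cube A) u x - weakLaplacian (cube A) v x := by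
  have : ∀ᵐ x ∂volume.restrict (cube A), ∀ i : Fin 3,
      weakDeriv (cube A) (Pi.single i 2) (fun x => u x - v x) x =
        weakDeriv (cube A) (Pi.single i 2) u x - weakDeriv (cube A) (Pi.single i 2) v x :=
    ae_all_iff.2 fun i => h.weakDeriv_sub (isOpen_cube A) h' (by simp)
  filter_upwards [this] with x hx
  simp only [weakLaplacian, hx, Finset.sum_sub_distrib]

lemma opL_add_ae {A b d : ℝ} {N : ℕ} {U V : Fin N → E3 → ℝ} (h : ∀ n, MemH 3 (cube A) (U n))
    (h' : ∀ n, MemH 3 (cube A) (V n)) : ∀ᵐ x ∂volume.restrict (cube A), ∀ m,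
      opL A b d (fun n x => U n x + V n x) m x = opL A b d U m x + opL A b d V m x := by
  have h1 := ae_all_iff.2 fun n => ae_all_iff.2 fun i => weakD_add_ae (h n) (h' n) i
  have h2 := ae_all_iff.2 fun n => weakLaplacian_add_ae (h n) (h' n)
  filter_upwards [h1, h2] with x e1 e2 m
  simp only [opL, e1, e2, mul_add, Finset.sum_add_distrib]
  ring

lemma opL_sub_ae {A b d : ℝ} {N : ℕ} {U V : Fin N → E3 → ℝ} (h : ∀ n, MemH 3 (cube A) (U n))
    (h' : ∀ n, MemH 3 (cube A) (V n)) : ∀ᵐ x ∂volume.restrict (cube A), ∀ m,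
      opL A b d (fun n x => U n x - V n x) m x = opL A b d U m x - opL A b d V m x := by
  have h1 := ae_all_iff.2 fun n => ae_all_iff.2 fun i => weakD_sub_ae (h n) (h' n) i
  have h2 := ae_all_iff.2 fun n => weakLaplacian_sub_ae (h n) (h' n)
  filter_upwards [h1, h2] with x e1 e2 m
  simp only [opL, e1, e2, mul_sub, Finset.sum_sub_distrib]
  ring

/-! ### Differences with equal traces -/

/-- The function `w` is a difference only almost everywhere because for normal traces it is the
chosen representative of a weak derivative of `u - v`, which need not equal the difference of the
chosen ones pointwise. -/
lemma HasFaceTrace.sub {A : ℝ} {i : Fin 3} {s : ℝ} {u v g : E3 → ℝ} (h : HasFaceTrace A i s u g)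
    (h' : HasFaceTrace A i s v g) (hu : MemLp u 2 (volume.restrict (cube A)))
    (hv : MemLp v 2 (volume.restrict (cube A)))
    (hu' : MemLp (weakD (cube A) i u) 2 (volume.restrict (cube A)))
    (hv' : MemLp (weakD (cube A) i v) 2 (volume.restrict (cube A)))
    {w : E3 → ℝ} (hw : w =ᵐ[volume.restrict (cube A)] fun x => u x - v x)
    (hw' : weakD (cube A) i w =ᵐ[volume.restrict (cube A)]
      fun x => weakD (cube A) i u x - weakD (cube A) i v x) :
    HasFaceTrace A i s w 0 := by
  refine ⟨MemLp.zero, fun φ h1 h2 h3 => ?_⟩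
  have i1 := (hu.integrable_mul (memLp_of_bounded (contDiff_partialD h1 i).continuous
    (hasCompactSupport_partialD h2 i))).add
    (hu'.integrable_mul (memLp_of_bounded h1.continuous h2))
  have i2 := (hv.integrable_mul (memLp_of_bounded (contDiff_partialD h1 i).continuous
    (hasCompactSupport_partialD h2 i))).add
    (hv'.integrable_mul (memLp_of_bounded h1.continuous h2))
  have e := integral_sub i1 i2
  have e1 := h.2 φ h1 h2 h3
  have e2 := h'.2 φ h1 h2 h3
  simp only [Pi.add_apply, Pi.mul_apply] at e
  rw [e1, e2, sub_self] at e
  simp only [Pi.zero_apply, zero_mul, integral_zero, mul_zero]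
  rw [← e]
  refine integral_congr_ae ?_
  filter_upwards [hw, hw'] with x hx hx'
  rw [hx, hx']
  ring

/-- Subtraction of normal traces. -/
lemma HasNormalTrace.sub {A : ℝ} {i : Fin 3} {s : ℝ} {u v g : E3 → ℝ}
    (h : HasNormalTrace A i s u g) (h' : HasNormalTrace A i s v g) (hu : MemH 3 (cube A) u)
    (hv : MemH 3 (cube A) v) : HasNormalTrace A i s (fun x => u x - v x) 0 := by
  have hQ := isOpen_cube A
  have hs := hu.sub hQ hv
  have dd : ∀ {u : E3 → ℝ}, MemH 3 (cube A) u → weakD (cube A) i (fun x => s * weakD (cube A) i u x)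
      =ᵐ[volume.restrict (cube A)] fun x => s * weakDeriv (cube A) (idx2 i i) u x := by
    intro u hu
    have g := weakDeriv_green hu (a := Pi.single i 1) i (by simp)
    exact ((g.isWeakDeriv hQ).const_mul s).weakDeriv_ae hQ
  have m1 : ∀ {u : E3 → ℝ}, MemH 3 (cube A) u →
      MemLp (fun x => s * weakD (cube A) i u x) 2 (volume.restrict (cube A)) := fun hu =>
    (memLp_weakD (by norm_num) hu i).const_mul s
  have m2 : ∀ {u : E3 → ℝ}, MemH 3 (cube A) u →
      MemLp (weakD (cube A) i fun x => s * weakD (cube A) i u x) 2 (volume.restrict (cube A)) :=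
    fun hu => ((hu.spec hQ (by simp [Finset.sum_add_distrib])).2.const_mul s).ae_eq (dd hu).symm
  refine HasFaceTrace.sub h h' (m1 hu) (m1 hv) (m2 hu) (m2 hv) ?_ ?_
  · filter_upwards [weakD_sub_ae hu hv i] with x hx
    rw [hx]; ring
  · filter_upwards [dd hs, dd hu, dd hv, hu.weakDeriv_sub hQ hv
      (a := idx2 i i) (by simp [Finset.sum_add_distrib])] with x e1 e2 e3 e4
    rw [e1, e2, e3, e4]; ring

lemma BoundaryConditions.memH0bsc_sub {A : ℝ} {N : ℕ} {φ₀ φ₁ U V : Fin N → E3 → ℝ}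
    (h : BoundaryConditions A φ₀ φ₁ U) (h' : BoundaryConditions A φ₀ φ₁ V)
    (hU : ∀ n, MemH 3 (cube A) (U n)) (hV : ∀ n, MemH 3 (cube A) (V n)) (n : Fin N) :
    MemH0bsc A fun x => U n x - V n x := by
  have hQ := isOpen_cube A
  obtain ⟨a1, a2, a3, -⟩ := h n
  obtain ⟨b1, b2, b3, -⟩ := h' n
  refine ⟨(hU n).sub hQ (hV n), ?_, a2.sub b2 (hU n) (hV n),
    fun i hi s hs => (a3 i hi s hs).sub (b3 i hi s hs) (hU n) (hV n)⟩
  exact a1.sub b1 ((hU n).memLp hQ) ((hV n).memLp hQ) (memLp_weakD (by norm_num) (hU n) 2)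
    (memLp_weakD (by norm_num) (hV n) 2) (ae_eq_refl _) (weakD_sub_ae (hU n) (hV n) 2)

lemma MemH0bsc.sub {A : ℝ} {u v : E3 → ℝ} (h : MemH0bsc A u) (h' : MemH0bsc A v) :
    MemH0bsc A fun x => u x - v x := by
  have hQ := isOpen_cube A
  obtain ⟨a0, a1, a2, a3⟩ := h
  obtain ⟨b0, b1, b2, b3⟩ := h'
  refine ⟨a0.sub hQ b0, ?_, a2.sub b2 a0 b0, fun i hi s hs => (a3 i hi s hs).sub (b3 i hi s hs) a0 b0⟩
  exact a1.sub b1 (a0.memLp hQ) (b0.memLp hQ) (memLp_weakD (by norm_num) a0 2)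
    (memLp_weakD (by norm_num) b0 2) (ae_eq_refl _) (weakD_sub_ae a0 b0 2)

/-! ### Energy estimate for the minimizer -/

/-- Comparison of the minimizer with the exact competitor. Subtracting the two puts the error in the
homogeneous space, where the Carleman estimate applies: its residual is small, and its first
derivatives are bounded but not small. -/
lemma BoundaryConditions.energy {A b d K : ℝ} {N : ℕ} (hb : 0 < b)
    (h1 : ∀ j, matNorm A (coeffFirst A b d N j) ≤ K) (h0 : matNorm A (coeffZeroth A b d N) ≤ K)
    {φ₀' φ₁' U' F' F V : Fin N → E3 → ℝ} {δ : ℝ} (hδ : 0 < δ)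
    (hU : ∀ n, MemH 3 (cube A) (U' n))
    (hL : ∀ m, ∀ᵐ x ∂(volume.restrict (cube A)), opL A b d U' m x = 0)
    (hbU : BoundaryConditions A φ₀' φ₁' U') (hF' : ∀ n, MemH 3 (cube A) (F' n))
    (hbF : BoundaryConditions A φ₀' φ₁' F') (hF : ∀ n, MemH 3 (cube A) (F n))
    (hd : hNorm 2 (cube A) (fun n x => F n x - F' n x) ≤ δ)
    (hV : IsMinimizer A b d F (δ ^ 2) V) {M : ℝ} (hM1 : 1 ≤ M)
    (hM : hNorm 3 (cube A) U' ^ 2 + hNorm 3 (cube A) F' ^ 2 ≤ M ^ 2)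
    {W : Fin N → E3 → ℝ} (hW : W = fun n x => V n x - (U' n x - F' n x)) :
    (∀ n, MemH0bsc A (W n)) ∧
    ∫ x in cube A, ∑ m, opL A b d W m x ^ 2 ≤ (200 + 200 * K ^ 2) * (δ ^ 2 * M ^ 2) ∧
    ∫ x in cube A, density A W x ≤ (200 + 300 * K ^ 2) * M ^ 2 := by
  have hQ := isOpen_cube A
  set V' : Fin N → E3 → ℝ := fun n x => U' n x - F' n x with hV'
  set D : Fin N → E3 → ℝ := fun n x => F n x - F' n x with hD
  have mV' : ∀ n, MemH0bsc A (V' n) := hbU.memH0bsc_sub hbF hU hF'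
  have mV : ∀ n, MemH0bsc A (V n) := hV.1
  have mW : ∀ n, MemH0bsc A (W n) := fun n => by rw [hW]; exact (mV n).sub (mV' n)
  have sV' : ∀ n, MemH 3 (cube A) (V' n) := fun n => (mV' n).1
  have sV : ∀ n, MemH 3 (cube A) (V n) := fun n => (mV n).1
  have sD : ∀ n, MemH 3 (cube A) (D n) := fun n => (hF n).sub hQ (hF' n)
  set T : Fin N → E3 → ℝ := fun n x => V n x + F n x with hT
  set T' : Fin N → E3 → ℝ := fun n x => V' n x + F n x with hT'
  have sT : ∀ n, MemH 3 (cube A) (T n) := fun n => (sV n).add hQ (hF n)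
  have sT' : ∀ n, MemH 3 (cube A) (T' n) := fun n => (sV' n).add hQ (hF n)
  have int : ∀ {U : Fin N → E3 → ℝ}, (∀ n, MemH 3 (cube A) (U n)) →
      Integrable (fun x => ∑ m, opL A b d U m x ^ 2) (volume.restrict (cube A)) := fun hU =>
    integrable_sum_sq_opL hb (by norm_num) hU
  -- `V' + F = U' + (F - F')`, and `U'` solves the system.
  have eT' : ∀ᵐ x ∂volume.restrict (cube A), ∀ m, opL A b d T' m x = opL A b d D m x := by
    have e : T' = fun n x => U' n x + D n x := by
      ext n x; simp only [hT', hV', hD]; ring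
    rw [e]
    filter_upwards [opL_add_ae (b := b) (d := d) hU sD, ae_all_iff.2 hL] with x k1 k2 m
    rw [k1, k2, zero_add]
  have eW : ∀ᵐ x ∂volume.restrict (cube A), ∀ m,
      opL A b d W m x = opL A b d T m x - opL A b d T' m x := by
    rw [hW]
    filter_upwards [opL_sub_ae (b := b) (d := d) sV sV', opL_add_ae (b := b) (d := d) sV hF,
      opL_add_ae (b := b) (d := d) sV' hF] with x k1 k2 k3 m
    rw [k1, k2, k3]; ring
  have bD : ∫ x in cube A, ∑ m, opL A b d D m x ^ 2 ≤ (18 + 32 * K ^ 2) * δ ^ 2 := by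
    refine (integral_sum_sq_opL_le hb h1 h0 fun n => (sD n).mono (by norm_num)).trans ?_
    have := pow_le_pow_left₀ (hNorm_nonneg _ _ _) hd 2
    gcongr
  have bT' : ∫ x in cube A, ∑ m, opL A b d T' m x ^ 2 ≤ (18 + 32 * K ^ 2) * δ ^ 2 := by
    refine le_trans (le_of_eq (integral_congr_ae ?_)) bD
    filter_upwards [eT'] with x hx
    simp only [hx]
  have bV' : hNorm 3 (cube A) V' ^ 2 ≤ 2 * M ^ 2 := by
    have := sq_hNorm_sub_le hQ hU hF'
    linarith
  -- The competitor costs at most `(18 + 32 K²) δ²` in the residual and `2 δ² M²` in the penalty.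
  have hJ := hV.2 V' mV'
  unfold functionalJ at hJ
  have hM2 : 1 ≤ M ^ 2 := one_le_pow₀ hM1
  have p0 : 0 ≤ δ ^ 2 * (M ^ 2 - 1) := mul_nonneg (sq_nonneg _) (by linarith)
  have p1 : 0 ≤ K ^ 2 * (δ ^ 2 * (M ^ 2 - 1)) := mul_nonneg (sq_nonneg _) p0
  have p2 : 0 ≤ δ ^ 2 * M ^ 2 := by positivity
  have hE : (∫ x in cube A, ∑ m, opL A b d T m x ^ 2) + δ ^ 2 * hNorm 3 (cube A) V ^ 2 ≤
      (20 + 32 * K ^ 2) * (δ ^ 2 * M ^ 2) := by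
    have q := mul_le_mul_of_nonneg_left bV' (sq_nonneg δ)
    refine hJ.trans ?_
    linarith
  have nT : 0 ≤ ∫ x in cube A, ∑ m, opL A b d T m x ^ 2 :=
    integral_nonneg fun x => Finset.sum_nonneg fun _ _ => sq_nonneg _
  have nV : 0 ≤ δ ^ 2 * hNorm 3 (cube A) V ^ 2 := by positivity
  refine ⟨mW, ?_, ?_⟩
  · have : ∫ x in cube A, ∑ m, opL A b d W m x ^ 2 ≤
        2 * (∫ x in cube A, ∑ m, opL A b d T m x ^ 2)
          + 2 * ∫ x in cube A, ∑ m, opL A b d T' m x ^ 2 := by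
      rw [← integral_const_mul, ← integral_const_mul,
        ← integral_add ((int sT).const_mul 2) ((int sT').const_mul 2)]
      refine integral_mono_ae (int fun n => (mW n).1)
        (((int sT).const_mul 2).add ((int sT').const_mul 2)) ?_
      filter_upwards [eW] with x hx
      simp only [hx, sub_eq_add_neg]
      have := sum_sq_add_le Finset.univ (fun m => opL A b d T m x) fun m => -opL A b d T' m x
      simpa only [neg_sq] using this
    have p3 := mul_nonneg (sq_nonneg K) p2
    linarith
  -- The regularization parameter `δ²` has the same order as the minimal value, so dividing by it
  -- leaves an `H³` bound free of `δ`.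
  · have bV : hNorm 3 (cube A) V ^ 2 ≤ (20 + 32 * K ^ 2) * M ^ 2 := by
      refine le_of_mul_le_mul_left ?_ (by positivity : 0 < δ ^ 2)
      linarith
    have b1 := integral_density_le (k := 3) (by norm_num) fun n => (mW n).1
    have b2 : hNorm 3 (cube A) W ^ 2 ≤ 2 * hNorm 3 (cube A) V ^ 2 + 2 * hNorm 3 (cube A) V' ^ 2 := by
      rw [hW]; exact sq_hNorm_sub_le hQ sV sV'
    have p3 : 0 ≤ K ^ 2 * M ^ 2 := by positivity
    linarith

/-! ### The norm of `H²` away from the top face -/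

lemma multiIndices_two_cases {a : Fin 3 → ℕ} (h : a ∈ multiIndices 2) :
    a = 0 ∨ (∃ i, a = Pi.single i 1) ∨ ∃ i j, a = idx2 i j := by
  have key : ∀ a ∈ multiIndices 2, a = 0 ∨ (∃ i, a = Pi.single i 1) ∨ ∃ i j, a = idx2 i j := by
    decide
  exact key a h

/-- Weak derivatives on the subdomain agree almost everywhere with those on the cube. Each
multi-index contributes at most `R`, hence the cardinality. -/
lemma sq_hNorm_two_le {A ε R : ℝ} {N : ℕ} {W : Fin N → E3 → ℝ}
    (h : ∀ n, MemH 3 (cube A) (W n)) (hd : ∫ x in cubeEps A ε, density A W x ≤ R)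
    (h2 : ∀ i j, ∑ n, ∫ x in cubeEps A ε, weakDeriv (cube A) (idx2 i j) (W n) x ^ 2 ≤ R) :
    hNorm 2 (cubeEps A ε) W ^ 2 ≤ (multiIndices 2).card * R := by
  have hQ := isOpen_cube A
  have hQ' := isOpen_cubeEps A ε
  have hs := cubeEps_subset A ε
  have res : ∀ {f : E3 → ℝ}, Integrable f (volume.restrict (cube A)) →
      Integrable f (volume.restrict (cubeEps A ε)) := fun hf =>
    hf.mono_measure (Measure.restrict_mono hs le_rfl)
  have hle : ∀ a ∈ multiIndices 2,
      ∑ n, ∫ x in cubeEps A ε, weakDeriv (cubeEps A ε) a (W n) x ^ 2 ≤ R := by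
    intro a ha
    have ha2 := mem_multiIndices.1 ha
    have e : ∀ n, ∫ x in cubeEps A ε, weakDeriv (cubeEps A ε) a (W n) x ^ 2 =
        ∫ x in cubeEps A ε, weakDeriv (cube A) a (W n) x ^ 2 := fun n => by
      refine integral_congr_ae ?_
      filter_upwards [(h n).weakDeriv_restrict hQ hQ' hs (a := a) (by omega)] with x hx
      rw [hx]
    simp only [e]
    have iD := res (integrable_density (by norm_num) h)
    rcases multiIndices_two_cases ha with rfl | ⟨i, rfl⟩ | ⟨i, j, rfl⟩
    · have e0 : ∀ n, ∫ x in cubeEps A ε, weakDeriv (cube A) 0 (W n) x ^ 2 =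
          ∫ x in cubeEps A ε, W n x ^ 2 := fun n => by
        refine integral_congr_ae ?_
        filter_upwards [ae_mono (Measure.restrict_mono hs le_rfl)
          ((h n).weakDeriv_zero_ae hQ)] with x hx
        rw [hx]
      simp only [e0]
      rw [← integral_finsetSum _ fun n _ => res ((h n).memLp hQ).integrable_sq]
      refine le_trans (integral_mono (integrable_finsetSum _ fun n _ =>
        res ((h n).memLp hQ).integrable_sq) iD fun x => ?_) hd
      exact Finset.sum_le_sum fun n _ =>
        le_add_of_nonneg_left (Finset.sum_nonneg fun _ _ => sq_nonneg _)
    · have im : ∀ n, Integrable (fun x => weakDeriv (cube A) (Pi.single i 1) (W n) x ^ 2)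
          (volume.restrict (cubeEps A ε)) := fun n =>
        res (memLp_weakD (by norm_num) (h n) i).integrable_sq
      rw [← integral_finsetSum _ fun n _ => im n]
      refine le_trans (integral_mono (integrable_finsetSum _ fun n _ => im n) iD fun x => ?_) hd
      refine Finset.sum_le_sum fun n _ => ?_
      exact (Finset.single_le_sum (f := fun i => weakD (cube A) i (W n) x ^ 2)
        (fun _ _ => sq_nonneg _) (Finset.mem_univ i)).trans (le_add_of_nonneg_right (sq_nonneg _))
    · exact h2 i j
  rw [sq_hNorm]
  simp only [hNormSq]
  rw [Finset.sum_comm, ← nsmul_eq_mul]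
  exact Finset.sum_le_card_nsmul _ _ _ hle

/-! ### The reconstructed coefficient -/

lemma truncatedSeries_weakDeriv_ae {A d : ℝ} {N : ℕ} {U : Fin N → E3 → ℝ}
    (h : ∀ n, MemH 3 (cube A) (U n)) (s : ℝ) {a : Fin 3 → ℕ} (ha : ∑ i, a i ≤ 3) :
    weakDeriv (cube A) a (truncatedSeries d U s) =ᵐ[volume.restrict (cube A)]
      fun x => ∑ n : Fin N, psi d n s * weakDeriv (cube A) a (U n) x := by
  have e : truncatedSeries d U s = fun x => ∑ n : Fin N, psi d n s * U n x := by
    ext x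
    exact Finset.sum_congr rfl fun n _ => mul_comm _ _
  rw [e]
  exact (IsWeakDeriv.sum (isOpen_cube A) Finset.univ fun n _ =>
    (((h n).spec (isOpen_cube A) ha).1.const_mul (psi d n s))).weakDeriv_ae (isOpen_cube A)

/-- The reconstruction is linear up to null sets. Cauchy–Schwarz with `∑ Ψ_n(0)² ≤ K²` controls the
truncated series, and `|x - x₀|⁻² ≤ b⁻² ≤ K²` controls the coefficients. The factor `12 π²` is `(2
π)²` times the `3` from the square of three summands. -/
lemma sq_l2Norm_reconstruct_sub_le {A b d K ε : ℝ} (hb : 0 < b) {N : ℕ} (hbK : 1 / b ≤ K)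
    (hψ : Real.sqrt (∑ n : Fin N, psi d n 0 ^ 2) ≤ K) {T U : Fin N → E3 → ℝ}
    (hT : ∀ n, MemH 3 (cube A) (T n)) (hU : ∀ n, MemH 3 (cube A) (U n)) :
    l2Norm (cubeEps A ε) (fun x => reconstruct A b d 0 T x - reconstruct A b d 0 U x) ^ 2 ≤
      12 * Real.pi ^ 2 * (9 * K ^ 2 + 12 * K ^ 4 + 16 * K ^ 6) *
        hNorm 2 (cubeEps A ε) (fun n x => T n x - U n x) ^ 2 := by
  have hQ := isOpen_cube A
  have hQ' := isOpen_cubeEps A ε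
  have hs := cubeEps_subset A ε
  set G : Fin N → E3 → ℝ := fun n x => T n x - U n x with hG
  have sG : ∀ n, MemH 3 (cube A) (G n) := fun n => (hT n).sub hQ (hU n)
  have hK0 : 0 < K := lt_of_lt_of_le (by positivity) hbK
  have hψ2 : ∑ n : Fin N, psi d n 0 ^ 2 ≤ K ^ 2 := by
    have := pow_le_pow_left₀ (Real.sqrt_nonneg _) hψ 2
    rwa [Real.sq_sqrt (Finset.sum_nonneg fun _ _ => sq_nonneg _)] at this
  have cs : ∀ y : Fin N → ℝ, (∑ n : Fin N, psi d n 0 * y n) ^ 2 ≤ K ^ 2 * ∑ n, y n ^ 2 :=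
    fun y => (Finset.sum_mul_sq_le_sq_mul_sq _ _ _).trans
      (mul_le_mul_of_nonneg_right hψ2 (Finset.sum_nonneg fun _ _ => sq_nonneg _))
  -- the difference in terms of the difference of the arguments
  have lin : ∀ {a : Fin 3 → ℕ}, ∑ i, a i ≤ 3 → ∀ᵐ x ∂volume.restrict (cube A),
      weakDeriv (cube A) a (truncatedSeries d T 0) x
        - weakDeriv (cube A) a (truncatedSeries d U 0) x =
      ∑ n : Fin N, psi d n 0 * weakDeriv (cube A) a (G n) x := by
    intro a ha
    have e := ae_all_iff.2 fun n => (hT n).weakDeriv_sub hQ (hU n) ha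
    filter_upwards [truncatedSeries_weakDeriv_ae (d := d) hT 0 ha,
      truncatedSeries_weakDeriv_ae (d := d) hU 0 ha, e] with x e1 e2 e3
    simp only [e1, e2, e3, mul_sub, Finset.sum_sub_distrib, hG]
  have lin1 := ae_all_iff.2 fun i : Fin 3 => lin (a := Pi.single i 1) (by simp)
  have lin2 := ae_all_iff.2 fun i : Fin 3 => lin (a := Pi.single i 2) (by simp)
  set R : E3 → ℝ := fun x => 12 * Real.pi ^ 2 *
    (3 * K ^ 2 * (∑ i, ∑ n, weakDeriv (cube A) (Pi.single i 2) (G n) x ^ 2)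
      + 4 * K ^ 4 * (∑ i, ∑ n, weakDeriv (cube A) (Pi.single i 1) (G n) x ^ 2)
      + 16 * K ^ 6 * ∑ n, G n x ^ 2) with hR
  have pw : ∀ᵐ x ∂volume.restrict (cubeEps A ε),
      (reconstruct A b d 0 T x - reconstruct A b d 0 U x) ^ 2 ≤ R x := by
    filter_upwards [ae_mono (Measure.restrict_mono hs le_rfl) lin1,
      ae_mono (Measure.restrict_mono hs le_rfl) lin2, ae_restrict_mem hQ'.measurableSet]
      with x l1 l2 hx
    have hr := le_norm_sub_source_sq hb 0 (cube_subset_closedCube A (hs hx))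
    set y := x - source A b 0 with hy
    set r2 := ‖y‖ ^ 2 with hr2
    have hr0 : 0 < r2 := lt_of_lt_of_le (by positivity) hr
    have hrK : 1 / r2 ≤ K ^ 2 := by
      calc 1 / r2 ≤ 1 / b ^ 2 := one_div_le_one_div_of_le (by positivity) hr
        _ = (1 / b) ^ 2 := by rw [one_div_pow]
        _ ≤ K ^ 2 := pow_le_pow_left₀ (by positivity) hbK 2
    have hy2 : r2 = ∑ j, y j ^ 2 := EuclideanSpace.real_norm_sq_eq y
    set L : Fin 3 → ℝ := fun i => ∑ n : Fin N, psi d n 0 * weakDeriv (cube A) (Pi.single i 2) (G n) x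
      with hL
    set E : Fin 3 → ℝ := fun i => ∑ n : Fin N, psi d n 0 * weakDeriv (cube A) (Pi.single i 1) (G n) x
      with hE
    set Z : ℝ := ∑ n : Fin N, psi d n 0 * G n x with hZ
    have eZ : truncatedSeries d T 0 x - truncatedSeries d U 0 x = Z := by
      simp only [truncatedSeries, hZ, hG, mul_sub, Finset.sum_sub_distrib]
      congr 1 <;> exact Finset.sum_congr rfl fun n _ => mul_comm _ _
    have e : reconstruct A b d 0 T x - reconstruct A b d 0 U x =
        -(2 * Real.pi) * ((∑ i, L i) + -(2 * (1 / r2) * ∑ j, y j * E j) + 4 * (1 / r2) * Z) := by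
      simp only [reconstruct, weakLaplacian, weakD]
      rw [← eZ, ← hy, ← hr2]
      simp only [hL, hE, ← l1, ← l2, Fin.sum_univ_three]
      ring
    have cL : ∀ i, L i ^ 2 ≤ K ^ 2 * ∑ n, weakDeriv (cube A) (Pi.single i 2) (G n) x ^ 2 :=
      fun i => cs _
    have cE : ∀ i, E i ^ 2 ≤ K ^ 2 * ∑ n, weakDeriv (cube A) (Pi.single i 1) (G n) x ^ 2 :=
      fun i => cs _
    have cZ : Z ^ 2 ≤ K ^ 2 * ∑ n, G n x ^ 2 := cs _
    have k1 : (∑ i, L i) ^ 2 ≤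
        3 * K ^ 2 * (∑ i, ∑ n, weakDeriv (cube A) (Pi.single i 2) (G n) x ^ 2) := by
      refine sq_sum_le_card_mul_sum_sq.trans ?_
      have : ∑ i, L i ^ 2 ≤
          ∑ i, K ^ 2 * ∑ n, weakDeriv (cube A) (Pi.single i 2) (G n) x ^ 2 :=
        Finset.sum_le_sum fun i _ => cL i
      rw [← Finset.mul_sum] at this
      simp only [Finset.card_univ, Fintype.card_fin]
      push_cast
      linarith
    -- Cauchy–Schwarz in the three coordinates produces `|x - x₀|²`, which cancels one of the two
    -- inverse factors; hence the power `K⁴` and no bound on `|x - x₀|` from above.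
    have k2 : (-(2 * (1 / r2) * ∑ j, y j * E j)) ^ 2 ≤
        4 * K ^ 4 * (∑ i, ∑ n, weakDeriv (cube A) (Pi.single i 1) (G n) x ^ 2) := by
      have c1 : (∑ j, y j * E j) ^ 2 ≤ r2 * ∑ j, E j ^ 2 := by
        rw [hy2]; exact Finset.sum_mul_sq_le_sq_mul_sq _ _ _
      have c2 : ∑ i, E i ^ 2 ≤
          K ^ 2 * ∑ i, ∑ n, weakDeriv (cube A) (Pi.single i 1) (G n) x ^ 2 := by
        rw [Finset.mul_sum]
        exact Finset.sum_le_sum fun i _ => cE i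
      have c3 : (-(2 * (1 / r2) * ∑ j, y j * E j)) ^ 2 =
          4 * (1 / r2) ^ 2 * (∑ j, y j * E j) ^ 2 := by ring
      rw [c3]
      calc 4 * (1 / r2) ^ 2 * (∑ j, y j * E j) ^ 2
          ≤ 4 * (1 / r2) ^ 2 * (r2 * ∑ j, E j ^ 2) := by gcongr
        _ = 4 * (1 / r2) * ∑ j, E j ^ 2 := by field_simp
        _ ≤ 4 * K ^ 2 * (K ^ 2 * ∑ i, ∑ n, weakDeriv (cube A) (Pi.single i 1) (G n) x ^ 2) := by
          gcongr
        _ = _ := by ring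
    have k3 : (4 * (1 / r2) * Z) ^ 2 ≤ 16 * K ^ 6 * ∑ n, G n x ^ 2 := by
      calc (4 * (1 / r2) * Z) ^ 2 = 16 * (1 / r2) ^ 2 * Z ^ 2 := by ring
        _ ≤ 16 * (K ^ 2) ^ 2 * (K ^ 2 * ∑ n, G n x ^ 2) := by gcongr
        _ = _ := by ring
    have three : ∀ p q r : ℝ, (p + q + r) ^ 2 ≤ 3 * (p ^ 2 + q ^ 2 + r ^ 2) := fun p q r => by
      nlinarith [sq_nonneg (p - q), sq_nonneg (p - r), sq_nonneg (q - r)]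
    rw [e, mul_pow]
    calc (-(2 * Real.pi)) ^ 2 * ((∑ i, L i) + -(2 * (1 / r2) * ∑ j, y j * E j)
          + 4 * (1 / r2) * Z) ^ 2
        ≤ (-(2 * Real.pi)) ^ 2 * (3 * ((∑ i, L i) ^ 2 + (-(2 * (1 / r2) * ∑ j, y j * E j)) ^ 2
          + (4 * (1 / r2) * Z) ^ 2)) := by gcongr; exact three _ _ _
      _ ≤ (-(2 * Real.pi)) ^ 2 * (3 *
          (3 * K ^ 2 * (∑ i, ∑ n, weakDeriv (cube A) (Pi.single i 2) (G n) x ^ 2)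
          + 4 * K ^ 4 * (∑ i, ∑ n, weakDeriv (cube A) (Pi.single i 1) (G n) x ^ 2)
          + 16 * K ^ 6 * ∑ n, G n x ^ 2)) := by gcongr
      _ = R x := by rw [hR]; ring
  have iw : ∀ (a : Fin 3 → ℕ), ∑ i, a i ≤ 3 → ∀ n,
      Integrable (fun x => weakDeriv (cube A) a (G n) x ^ 2) (volume.restrict (cubeEps A ε)) :=
    fun a ha n => (((sG n).spec hQ ha).2.mono_measure
      (Measure.restrict_mono hs le_rfl)).integrable_sq
  have i2 : Integrable (fun x => 3 * K ^ 2 *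
      (∑ i, ∑ n, weakDeriv (cube A) (Pi.single i 2) (G n) x ^ 2))
      (volume.restrict (cubeEps A ε)) :=
    (integrable_finsetSum _ fun i _ => integrable_finsetSum _ fun n _ =>
      iw _ (by simp) n).const_mul _
  have i1 : Integrable (fun x => 4 * K ^ 4 *
      (∑ i, ∑ n, weakDeriv (cube A) (Pi.single i 1) (G n) x ^ 2))
      (volume.restrict (cubeEps A ε)) :=
    (integrable_finsetSum _ fun i _ => integrable_finsetSum _ fun n _ =>
      iw _ (by simp) n).const_mul _
  have i0n : ∀ n, Integrable (fun x => G n x ^ 2) (volume.restrict (cubeEps A ε)) := fun n =>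
    (((sG n).memLp hQ).mono_measure (Measure.restrict_mono hs le_rfl)).integrable_sq
  have i0 : Integrable (fun x => 16 * K ^ 6 * ∑ n, G n x ^ 2) (volume.restrict (cubeEps A ε)) :=
    (integrable_finsetSum _ fun n _ => i0n n).const_mul _
  have i12 : Integrable (fun x => 3 * K ^ 2 *
      (∑ i, ∑ n, weakDeriv (cube A) (Pi.single i 2) (G n) x ^ 2) + 4 * K ^ 4 *
      (∑ i, ∑ n, weakDeriv (cube A) (Pi.single i 1) (G n) x ^ 2))
      (volume.restrict (cubeEps A ε)) := i2.add i1
  have hsum : ∀ (a : Fin 3 → ℕ), ∑ i, a i ≤ 2 →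
      ∫ x in cubeEps A ε, ∑ n, weakDeriv (cube A) a (G n) x ^ 2 ≤
        hNorm 2 (cubeEps A ε) G ^ 2 := by
    intro a ha
    rw [integral_finsetSum _ fun n _ => iw a (by omega) n, sq_hNorm]
    refine Finset.sum_le_sum fun n _ => ?_
    refine le_trans (le_of_eq ?_) (integral_sq_le_hNormSq (cubeEps A ε) (G n) ha)
    refine integral_congr_ae ?_
    filter_upwards [(sG n).weakDeriv_restrict hQ hQ' hs (a := a) (by omega)] with x hx
    rw [hx]
  rw [l2Norm, Real.sq_sqrt (integral_nonneg fun x => sq_nonneg _)]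
  refine (integral_mono_of_nonneg (ae_of_all _ fun x => sq_nonneg _)
    ((i12.add i0).const_mul (12 * Real.pi ^ 2)) pw).trans ?_
  have split : ∫ x in cubeEps A ε, R x = 12 * Real.pi ^ 2 * (3 * K ^ 2 *
      (∑ i, ∫ x in cubeEps A ε, ∑ n, weakDeriv (cube A) (Pi.single i 2) (G n) x ^ 2)
      + 4 * K ^ 4 *
      (∑ i, ∫ x in cubeEps A ε, ∑ n, weakDeriv (cube A) (Pi.single i 1) (G n) x ^ 2)
      + 16 * K ^ 6 * ∫ x in cubeEps A ε, ∑ n, G n x ^ 2) := by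
    rw [hR, integral_const_mul, integral_add i12 i0, integral_add i2 i1, integral_const_mul,
      integral_const_mul, integral_const_mul,
      integral_finsetSum _ fun i _ => integrable_finsetSum _ fun n _ => iw _ (by simp) n,
      integral_finsetSum _ fun i _ => integrable_finsetSum _ fun n _ => iw _ (by simp) n]
  have b0 : ∫ x in cubeEps A ε, ∑ n, G n x ^ 2 ≤ hNorm 2 (cubeEps A ε) G ^ 2 := by
    rw [integral_finsetSum _ fun n _ => i0n n, sq_hNorm]
    exact Finset.sum_le_sum fun n _ =>
      (((sG n).restrict hQ hs).mono (by norm_num)).integral_sq_le hQ'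
  have b1 := fun i : Fin 3 => hsum (Pi.single i 1) (by simp)
  have b2 := fun i : Fin 3 => hsum (Pi.single i 2) (by simp)
  refine split.le.trans ?_
  set H := hNorm 2 (cubeEps A ε) G ^ 2
  have s1 : ∑ i, ∫ x in cubeEps A ε, ∑ n, weakDeriv (cube A) (Pi.single i 1) (G n) x ^ 2 ≤ 3 * H := by
    rw [Fin.sum_univ_three]; linarith [b1 0, b1 1, b1 2]
  have s2 : ∑ i, ∫ x in cubeEps A ε, ∑ n, weakDeriv (cube A) (Pi.single i 2) (G n) x ^ 2 ≤ 3 * H := by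
    rw [Fin.sum_univ_three]; linarith [b2 0, b2 1, b2 2]
  calc _ ≤ 12 * Real.pi ^ 2 * (3 * K ^ 2 * (3 * H) + 4 * K ^ 4 * (3 * H) + 16 * K ^ 6 * H) := by
        gcongr
    _ = _ := by ring

/-! ### The convergence rate -/

/-- The exponent of the convergence rate in the domain `cubeEps A ε`. -/
def rateExponent (A ε : ℝ) : ℝ :=
  ((1 + ε / 2) ^ 2 - (1 + ε / 4) ^ 2) / (4 * (2 * A + 1) ^ 2)

/-- The upper bound `1 / 4` ensures `δ ≤ δ^(4α)` for `δ < 1`, so the terms of order `δ` and `δ²` are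
dominated by the exponentially decaying one. -/
lemma rateExponent_mem {A ε : ℝ} (h : ε ∈ Ioo 0 A) : rateExponent A ε ∈ Ioo 0 (1 / 4) := by
  obtain ⟨h0, hA⟩ := h
  have hD : 0 < 4 * (2 * A + 1) ^ 2 := by have : 0 < A := h0.trans hA; positivity
  refine ⟨div_pos (by nlinarith) hD, ?_⟩
  rw [rateExponent, div_lt_iff₀ hD]
  nlinarith

/-- The error estimate with an unspecified constant, in squared form. -/
lemma exists_error_estimate {A ε : ℝ} (h : ε ∈ Ioo 0 A) (K : ℝ) :
    ∃ C δ₁ : ℝ, 0 < C ∧ 0 < δ₁ ∧ ∀ (b d : ℝ) (N : ℕ), 0 < b →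
      (∀ j, matNorm A (coeffFirst A b d N j) ≤ K) → matNorm A (coeffZeroth A b d N) ≤ K →
      ∀ (φ₀' φ₁' U' F' F V : Fin N → E3 → ℝ) (δ : ℝ), 0 < δ → δ < 1 → δ ≤ δ₁ →
      (∀ n, MemH 3 (cube A) (U' n)) →
      (∀ m, ∀ᵐ x ∂(volume.restrict (cube A)), opL A b d U' m x = 0) →
      BoundaryConditions A φ₀' φ₁' U' → (∀ n, MemH 3 (cube A) (F' n)) →
      BoundaryConditions A φ₀' φ₁' F' → (∀ n, MemH 3 (cube A) (F n)) →
      hNorm 2 (cube A) (fun n x => F n x - F' n x) ≤ δ → IsMinimizer A b d F (δ ^ 2) V →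
      hNorm 2 (cubeEps A ε) (fun n x => (V n x + F n x) - U' n x) ^ 2 ≤
        C * (1 + hNorm 3 (cube A) U' + hNorm 3 (cube A) F') ^ 2 * δ ^ (4 * rateExponent A ε) := by
  have hα := rateExponent_mem h
  obtain ⟨h0, hεA⟩ := h
  have hA : 0 < A := h0.trans hεA
  -- The layers are nested: the first cutoff varies above `A - ε / 4`, first derivatives are
  -- controlled below `A - ε / 2`, and second derivatives below `A - ε`.
  obtain ⟨C1, l₀, hC1, hl₀, first⟩ :=
    exists_first_order_estimate (ε := ε / 2) (ε' := ε / 4) hA (by linarith) (by linarith) K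
  obtain ⟨C2, hC2, second⟩ :=
    exists_second_order_estimate (ε := ε) (ε' := ε / 2) hA (by linarith) (by linarith) K
  set D : ℝ := (2 * A + 1) ^ 2 with hD
  have hD0 : 0 < D := by positivity
  set c : ℝ := 200 + 300 * K ^ 2 with hc
  have hc0 : 0 < c := by positivity
  set R : ℝ := 2 * C1 * c + C2 * (c + 2 * C1 * c) with hR
  have hR0 : 0 < R := by positivity
  set α := rateExponent A ε with hαdef
  -- The threshold for `δ` is exactly what makes the parameter `l` chosen below at least `l₀`.
  refine ⟨2 * ((multiIndices 2).card * R) + 2, Real.exp (-(2 * D * l₀)), by positivity,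
    Real.exp_pos _, ?_⟩
  intro b d N hb hk1 hk0 φ₀' φ₁' U' F' F V δ hδ hδ1 hδ₁ hU hL hbU hF' hbF hF hd hV
  have nU := hNorm_nonneg 3 (cube A) U'
  have nF := hNorm_nonneg 3 (cube A) F'
  set M : ℝ := 1 + hNorm 3 (cube A) U' + hNorm 3 (cube A) F' with hM
  have hM1 : 1 ≤ M := by linarith
  have hM2 : hNorm 3 (cube A) U' ^ 2 + hNorm 3 (cube A) F' ^ 2 ≤ M ^ 2 := by
    rw [hM]; nlinarith [mul_nonneg nU nF]
  set W : Fin N → E3 → ℝ := fun n x => V n x - (U' n x - F' n x) with hW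
  obtain ⟨mW, eL, eD⟩ := BoundaryConditions.energy hb hk1 hk0 hδ hU hL hbU hF' hbF hF hd hV hM1
    hM2 hW
  set P : ℝ := δ ^ (4 * α) with hP
  have hP0 : 0 < P := Real.rpow_pos_of_pos hδ _
  have hδP : δ ≤ P := by
    calc δ = δ ^ (1 : ℝ) := (Real.rpow_one δ).symm
      _ ≤ P := Real.rpow_le_rpow_of_exponent_ge hδ hδ1.le (by linarith [hα.2])
  have hδ2 : δ ^ 2 ≤ δ := by nlinarith
  have hlog : Real.log δ ≤ -(2 * D * l₀) := by
    rw [← Real.log_exp (-(2 * D * l₀))]; exact Real.log_le_log hδ hδ₁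
  -- With this `l` the growing exponential is `δ⁻¹`, leaving one power of `δ` from the squared
  -- residual `δ²`, and the decaying exponential is `δ^(4α)` by the definition of `rateExponent`.
  set l : ℝ := -Real.log δ / (2 * D) with hl
  have hll : l₀ ≤ l := by rw [hl, le_div_iff₀ (by positivity)]; linarith
  have e1 : Real.exp (2 * l * D) = δ⁻¹ := by
    rw [show 2 * l * D = -Real.log δ by rw [hl]; field_simp, Real.exp_neg, Real.exp_log hδ]
  have e2 : Real.exp (-(2 * l * ((1 + ε / 2) ^ 2 - (1 + ε / 4) ^ 2))) = P := by
    rw [hP, Real.rpow_def_of_pos hδ]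
    congr 1
    rw [hαdef, rateExponent, hl, ← hD]
    field_simp
  have b1 := first b d N hb hk1 hk0 W mW l hll
  rw [e1, e2] at b1
  have eL' : ∫ x in cube A, ∑ m, opL A b d W m x ^ 2 ≤ c * (δ ^ 2 * M ^ 2) :=
    eL.trans (mul_le_mul_of_nonneg_right (by rw [hc]; nlinarith [sq_nonneg K]) (by positivity))
  have b1' : ∫ x in cubeEps A (ε / 2), density A W x ≤ 2 * C1 * c * (M ^ 2 * P) := by
    refine b1.trans ?_
    have q1 : δ⁻¹ * (∫ x in cube A, ∑ m, opL A b d W m x ^ 2) ≤ c * (M ^ 2 * P) := by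
      calc δ⁻¹ * (∫ x in cube A, ∑ m, opL A b d W m x ^ 2)
          ≤ δ⁻¹ * (c * (δ ^ 2 * M ^ 2)) := by gcongr
        _ = c * (M ^ 2 * δ) := by field_simp
        _ ≤ c * (M ^ 2 * P) := by gcongr
    have q2 : P * (∫ x in cube A, density A W x) ≤ c * (M ^ 2 * P) := by
      calc P * (∫ x in cube A, density A W x) ≤ P * (c * M ^ 2) := by gcongr
        _ = c * (M ^ 2 * P) := by ring
    calc _ ≤ C1 * (c * (M ^ 2 * P) + c * (M ^ 2 * P)) := by gcongr
      _ = _ := by ring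
  have iD := integrable_density (by norm_num) fun n => (mW n).1
  have b0 : ∫ x in cubeEps A ε, density A W x ≤ R * (M ^ 2 * P) := by
    have hsub : cubeEps A ε ⊆ cubeEps A (ε / 2) := fun x hx => ⟨hx.1, by linarith [hx.2]⟩
    refine ((setIntegral_mono_set (iD.mono_measure (Measure.restrict_mono (cubeEps_subset A _)
      le_rfl)) (ae_of_all _ (density_nonneg A W)) hsub.eventuallyLE).trans b1').trans ?_
    refine mul_le_mul_of_nonneg_right ?_ (by positivity)
    rw [hR]
    exact le_add_of_nonneg_right (by positivity)
  have b2 : ∀ i j, ∑ n, ∫ x in cubeEps A ε, weakDeriv (cube A) (idx2 i j) (W n) x ^ 2 ≤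
      R * (M ^ 2 * P) := fun i j => by
    refine (second b d N hb hk1 hk0 W mW i j).trans ?_
    calc _ ≤ C2 * (c * (δ ^ 2 * M ^ 2) + 2 * C1 * c * (M ^ 2 * P)) := by gcongr
      _ ≤ C2 * (c * (P * M ^ 2) + 2 * C1 * c * (M ^ 2 * P)) := by
        have := hδ2.trans hδP
        gcongr
      _ = C2 * (c + 2 * C1 * c) * (M ^ 2 * P) := by ring
      _ ≤ R * (M ^ 2 * P) := by
        refine mul_le_mul_of_nonneg_right ?_ (by positivity)
        rw [hR]
        exact le_add_of_nonneg_left (by positivity)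
  have bW := sq_hNorm_two_le (fun n => (mW n).1) b0 b2
  have hQ := isOpen_cube A
  have hQ' := isOpen_cubeEps A ε
  have hs := cubeEps_subset A ε
  have sG : ∀ n, MemH 2 (cube A) fun x => F n x - F' n x := fun n =>
    ((hF n).sub hQ (hF' n)).mono (by norm_num)
  have bG : hNorm 2 (cubeEps A ε) (fun n x => F n x - F' n x) ^ 2 ≤ P * M ^ 2 := by
    calc hNorm 2 (cubeEps A ε) (fun n x => F n x - F' n x) ^ 2
        ≤ hNorm 2 (cube A) (fun n x => F n x - F' n x) ^ 2 := by
          rw [sq_hNorm, sq_hNorm]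
          exact Finset.sum_le_sum fun n _ => hNormSq_restrict_le hQ hQ' hs (sG n)
      _ ≤ δ ^ 2 := pow_le_pow_left₀ (hNorm_nonneg _ _ _) hd 2
      _ ≤ P := hδ2.trans hδP
      _ ≤ P * M ^ 2 := le_mul_of_one_le_right hP0.le (one_le_pow₀ hM1)
  have e : (fun n x => (V n x + F n x) - U' n x) = fun n x => W n x + (F n x - F' n x) := by
    funext n x
    simp only [hW]
    ring
  rw [e]
  have := sq_hNorm_add_le hQ' (fun n => ((mW n).1.restrict hQ hs).mono (by norm_num : 2 ≤ 3))
    fun n => (sG n).restrict hQ hs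
  refine this.trans ?_
  calc _ ≤ 2 * ((multiIndices 2).card * (R * (M ^ 2 * P))) + 2 * (P * M ^ 2) := by gcongr
    _ = _ := by ring

end Lavrentev

end

/-! ### The convergence theorem: absorbing the constants -/

theorem theorem7p3 (A : ℝ) (hA : 0 < A) :
    ∃ α : ℝ → ℝ, (∀ ε ∈ Set.Ioo 0 A, α ε ∈ Set.Ioo (0 : ℝ) (1 / 2)) ∧
    ∀ K : ℝ, ∃ B : ℝ, 0 < B ∧
    ∀ ε ∈ Set.Ioo 0 A, ∃ δ₀ ∈ Set.Ioo (0 : ℝ) 1,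
    ∀ (b d : ℝ) (N : ℕ), 0 < b → 0 < d →
      (∀ j, Lavrentev.matNorm A (Lavrentev.coeffFirst A b d N j) ≤ K) →
      Lavrentev.matNorm A (Lavrentev.coeffZeroth A b d N) ≤ K →
    ∀ (φ₀' φ₁' φ₀ φ₁ U' F' F V : Fin N → Lavrentev.E3 → ℝ) (δ : ℝ), δ ∈ Set.Ioo 0 δ₀ →
      (∀ n, Lavrentev.MemH 3 (Lavrentev.cube A) (U' n)) →
      (∀ m, ∀ᵐ x ∂(MeasureTheory.volume.restrict (Lavrentev.cube A)),
        Lavrentev.opL A b d U' m x = 0) →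
      Lavrentev.BoundaryConditions A φ₀' φ₁' U' →
      (∀ n, Lavrentev.MemH 3 (Lavrentev.cube A) (F' n)) →
      Lavrentev.BoundaryConditions A φ₀' φ₁' F' →
      (∀ n, Lavrentev.MemH 3 (Lavrentev.cube A) (F n)) →
      Lavrentev.BoundaryConditions A φ₀ φ₁ F →
      Lavrentev.hNorm 2 (Lavrentev.cube A) (fun n x => F n x - F' n x) ≤ δ →
      Lavrentev.IsMinimizer A b d F (δ ^ 2) V →
      Lavrentev.hNorm 2 (Lavrentev.cubeEps A ε) (fun n x => (V n x + F n x) - U' n x) ≤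
          B * (1 + Lavrentev.hNorm 3 (Lavrentev.cube A) U'
            + Lavrentev.hNorm 3 (Lavrentev.cube A) F') * δ ^ α ε ∧
      (1 / b ≤ K → Real.sqrt (∑ n : Fin N, Lavrentev.psi d n 0 ^ 2) ≤ K →
        Lavrentev.l2Norm (Lavrentev.cubeEps A ε)
            (fun x => Lavrentev.reconstruct A b d 0 (fun n x => V n x + F n x) x
              - Lavrentev.reconstruct A b d 0 U' x) ≤
          B * (1 + Lavrentev.hNorm 3 (Lavrentev.cube A) U'
            + Lavrentev.hNorm 3 (Lavrentev.cube A) F') * δ ^ α ε) := by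
  -- The constant `B` is chosen before `ε`, while the constant of the error estimate depends on `ε`.
  -- That constant is absorbed into the spare power of `δ`, so `B = 1` works.
  refine ⟨Lavrentev.rateExponent A, fun ε hε => ?_, fun K => ⟨1, one_pos, fun ε hε => ?_⟩⟩
  · have := Lavrentev.rateExponent_mem hε
    exact ⟨this.1, this.2.trans (by norm_num)⟩
  have hα := (Lavrentev.rateExponent_mem hε).1
  obtain ⟨C, δ₁, hC, hδ₁, est⟩ := Lavrentev.exists_error_estimate hε K
  set α := Lavrentev.rateExponent A ε
  set c : ℝ := 12 * Real.pi ^ 2 * (9 * K ^ 2 + 12 * K ^ 4 + 16 * K ^ 6) with hc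
  have hc0 : 0 ≤ c := by positivity
  have hX : 0 < (1 + c) * C := by positivity
  -- The solution of `(1 + c) C δ₂^(2α) = 1`. The squared error has rate `δ^(4α)`: one factor
  -- `δ^(2α)` cancels the constants and the other is the square of the claimed rate. The factor `1 +
  -- c` serves the vector and the coefficient simultaneously.
  set δ₂ : ℝ := ((1 + c) * C) ^ (-(1 / (2 * α))) with hδ₂
  have hδ₂0 : 0 < δ₂ := Real.rpow_pos_of_pos hX _
  have hδ₂1 : (1 + c) * C * δ₂ ^ (2 * α) = 1 := by
    rw [hδ₂, ← Real.rpow_mul hX.le, show -(1 / (2 * α)) * (2 * α) = -1 by field_simp,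
      Real.rpow_neg_one, mul_inv_cancel₀ hX.ne']
  refine ⟨min (1 / 2) (min δ₁ δ₂), ⟨by positivity,
    (min_le_left _ _).trans_lt (by norm_num)⟩, ?_⟩
  intro b d N hb _ h1 h0 φ₀' φ₁' φ₀ φ₁ U' F' F V δ hδ hU hL hbU hF' hbF hF _ hd hV
  obtain ⟨hδ0, hδlt⟩ := hδ
  obtain ⟨d1, d2⟩ := lt_min_iff.1 hδlt
  obtain ⟨d2, d3⟩ := lt_min_iff.1 d2
  have main := est b d N hb h1 h0 φ₀' φ₁' U' F' F V δ hδ0 (by linarith) d2.le hU hL hbU hF' hbF hF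
    hd hV
  have nU := Lavrentev.hNorm_nonneg 3 (Lavrentev.cube A) U'
  have nF := Lavrentev.hNorm_nonneg 3 (Lavrentev.cube A) F'
  set M : ℝ := 1 + Lavrentev.hNorm 3 (Lavrentev.cube A) U'
    + Lavrentev.hNorm 3 (Lavrentev.cube A) F' with hM
  have hM0 : 0 ≤ M := by positivity
  set p : ℝ := δ ^ α with hp
  have hp0 : 0 < p := Real.rpow_pos_of_pos hδ0 _
  have hp2 : δ ^ (2 * α) = p ^ 2 := by
    rw [hp, mul_comm, Real.rpow_mul hδ0.le, Real.rpow_ofNat]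
  have hp4 : δ ^ (4 * α) = p ^ 2 * p ^ 2 := by
    rw [← hp2, ← Real.rpow_add hδ0]
    congr 1
    ring
  have small : (1 + c) * C * p ^ 2 ≤ 1 := by
    refine le_of_le_of_eq ?_ hδ₂1
    rw [← hp2]
    gcongr
  rw [hp4] at main
  set H := Lavrentev.hNorm 2 (Lavrentev.cubeEps A ε) (fun n x => (V n x + F n x) - U' n x)
  have bound : (1 + c) * H ^ 2 ≤ (M * p) ^ 2 := by
    calc (1 + c) * H ^ 2 ≤ (1 + c) * (C * M ^ 2 * (p ^ 2 * p ^ 2)) := by gcongr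
      _ = ((1 + c) * C * p ^ 2) * (M * p) ^ 2 := by ring
      _ ≤ 1 * (M * p) ^ 2 := by gcongr
      _ = (M * p) ^ 2 := one_mul _
  rw [one_mul]
  refine ⟨le_of_sq_le_sq ?_ (by positivity), fun hbK hψ => le_of_sq_le_sq ?_ (by positivity)⟩
  · nlinarith [mul_nonneg hc0 (sq_nonneg H)]
  · refine (Lavrentev.sq_l2Norm_reconstruct_sub_le hb hbK hψ
      (fun n => (hV.1 n).1.add (Lavrentev.isOpen_cube A) (hF n)) hU).trans ?_
    rw [← hc]
    nlinarith [sq_nonneg H]
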